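/- Let $m,n$ be positive integers and let $G=\langle a,b \mid a^m=b^n\rangle$ be the torus knot group. Then $G$ has a logspace normal form, with respect to every finite symmetric generating set. That is, let $X$ be a finite alphabet together with a map $X\to G$ whose image is closed under inversion and generates $G$ (for example $X=\{a,a^{-1},b,b^{-1}\}$), and for a word $w\in X^*$ let $\overline{w}\in G$ denote the element that it represents. Then there are a set $L\subseteq X^*$ that is mapped bijectively onto $G$ by $w\mapsto\overline{w}$, and a logspace computable function $f:X^*\to X^*$ such that $f(w)\in L$ and $\overline{f(w)}=\overline{w}$ for every $w\in X^*$. Here a function $f:X^*\to Y^*$ between words over finite alphabets is logspace computable if it is computed by a deterministic Turing machine with a finite state control, a two-way read-only input tape, a read-write work tape of which at most $c(\lfloor\log_2 \ell\rfloor+1)$ squares are used on inputs of length $\ell\ge 1$ (at most $c$ squares on the empty input), for a constant $c$, and a write-only output tape that is written from left to right, a bounded number of letters in each transition. -/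

import Mathlib

/-- What the input head scans: a letter of the input word, or the marker delimiting the word on
its left or on its right. -/
inductive InputSymbol (X : Type) : Type where
  | leftEnd : InputSymbol X
  | letter (x : X) : InputSymbol X
  | rightEnd : InputSymbol X

/-- Possible movements of a head in one transition. -/
inductive HeadMove : Type where
  | left : HeadMove
  | stay : HeadMove
  | right : HeadMove

/-- The new position of a head on the squares `0, 1, 2, …` (a left move on square `0` has no
effect). -/
def HeadMove.apply : HeadMove → ℕ → ℕ
  | left, i => i - 1
  | stay, i => i
  | right, i => i + 1

/-- What a transition does: the new state, the symbol written on the scanned work square, the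
movements of the input head and of the work head, and the (finitely many) letters appended to the
output tape. -/
structure TransducerAction (Y State Work : Type) : Type where
  nextState : State
  writeWork : Work
  moveInput : HeadMove
  moveWork : HeadMove
  print : List Y

/-- A deterministic transducer with a finite state control, a two-way read-only input tape, a
read-write work tape with squares `0, 1, 2, …`, and a write-only output tape written from left to
right. The machine halts where `transition` is `none`. As state set and alphabets are finite,
there are finitely many transitions, so the number of letters printed in one transition is
bounded. -/
structure Transducer (X Y : Type) : Type 1 where
  State : Type
  Work : Type
  finite_state : Finite State
  finite_work : Finite Work
  start : State
  blank : Work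
  transition : State → InputSymbol X → Work → Option (TransducerAction Y State Work)

namespace Transducer

variable {X Y : Type}

/-- A configuration: the state, the position of the input head, the contents of the work tape, the
position of the work head, and the word printed so far. -/
structure Config (M : Transducer X Y) : Type where
  state : M.State
  inputPos : ℕ
  workTape : ℕ → M.Work
  workPos : ℕ
  output : List Y

/-- The symbol on square `i` of the input tape with input word `w = x₁ … xₙ`: the left marker is
on square `0`, the letter `xᵢ` on square `i`, and the right marker on square `n + 1`. -/
def inputAt (w : List X) : ℕ → InputSymbol X
  | 0 => InputSymbol.leftEnd
  | i + 1 =>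
    match w[i]? with
    | some x => InputSymbol.letter x
    | none => InputSymbol.rightEnd

/-- At the start the work tape is blank, the output tape is empty, the work head is on square `0`,
and the input head is on square `1`: on the first letter of the input word if there is one. -/
def initial (M : Transducer X Y) : M.Config where
  state := M.start
  inputPos := 1
  workTape := fun _ => M.blank
  workPos := 0
  output := []

/-- One step on input `w`; the value is `none` when the machine halts. The input head does not
leave the squares `0, …, n + 1` where `n` is the length of `w`. -/
def step (M : Transducer X Y) (w : List X) (C : M.Config) : Option M.Config :=
  (M.transition C.state (inputAt w C.inputPos) (C.workTape C.workPos)).map fun A =>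
    { state := A.nextState
      inputPos := min (A.moveInput.apply C.inputPos) (w.length + 1)
      workTape := Function.update C.workTape C.workPos A.writeWork
      workPos := A.moveWork.apply C.workPos
      output := C.output ++ A.print }

/-- On input `w` the machine halts after finitely many steps, having printed `v`. -/
def Outputs (M : Transducer X Y) (w : List X) (v : List Y) : Prop :=
  ∃ C : M.Config, StateTransition.Reaches (M.step w) M.initial C ∧ M.step w C = none ∧ C.output = v

/-- On input `w` the machine uses at most the first `s` squares of its work tape. -/
def UsesSpaceAtMost (M : Transducer X Y) (w : List X) (s : ℕ) : Prop :=
  ∀ C : M.Config, StateTransition.Reaches (M.step w) M.initial C → C.workPos < s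

end Transducer

/-- `f : X* → Y*`, for finite alphabets `X` and `Y`, is computed by a deterministic transducer that
uses, for a constant `c`, at most `c (⌊log₂ n⌋ + 1)` work squares on inputs of length `n`. (The
summand `1` only serves to allow a constant number of squares on inputs of length `0` and `1`.) -/
def LogspaceComputable {X Y : Type} [Finite X] [Finite Y] (f : List X → List Y) : Prop :=
  ∃ (M : Transducer X Y) (c : ℕ), ∀ w : List X,
    M.Outputs w (f w) ∧ M.UsesSpaceAtMost w (c * (Nat.log 2 w.length + 1))

/-- The element of `G` represented by a word over `X`, where the letter `x` stands for `φ x`. -/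
def wordValue {G X : Type} [Group G] (φ : X → G) (w : List X) : G :=
  (w.map φ).prod

/-- The letters `φ x` form a symmetric generating set of `G`: closed under inversion, and
generating `G`. -/
def IsSymmetricGenerating {G X : Type} [Group G] (φ : X → G) : Prop :=
  (∀ x, ∃ y, φ y = (φ x)⁻¹) ∧ Subgroup.closure (Set.range φ) = ⊤

/-- A normal form: a set of words that is mapped bijectively onto `G` by evaluation. -/
def IsNormalForm {G X : Type} [Group G] (φ : X → G) (L : Set (List X)) : Prop :=
  Set.BijOn (wordValue φ) L Set.univ

/-- `(G, X)` has a logspace normal form: there are a normal form `L` and a logspace computable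
function sending each word to the word of `L` that represents the same element. -/
def HasLogspaceNormalForm {G X : Type} [Group G] [Finite X] (φ : X → G) : Prop :=
  ∃ (L : Set (List X)) (f : List X → List X), IsNormalForm φ L ∧ LogspaceComputable f ∧
    ∀ w, f w ∈ L ∧ wordValue φ (f w) = wordValue φ w

/-- The torus knot group `⟨a, b | a ^ m = b ^ n⟩`, with `a` and `b` the generators `0` and `1`. -/
abbrev TorusKnotGroup (m n : ℕ) : Type :=
  PresentedGroup
    ({FreeGroup.of 0 ^ m * (FreeGroup.of 1 ^ n)⁻¹} : Set (FreeGroup (Fin 2)))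

/-! The element `z = a ^ m = b ^ n` is central, and the quotient by its powers is the free product
of cyclic groups of orders `m` and `n`. Hence every element is, in exactly one way, an alternating
product of powers of `a` and `b` with exponents strictly between `0` and `m` or `n`, times a power
of `z`. Here the product always begins with `a`, whose first exponent may be `0`. What has to be
shown is that this form can be computed in logarithmic space.

Centrality is decided by a linear representation `ρ` on integer vectors indexed by the disjoint
union of `ZMod m` and `ZMod n`. It kills `z`, and a ping-pong argument (`Dominant.twist`,
`Reduced.orbitPoint_injective`) shows that only the powers of `z` fix the base vector
(`Setting.eq_zpow_of_ρ_baseVector`). The entries grow at most exponentially in the length of the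
word, and an integer below `2 ^ k` in absolute value that is divisible by all numbers up to `2 * k`
is zero (`Int.eq_zero_of_forall_dvd`). So it suffices to follow the vector modulo each of linearly
many numbers `q`, one after the other, and residues modulo such `q` have logarithmic length.

The exponents are found greedily (`ensures_mainLoop_reduced`). From position `i` of the input, whose
turn is the generator `t`, one searches for the last position `j` such that the factor between `i`
and `j` is a power of `t` modulo the center. That power is printed, and the search goes on from `j`
with the other generator. Maximality of `j` forces the next exponent to be nonzero, so the product
is reduced. The exponent of `z` follows from the homomorphism `τ` to the integers with `a ↦ n`, `b ↦
m`, `z ↦ m * n`.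

The machine keeps finitely many binary registers side by side on its work tape, and is verified by
rules of weakest-precondition type for `Ensures`. An arbitrary generating set is reduced to the
letters `Letter` by substituting words of one common length (`Transducer.substitute`). -/

/-! ### Program fragments

A fragment is a part of a transducer with finitely many exits. Fragments are composed
sequentially (`bind`) and by iteration (`iter`). -/

structure Fragment (X Y W E : Type) : Type 1 where
  State : Type
  finite_state : Finite State
  start : State
  transition : State → InputSymbol X → W → TransducerAction Y (State ⊕ E) W

/-- The configuration of a transducer without its state. -/
@[ext] structure TapeData (Y W : Type) : Type where
  inputPos : ℕ
  workTape : ℕ → W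
  workPos : ℕ
  output : List Y

namespace Fragment

variable {X Y W E E' P : Type}

/-- The effect of one action on the tapes. -/
def perform {Q : Type} (w : List X) (d : TapeData Y W) (A : TransducerAction Y Q W) :
    TapeData Y W where
  inputPos := min (A.moveInput.apply d.inputPos) (w.length + 1)
  workTape := Function.update d.workTape d.workPos A.writeWork
  workPos := A.moveWork.apply d.workPos
  output := d.output ++ A.print

/-- The action taken in state `q`. -/
def action (F : Fragment X Y W E) (w : List X) (q : F.State) (d : TapeData Y W) :
    TransducerAction Y (F.State ⊕ E) W :=
  F.transition q (Transducer.inputAt w d.inputPos) (d.workTape d.workPos)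

/-- Started in state `q` with tapes `d`, the fragment leaves at the exit `e` with tapes `d'`, and
the work head stays on the first `S` squares before. -/
inductive Run (F : Fragment X Y W E) (w : List X) (S : ℕ) :
    F.State → TapeData Y W → E → TapeData Y W → Prop
  | exit {q d e} : d.workPos < S → (F.action w q d).nextState = Sum.inr e →
      Run F w S q d e (perform w d (F.action w q d))
  | step {q d q' e d'} : d.workPos < S → (F.action w q d).nextState = Sum.inl q' →
      Run F w S q' (perform w d (F.action w q d)) e d' → Run F w S q d e d'

/-- Replace the next state in an action. -/
def mapAction {Q Q' : Type} (f : Q → Q') (A : TransducerAction Y Q W) :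
    TransducerAction Y Q' W :=
  { A with nextState := f A.nextState }

/-- The next state of a sequential composition, during its first part. -/
def bindFirst (F : Fragment X Y W E) (G : E → Fragment X Y W E') :
    F.State ⊕ E → (F.State ⊕ Σ e, (G e).State) ⊕ E' :=
  Sum.elim (fun q => Sum.inl (Sum.inl q)) fun e => Sum.inl (Sum.inr ⟨e, (G e).start⟩)

/-- The next state of a sequential composition, during its second part. -/
def bindSecond (F : Fragment X Y W E) (G : E → Fragment X Y W E') (e : E) :
    (G e).State ⊕ E' → (F.State ⊕ Σ e, (G e).State) ⊕ E' :=
  Sum.elim (fun q => Sum.inl (Sum.inr ⟨e, q⟩)) Sum.inr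

/-- The next state of an iteration. -/
def iterNext (F : P → Fragment X Y W (P ⊕ E)) (p : P) :
    (F p).State ⊕ (P ⊕ E) → (Σ p, (F p).State) ⊕ E :=
  Sum.elim (fun q => Sum.inl ⟨p, q⟩) (Sum.elim (fun p' => Sum.inl ⟨p', (F p').start⟩) Sum.inr)

/-- Sequential composition: after the exit `e` of `F`, continue with `G e`. -/
def bind [Finite E] (F : Fragment X Y W E) (G : E → Fragment X Y W E') : Fragment X Y W E' where
  State := F.State ⊕ Σ e, (G e).State
  finite_state := by
    have := F.finite_state
    have := fun e => (G e).finite_state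
    infer_instance
  start := Sum.inl F.start
  transition
    | Sum.inl q, x, s => mapAction (bindFirst F G) (F.transition q x s)
    | Sum.inr q, x, s => mapAction (bindSecond F G q.1) ((G q.1).transition q.2 x s)

theorem Run.bind_right [Finite E] {F : Fragment X Y W E} {G : E → Fragment X Y W E'} {w : List X}
    {S : ℕ} {e : E} {q d e' d'} (h : (G e).Run w S q d e' d') :
    (F.bind G).Run w S (Sum.inr ⟨e, q⟩) d e' d' := by
  induction h with
  | @exit q d e' hS h =>
    exact Run.exit (F := F.bind G) (q := Sum.inr ⟨e, q⟩) hS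
      (congrArg (bindSecond F G e) h)
  | @step q d q' e' d' hS h _ ih =>
    exact Run.step (F := F.bind G) (q := Sum.inr ⟨e, q⟩) hS
      (congrArg (bindSecond F G e) h) ih

theorem Run.bind_left [Finite E] {F : Fragment X Y W E} {G : E → Fragment X Y W E'} {w : List X}
    {S : ℕ} {e : E} {q d d' e' d''} (h : F.Run w S q d e d')
    (h' : (G e).Run w S (G e).start d' e' d'') :
    (F.bind G).Run w S (Sum.inl q) d e' d'' := by
  induction h with
  | @exit q d e hS h =>
    exact Run.step (F := F.bind G) (q := Sum.inl q) hS
      (congrArg (bindFirst F G) h) h'.bind_right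
  | @step q d q' e d' hS h _ ih =>
    exact Run.step (F := F.bind G) (q := Sum.inl q) hS
      (congrArg (bindFirst F G) h) (ih h')

/-- Iteration: at an exit `Sum.inl p` of `F`, start `F p` anew. -/
def iter [Finite P] (F : P → Fragment X Y W (P ⊕ E)) (p : P) : Fragment X Y W E where
  State := Σ p, (F p).State
  finite_state := by
    have := fun p => (F p).finite_state
    infer_instance
  start := ⟨p, (F p).start⟩
  transition q x s := mapAction (iterNext F q.1) ((F q.1).transition q.2 x s)

theorem Run.iter_exit [Finite P] {F : P → Fragment X Y W (P ⊕ E)} {w : List X} {S : ℕ} {p₀ p : P}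
    {q d e₀ d'} (h : (F p).Run w S q d e₀ d') {e : E} (he : e₀ = Sum.inr e) :
    (iter F p₀).Run w S ⟨p, q⟩ d e d' := by
  induction h with
  | @exit q d e₀ hS h =>
    subst he
    exact Run.exit (F := iter F p₀) (q := ⟨p, q⟩) hS (congrArg (iterNext F p) h)
  | @step q d q' e₀ d' hS h _ ih =>
    exact Run.step (F := iter F p₀) (q := ⟨p, q⟩) hS (congrArg (iterNext F p) h)
      (ih he)

theorem Run.iter_again [Finite P] {F : P → Fragment X Y W (P ⊕ E)} {w : List X} {S : ℕ}
    {p₀ p p' : P} {q d e₀ d' e d''} (h : (F p).Run w S q d e₀ d') (he : e₀ = Sum.inl p')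
    (h' : (iter F p₀).Run w S ⟨p', (F p').start⟩ d' e d'') :
    (iter F p₀).Run w S ⟨p, q⟩ d e d'' := by
  induction h with
  | @exit q d e₀ hS h =>
    subst he
    exact Run.step (F := iter F p₀) (q := ⟨p, q⟩) hS (congrArg (iterNext F p) h) h'
  | @step q d q' e₀ d' hS h _ ih =>
    exact Run.step (F := iter F p₀) (q := ⟨p, q⟩) hS (congrArg (iterNext F p) h)
      (ih he h')

/-- The parameter of `iter` only fixes the start state, so runs do not depend on it. -/
theorem Run.iter_start [Finite P] {F : P → Fragment X Y W (P ⊕ E)} {w : List X} {S : ℕ}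
    {p₀ p₁ : P} {q d e d'} (h : (iter F p₀).Run w S q d e d') : (iter F p₁).Run w S q d e d' := by
  induction h with
  | exit hS h => exact Run.exit (F := iter F p₁) hS h
  | step hS h _ ih => exact Run.step (F := iter F p₁) hS h ih

/-- The transducer that halts where the fragment leaves. -/
def toTransducer [Finite W] (F : Fragment X Y W Unit) (blank : W) : Transducer X Y where
  State := Option F.State
  Work := W
  finite_state := by
    have := F.finite_state
    infer_instance
  finite_work := inferInstance
  start := some F.start
  blank := blank
  transition
    | none, _, _ => none
    | some q, x, s => some (mapAction (Sum.elim some fun _ => none) (F.transition q x s))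

section toTransducer

variable [Finite W] {F : Fragment X Y W Unit} {blank : W} {w : List X} {S : ℕ}

/-- The configuration with the given state and tapes. -/
def config (F : Fragment X Y W Unit) (blank : W) (q : Option F.State) (d : TapeData Y W) :
    (F.toTransducer blank).Config :=
  ⟨q, d.inputPos, d.workTape, d.workPos, d.output⟩

theorem step_config (q : F.State) (d : TapeData Y W) :
    (F.toTransducer blank).step w (F.config blank (some q) d) =
      some (F.config blank (Sum.elim some (fun _ => none) (F.action w q d).nextState)
        (perform w d (F.action w q d))) := rfl

theorem step_config_none (d : TapeData Y W) :
    (F.toTransducer blank).step w (F.config blank none d) = none := rfl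

theorem Run.reaches {q d e d'} (h : F.Run w S q d e d') :
    StateTransition.Reaches ((F.toTransducer blank).step w) (F.config blank (some q) d)
      (F.config blank none d') := by
  induction h with
  | exit hS h =>
    refine Relation.ReflTransGen.single ?_
    rw [step_config, h]; rfl
  | step hS h _ ih =>
    refine Relation.ReflTransGen.head ?_ ih
    rw [step_config, h]; rfl

/-- By determinism every reachable configuration lies on the run. A run bounds the head only before
each action, so the last position is a separate hypothesis. -/
theorem Run.workPos_lt {q d e d'} (h : F.Run w S q d e d') (hd' : d'.workPos < S)
    {C : (F.toTransducer blank).Config}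
    (hC : StateTransition.Reaches ((F.toTransducer blank).step w) (F.config blank (some q) d) C) :
    C.workPos < S := by
  induction h with
  | exit hS h =>
    rcases hC.cases_head with rfl | ⟨C', h1, h2⟩
    · exact hS
    · rw [step_config, h, Option.mem_def, Option.some_inj] at h1
      subst h1
      rcases h2.cases_head with rfl | ⟨C', h1, -⟩
      · exact hd'
      · exact absurd h1 (by simp [step_config_none])
  | step hS h _ ih =>
    rcases hC.cases_head with rfl | ⟨C', h1, h2⟩
    · exact hS
    · rw [step_config, h, Option.mem_def, Option.some_inj] at h1
      subst h1
      exact ih hd' h2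

end toTransducer

end Fragment

/-! ### Registers on the work tape

The work tape holds, for each `k : K`, a natural number in binary, with the least significant bit
on square `0`. The first component of a symbol marks square `0`. -/

/-- One square carries one bit of every register, so a single pass of a finite automaton can act on
all registers together. The blank `none` delimits the squares in use. -/
abbrev TrackSymbol (K : Type) : Type := Option (Bool × (K → Bool))

/-- The contents of the tapes in terms of registers: `width` squares of the work tape are in use,
and the work head is on square `0`. -/
structure Memory (K Y : Type) : Type where
  width : ℕ
  pos : ℕ
  reg : K → ℕ
  out : List Y

namespace Memory

variable {K Y : Type}

/-- The bits on square `j`. -/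
def bits (r : K → ℕ) (j : ℕ) : K → Bool := fun k => (r k).testBit j

/-- Bits beyond `width` are not represented; this is the origin of the bounds `< 2 ^ σ.width` below.
-/
def encode (σ : Memory K Y) : TapeData Y (TrackSymbol K) where
  inputPos := σ.pos
  workTape j := if j < σ.width then some (decide (j = 0), bits σ.reg j) else none
  workPos := 0
  output := σ.out

end Memory

namespace Fragment

open Memory

variable {X Y K E E' P : Type} {w : List X} {S : ℕ}

/-- Started in `σ`, the fragment leaves at an exit `e` with a memory `σ'` such that `Q e σ'`. -/
def Ensures (w : List X) (S : ℕ) (F : Fragment X Y (TrackSymbol K) E)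
    (Q : E → Memory K Y → Prop) (σ : Memory K Y) : Prop :=
  ∃ e σ', F.Run w S F.start σ.encode e σ'.encode ∧ Q e σ'

/-- The postcondition of the first part is that the second part ensures the goal. Programs are thus
verified from front to back without naming intermediate memories. -/
theorem Ensures.bind [Finite E] {F : Fragment X Y (TrackSymbol K) E}
    {G : E → Fragment X Y (TrackSymbol K) E'} {Q : E' → Memory K Y → Prop} {σ : Memory K Y}
    (h : Ensures w S F (fun e => Ensures w S (G e) Q) σ) : Ensures w S (F.bind G) Q σ :=
  let ⟨_, _, h1, e', σ'', h2, h3⟩ := h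
  ⟨e', σ'', h1.bind_left h2, h3⟩

/-- This unrolls a loop once. Each loop below is treated by an induction on the number of rounds
left. -/
theorem Ensures.iter [Finite P] {F : P → Fragment X Y (TrackSymbol K) (P ⊕ E)} {p : P}
    {Q : E → Memory K Y → Prop} {σ : Memory K Y}
    (h : Ensures w S (F p) (Sum.elim (fun p' => Ensures w S (Fragment.iter F p') Q) Q) σ) :
    Ensures w S (Fragment.iter F p) Q σ := by
  obtain ⟨p' | e, σ', h1, h2⟩ := h
  · obtain ⟨e, σ'', h2, h3⟩ := h2
    exact ⟨e, σ'', h1.iter_again rfl h2.iter_start, h3⟩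
  · exact ⟨e, σ', h1.iter_exit rfl, h2⟩

/-- Move the input head and print, depending on the letter read, and exit. -/
def act (f : InputSymbol X → E × HeadMove × List Y) : Fragment X Y (TrackSymbol K) E where
  State := Unit
  finite_state := inferInstance
  start := ()
  transition _ x s := ⟨Sum.inr (f x).1, s, (f x).2.1, HeadMove.stay, (f x).2.2⟩

theorem ensures_act {f : InputSymbol X → E × HeadMove × List Y} {Q : E → Memory K Y → Prop}
    {σ : Memory K Y} (hS : 0 < S)
    (h : Q (f (Transducer.inputAt w σ.pos)).1
      { σ with
        pos := min ((f (Transducer.inputAt w σ.pos)).2.1.apply σ.pos) (w.length + 1)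
        out := σ.out ++ (f (Transducer.inputAt w σ.pos)).2.2 }) :
    Ensures w S (act f) Q σ := by
  refine ⟨_, _, ?_, h⟩
  have := Run.exit (F := act (K := K) f) (w := w) (S := S) (q := ()) (d := σ.encode) hS rfl
  refine cast (congrArg _ ?_) this
  ext : 1
  · rfl
  · simp [perform, action, act, encode]
  · rfl
  · rfl

/-- Exit at once. -/
def skip (e : E) : Fragment X Y (TrackSymbol K) E := act fun _ => (e, HeadMove.stay, [])

/-- Mark square `0` and write the bits `b` there. -/
def mark (b : K → Bool) : Fragment X Y (TrackSymbol K) Unit where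
  State := Unit
  finite_state := inferInstance
  start := ()
  transition _ _ _ := ⟨Sum.inr (), some (true, b), HeadMove.stay, HeadMove.stay, []⟩

theorem ensures_mark {b : K → Bool} {Q : Unit → Memory K Y → Prop} {σ : Memory K Y} (hS : 0 < S)
    (hσ : σ.width = 0) (hpos : σ.pos ≤ w.length + 1)
    (h : Q () { σ with width := 1, reg := fun k => (b k).toNat }) :
    Ensures w S (mark b) Q σ := by
  refine ⟨_, _, ?_, h⟩
  have := Run.exit (F := mark (Y := Y) b) (w := w) (S := S) (q := ()) (d := σ.encode) hS rfl
  refine cast (congrArg _ ?_) this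
  ext : 1
  · simpa [perform, action, mark, encode, HeadMove.apply] using hpos
  · funext j
    rcases j with _ | j
    · simp only [perform, action, mark, encode, zero_lt_one, if_true, decide_true,
        Function.update_self, Option.some.injEq, Prod.mk.injEq, true_and]
      funext k
      cases h : b k <;> simp [bits, h]
    · simp [perform, action, mark, encode, hσ]
  · rfl
  · simp [perform, action, mark, encode]

/-- A finite automaton runs over the work tape from square `0` to the first blank square, which it
may overwrite, and then the work head returns to square `0`. -/
def scan {C : Type} [Finite C] (δ : C → (K → Bool) → C × (K → Bool)) (grow : C → Option (K → Bool))
    (c₀ : C) : Fragment X Y (TrackSymbol K) C where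
  State := C ⊕ C
  finite_state := inferInstance
  start := Sum.inl c₀
  transition
    | Sum.inl c, _, some (b, s) =>
      ⟨Sum.inl (Sum.inl (δ c s).1), some (b, (δ c s).2), HeadMove.stay, HeadMove.right, []⟩
    | Sum.inl c, _, none =>
      ⟨Sum.inl (Sum.inr c), (grow c).map (Prod.mk false), HeadMove.stay, HeadMove.left, []⟩
    | Sum.inr c, _, some (true, s) => ⟨Sum.inr c, some (true, s), HeadMove.stay, HeadMove.stay, []⟩
    | Sum.inr c, _, some (false, s) =>
      ⟨Sum.inl (Sum.inr c), some (false, s), HeadMove.stay, HeadMove.left, []⟩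
    | Sum.inr c, _, none => ⟨Sum.inr c, none, HeadMove.stay, HeadMove.stay, []⟩

section scan

variable {C : Type} [Finite C] {δ : C → (K → Bool) → C × (K → Bool)}
  {grow : C → Option (K → Bool)} {c₀ : C}

theorem run_scan_return {σ : Memory K Y} (hpos : σ.pos ≤ w.length + 1) (c : C) (j : ℕ)
    (hj : j < σ.width) (hS : σ.width ≤ S) :
    (scan (X := X) (Y := Y) δ grow c₀).Run w S (Sum.inr c) { σ.encode with workPos := j } c
      σ.encode := by
  induction j with
  | zero =>
    have hact : (scan (X := X) (Y := Y) δ grow c₀).action w (Sum.inr c)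
        { σ.encode with workPos := 0 } = ⟨Sum.inr c, some (true, bits σ.reg 0), HeadMove.stay,
          HeadMove.stay, []⟩ := by
      simp [action, encode, hj, scan]
    have := Run.exit (F := scan (X := X) (Y := Y) δ grow c₀) (w := w) (S := S) (q := Sum.inr c)
      (d := { σ.encode with workPos := 0 }) (e := c) (by simp; omega) (by rw [hact])
    rw [hact] at this
    convert this using 1
    ext : 1
    · simpa [perform, encode, HeadMove.apply] using hpos
    · funext i
      by_cases hi : i = 0
      · subst hi; simp [perform, encode, hj]
      · simp [perform, encode, hi]
    · rfl
    · simp [perform, encode]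
  | succ j ih =>
    have hact : (scan (X := X) (Y := Y) δ grow c₀).action w (Sum.inr c)
        { σ.encode with workPos := j + 1 } = ⟨Sum.inl (Sum.inr c), some (false, bits σ.reg (j + 1)),
          HeadMove.stay, HeadMove.left, []⟩ := by
      simp [action, encode, hj, scan]
    refine Run.step (q' := Sum.inr c) (by simp; omega) (by rw [hact]) ?_
    convert ih (by omega) using 1
    rw [hact]
    ext : 1
    · simpa [perform, encode, HeadMove.apply] using hpos
    · funext i
      by_cases hi : i = j + 1
      · subst hi; simp [perform, encode, hj]
      · simp [perform, encode, hi]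
    · rfl
    · simp [perform, encode]

/-- The tapes while the head of `scan` is on square `j`. -/
def midScan (σ : Memory K Y) (r : K → ℕ) (j : ℕ) : TapeData Y (TrackSymbol K) where
  inputPos := σ.pos
  workTape i := if i < σ.width then some (decide (i = 0), bits (if i < j then r else σ.reg) i)
    else none
  workPos := j
  output := σ.out

/-- Induction on the number `i` of squares still ahead: in `midScan` the new bits are behind the
head and the old ones before it. The head enters the first blank square, whence `σ.width < S`. -/
theorem run_scan_forward {σ : Memory K Y} {r : K → ℕ} {W : ℕ} (hpos : σ.pos ≤ w.length + 1)
    (hw : 0 < σ.width) (hS : W ≤ S) (hwS : σ.width < S) {c : ℕ → C}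
    (hδ : ∀ j < σ.width, δ (c j) (bits σ.reg j) = (c (j + 1), bits r j))
    (hg : (W = σ.width ∧ grow (c σ.width) = none) ∨
      (W = σ.width + 1 ∧ grow (c σ.width) = some (bits r σ.width)))
    (i : ℕ) (hi : i ≤ σ.width) :
    (scan (X := X) (Y := Y) δ grow c₀).Run w S (Sum.inl (c (σ.width - i)))
      (midScan σ r (σ.width - i)) (c σ.width) { σ with width := W, reg := r }.encode := by
  induction i with
  | zero =>
    have hact : (scan (X := X) (Y := Y) δ grow c₀).action w (Sum.inl (c σ.width))
        (midScan σ r σ.width) = ⟨Sum.inl (Sum.inr (c σ.width)),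
          (grow (c σ.width)).map (Prod.mk false), HeadMove.stay, HeadMove.left, []⟩ := by
      simp [action, midScan, scan]
    refine Run.step (q' := Sum.inr (c σ.width)) (by simpa [midScan] using hwS)
      (by simp [hact]) ?_
    convert run_scan_return (δ := δ) (grow := grow) (c₀ := c₀) (σ := { σ with width := W, reg := r }) hpos (c σ.width)
      (σ.width - 1) (by simp; omega) (by simpa using hS) using 1
    simp only [Nat.sub_zero, hact]
    ext : 1
    · simpa [perform, encode, midScan, HeadMove.apply] using hpos
    · funext i
      by_cases hi : i = σ.width
      · subst hi
        rcases hg with ⟨rfl, hg⟩ | ⟨rfl, hg⟩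
        · simp [perform, encode, midScan, hg]
        · simp [perform, encode, midScan, hg, hw.ne']
      · simp only [perform, midScan, Function.update_of_ne hi, encode]
        by_cases hlt : i < σ.width
        · rw [if_pos hlt, if_pos hlt, if_pos (by omega)]
        · rw [if_neg hlt, if_neg (by omega)]
    · rfl
    · simp [perform, encode, midScan]
  | succ i ih =>
    specialize ih (by omega)
    obtain ⟨j, hj⟩ : ∃ j, j = σ.width - (i + 1) := ⟨_, rfl⟩
    have hj' : σ.width - i = j + 1 := by omega
    have hjw : j < σ.width := by omega
    rw [hj'] at ih
    rw [← hj]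
    have hact : (scan (X := X) (Y := Y) δ grow c₀).action w (Sum.inl (c j))
        (midScan σ r j) = ⟨Sum.inl (Sum.inl (c (j + 1))), some (decide (j = 0), bits r j),
          HeadMove.stay, HeadMove.right, []⟩ := by
      simp [action, midScan, scan, hjw, hδ j hjw]
    refine Run.step (q' := Sum.inl (c (j + 1))) (by simp [midScan]; omega) (by simp [hact]) ?_
    convert ih using 1
    rw [hact]
    ext : 1
    · simpa [perform, encode, midScan, HeadMove.apply] using hpos
    · funext i
      by_cases hi : i = j
      · subst hi; simp [perform, midScan, hjw]
      · simp only [perform, midScan, Function.update_of_ne hi]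
        by_cases hlt : i < j
        · rw [if_pos hlt, if_pos (by omega : i < j + 1)]
        · rw [if_neg hlt, if_neg (by omega : ¬ i < j + 1)]
    · rfl
    · simp [perform, midScan]

theorem ensures_scan_grow {σ : Memory K Y} {Q : C → Memory K Y → Prop} (r : K → ℕ) (W : ℕ)
    (c : ℕ → C) (hpos : σ.pos ≤ w.length + 1) (hw : 0 < σ.width) (hS : W ≤ S)
    (hwS : σ.width < S) (hc : c 0 = c₀)
    (hδ : ∀ j < σ.width, δ (c j) (bits σ.reg j) = (c (j + 1), bits r j))
    (hg : (W = σ.width ∧ grow (c σ.width) = none) ∨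
      (W = σ.width + 1 ∧ grow (c σ.width) = some (bits r σ.width)))
    (hQ : Q (c σ.width) { σ with width := W, reg := r }) :
    Ensures w S (scan δ grow c₀) Q σ := by
  refine ⟨_, _, ?_, hQ⟩
  have := run_scan_forward (δ := δ) (grow := grow) (c₀ := c₀) hpos hw hS hwS hδ hg σ.width le_rfl
  rw [Nat.sub_self, hc] at this
  have h0 : σ.encode = midScan σ r 0 := by ext : 1 <;> simp [encode, midScan]
  rw [h0]
  exact this

theorem ensures_scan {σ : Memory K Y} {Q : C → Memory K Y → Prop} (r : K → ℕ)
    (c : ℕ → C) (hpos : σ.pos ≤ w.length + 1) (hw : 0 < σ.width)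
    (hwS : σ.width < S) (hc : c 0 = c₀)
    (hδ : ∀ j < σ.width, δ (c j) (bits σ.reg j) = (c (j + 1), bits r j))
    (hQ : Q (c σ.width) { σ with reg := r }) :
    Ensures w S (scan δ (fun _ => none) c₀) Q σ :=
  ensures_scan_grow r σ.width c hpos hw hwS.le hwS hc hδ (Or.inl ⟨rfl, rfl⟩) hQ

end scan

end Fragment

/-! ### Operations on registers -/

theorem Nat.mod_two_pow_succ_eq_add_testBit (x j : ℕ) :
    x % 2 ^ (j + 1) = x % 2 ^ j + 2 ^ j * (x.testBit j).toNat := by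
  rw [pow_succ, Nat.mod_mul, Nat.testBit_eq_decide_div_mod_eq]
  rcases Nat.mod_two_eq_zero_or_one (x / 2 ^ j) with h | h <;> simp [h]

/-- The carry into bit `j` of a sum. -/
def Nat.carryAt (x y j : ℕ) : Bool := decide (2 ^ j ≤ x % 2 ^ j + y % 2 ^ j)

/-- The quotient of a sum by `2 ^ j` is the sum of the quotients plus the carry; take parities. -/
theorem Nat.testBit_add_carryAt (x y j : ℕ) :
    (x + y).testBit j = ((x.testBit j ^^ y.testBit j) ^^ Nat.carryAt x y j) := by
  have h := Nat.add_div (a := x) (b := y) (Nat.two_pow_pos j)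
  simp only [Nat.testBit_eq_decide_div_mod_eq, Nat.carryAt, h]
  generalize x / 2 ^ j = a
  generalize y / 2 ^ j = b
  split_ifs with h <;> rcases Nat.mod_two_eq_zero_or_one a with ha | ha <;>
    rcases Nat.mod_two_eq_zero_or_one b with hb | hb <;> simp [h, ha, hb] <;> omega

/-- The new carry is the majority of the two bits and the old carry, so a two-state automaton can
add. -/
theorem Nat.carryAt_succ (x y j : ℕ) :
    Nat.carryAt x y (j + 1) = if x.testBit j = y.testBit j then x.testBit j
      else Nat.carryAt x y j := by
  have hx := Nat.mod_lt x (Nat.two_pow_pos j)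
  have hy := Nat.mod_lt y (Nat.two_pow_pos j)
  simp only [Nat.carryAt, Nat.mod_two_pow_succ_eq_add_testBit]
  rw [pow_succ]
  generalize x.testBit j = a
  generalize y.testBit j = b
  cases a <;> cases b <;> simp <;> omega

/-- Whether the last `j` bits of `x` represent a smaller number than those of `y`. -/
def Nat.ltAt (x y j : ℕ) : Bool := decide (x % 2 ^ j < y % 2 ^ j)

theorem Nat.ltAt_succ (x y j : ℕ) :
    Nat.ltAt x y (j + 1) = if x.testBit j = y.testBit j then Nat.ltAt x y j else y.testBit j := by
  have hx := Nat.mod_lt x (Nat.two_pow_pos j)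
  have hy := Nat.mod_lt y (Nat.two_pow_pos j)
  simp only [Nat.ltAt, Nat.mod_two_pow_succ_eq_add_testBit]
  generalize x.testBit j = a
  generalize y.testBit j = b
  cases a <;> cases b <;> simp <;> omega

/-- The borrow in `x - y` is the carry in `(x - y) + y`, and it occurs when the last bits of `x`
represent less than those of `y`. The same automaton therefore serves for comparison and
subtraction. -/
theorem Nat.testBit_sub_ltAt {x y : ℕ} (h : y ≤ x) (j : ℕ) :
    (x - y).testBit j = ((x.testBit j ^^ y.testBit j) ^^ Nat.ltAt x y j) := by
  obtain ⟨z, rfl⟩ := Nat.exists_eq_add_of_le' h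
  rw [Nat.add_sub_cancel, Nat.testBit_add_carryAt]
  have : Nat.ltAt (z + y) y j = Nat.carryAt z y j := by
    have hx := Nat.mod_lt z (Nat.two_pow_pos j)
    have hy := Nat.mod_lt y (Nat.two_pow_pos j)
    simp only [Nat.ltAt, Nat.carryAt, Nat.add_mod z y, decide_eq_decide]
    rcases lt_or_ge (z % 2 ^ j + y % 2 ^ j) (2 ^ j) with h | h
    · rw [Nat.mod_eq_of_lt h]; omega
    · rw [Nat.mod_eq_sub_mod h, Nat.mod_eq_of_lt (by omega)]; omega
  rw [this]
  cases z.testBit j <;> cases y.testBit j <;> cases Nat.carryAt z y j <;> rfl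

namespace Fragment

open Memory

variable {X Y K E E' P : Type} {w : List X} {S : ℕ}

/-- Conditions for the operations on registers to work. -/
structure Fits (w : List X) (S : ℕ) (σ : Memory K Y) : Prop where
  pos_le : σ.pos ≤ w.length + 1
  width_pos : 0 < σ.width
  width_lt : σ.width < S

theorem ensures_skip {e : E} {Q : E → Memory K Y → Prop} {σ : Memory K Y} (hσ : Fits w S σ)
    (h : Q e σ) : Ensures w S (skip e) Q σ := by
  refine ensures_act (hσ.width_pos.trans hσ.width_lt) ?_
  simpa [HeadMove.apply, min_eq_left hσ.pos_le] using h

/-- Assign to each register the value of another one or zero. -/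
def select (g : K → Option K) : Fragment X Y (TrackSymbol K) Unit :=
  scan (fun _ b => ((), fun k => (g k).elim false b)) (fun _ => none) ()

/-- The memory after `select g`. -/
def selected (g : K → Option K) (r : K → ℕ) (k : K) : ℕ := (g k).elim 0 r

theorem bits_selected (g : K → Option K) (r : K → ℕ) (j : ℕ) :
    bits (selected g r) j = fun k => (g k).elim false (bits r j) := by
  funext k
  simp only [bits, selected]
  cases g k <;> simp [bits]

theorem ensures_select {g : K → Option K} {Q : Unit → Memory K Y → Prop} {σ : Memory K Y}
    (hσ : Fits w S σ) (h : Q () { σ with reg := selected g σ.reg }) :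
    Ensures w S (select g) Q σ :=
  ensures_scan _ (fun _ => ()) hσ.pos_le hσ.width_pos hσ.width_lt rfl
    (fun j _ => by rw [bits_selected]) h

open Classical in
/-- Compare each register with another one or zero. -/
noncomputable def test (g : K → Option K) : Fragment X Y (TrackSymbol K) Bool :=
  scan (fun c b => (c && decide (b = fun k => (g k).elim false b), b)) (fun _ => none) true

-- The scan sees only the first `σ.width` bits. A register compared with anything but itself must
-- fit into them, and so must its partner.
open Classical in
theorem ensures_test {g : K → Option K} {Q : Bool → Memory K Y → Prop} {σ : Memory K Y}
    (hσ : Fits w S σ) (hg : ∀ k, g k ≠ some k → σ.reg k < 2 ^ σ.width)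
    (hg' : ∀ k k', g k = some k' → k' ≠ k → σ.reg k' < 2 ^ σ.width)
    (h : Q (decide (σ.reg = selected g σ.reg)) σ) : Ensures w S (test g) Q σ := by
  refine ensures_scan σ.reg
    (fun j => decide (∀ i < j, bits σ.reg i = bits (selected g σ.reg) i))
    hσ.pos_le hσ.width_pos hσ.width_lt (by simp) (fun j _ => ?_) ?_
  · rw [← bits_selected, ← Bool.decide_and]
    simp only [Nat.lt_succ_iff_lt_or_eq, or_imp, forall_and, forall_eq]
  · convert h using 2
    refine ⟨fun h => funext fun k => ?_, fun h i _ => by rw [← h]⟩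
    by_cases hk : g k = some k
    · simp [selected, hk]
    refine Nat.eq_of_testBit_eq fun i => ?_
    by_cases hi : i < σ.width
    · exact congrFun (h i hi) k
    have h2 : 2 ^ σ.width ≤ 2 ^ i := Nat.pow_le_pow_right (by norm_num) (by omega)
    rw [Nat.testBit_lt_two_pow ((hg k hk).trans_le h2)]
    rcases hgk : g k with _ | k'
    · simp [selected, hgk]
    · have : k' ≠ k := by rintro rfl; exact hk hgk
      simp only [selected, hgk, Option.elim]
      rw [Nat.testBit_lt_two_pow ((hg' k k' hgk this).trans_le h2)]

/-- Test whether register `x` is less than register `y`. -/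
def less (x y : K) : Fragment X Y (TrackSymbol K) Bool :=
  scan (fun c b => (if b x = b y then c else b y, b)) (fun _ => none) false

theorem ensures_less {x y : K} {Q : Bool → Memory K Y → Prop} {σ : Memory K Y}
    (hσ : Fits w S σ) (hx : σ.reg x < 2 ^ σ.width) (hy : σ.reg y < 2 ^ σ.width)
    (h : Q (decide (σ.reg x < σ.reg y)) σ) :
    Ensures w S (less x y) Q σ := by
  refine ensures_scan σ.reg
    (fun j => Nat.ltAt (σ.reg x) (σ.reg y) j) hσ.pos_le hσ.width_pos hσ.width_lt
    (by simp [Nat.ltAt, Nat.mod_one]) (fun j _ => ?_) ?_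
  · rw [Nat.ltAt_succ]
    rfl
  · simpa only [Nat.ltAt, Nat.mod_eq_of_lt hx, Nat.mod_eq_of_lt hy] using h

variable [DecidableEq K]

/-- The bits of the registers, with those of register `x` replaced. -/
theorem bits_update (r : K → ℕ) (x : K) (v j : ℕ) :
    bits (Function.update r x v) j = Function.update (bits r j) x (v.testBit j) := by
  funext k
  by_cases h : k = x
  · subst h; simp [bits]
  · simp [bits, h]

/-- Add register `y` to register `x`. The number of squares in use grows if necessary. -/
def add (x y : K) : Fragment X Y (TrackSymbol K) Unit :=
  (scan (fun c b => (if b x = b y then b x else c, Function.update b x ((b x ^^ b y) ^^ c)))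
    (fun c => if c then some fun k => decide (k = x) else none) false).bind fun _ => skip ()

theorem add_step (r : K → ℕ) (x y : K) (j : ℕ) :
    (if bits r j x = bits r j y then bits r j x else Nat.carryAt (r x) (r y) j,
      Function.update (bits r j) x ((bits r j x ^^ bits r j y) ^^ Nat.carryAt (r x) (r y) j)) =
    (Nat.carryAt (r x) (r y) (j + 1), bits (Function.update r x (r x + r y)) j) := by
  rw [bits_update, Nat.testBit_add_carryAt, Nat.carryAt_succ]
  rfl

theorem ensures_add {x y : K} {Q : Unit → Memory K Y → Prop} {σ : Memory K Y}
    (hσ : Fits w S σ) (hx : σ.reg x + σ.reg y < 2 ^ σ.width)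
    (h : Q () { σ with reg := Function.update σ.reg x (σ.reg x + σ.reg y) }) :
    Ensures w S (add x y) Q σ := by
  refine Ensures.bind (ensures_scan_grow _ σ.width
    (fun j => Nat.carryAt (σ.reg x) (σ.reg y) j) hσ.pos_le hσ.width_pos hσ.width_lt.le hσ.width_lt
    (by simp [Nat.carryAt, Nat.mod_one]) (fun j _ => add_step σ.reg x y j) (Or.inl ⟨rfl, ?_⟩)
    (ensures_skip ?_ h))
  · rw [if_neg]
    simp only [Nat.carryAt, decide_eq_true_eq, not_le]
    rwa [Nat.mod_eq_of_lt (by omega), Nat.mod_eq_of_lt (by omega)]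
  · exact ⟨hσ.pos_le, hσ.width_pos, hσ.width_lt⟩

/-- An addition with one more square in use afterwards. -/
theorem ensures_add_grow {x y : K} {Q : Unit → Memory K Y → Prop} {σ : Memory K Y}
    (hσ : Fits w S σ) (hr : ∀ k, σ.reg k < 2 ^ σ.width) (hS : σ.width + 1 < S)
    (hx : 2 ^ σ.width ≤ σ.reg x + σ.reg y)
    (h : Q () { σ with
      width := σ.width + 1, reg := Function.update σ.reg x (σ.reg x + σ.reg y) }) :
    Ensures w S (add x y) Q σ := by
  have hc : Nat.carryAt (σ.reg x) (σ.reg y) σ.width = true := by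
    simp only [Nat.carryAt, decide_eq_true_eq]
    rwa [Nat.mod_eq_of_lt (hr x), Nat.mod_eq_of_lt (hr y)]
  refine Ensures.bind (ensures_scan_grow _ (σ.width + 1)
    (fun j => Nat.carryAt (σ.reg x) (σ.reg y) j) hσ.pos_le hσ.width_pos hS.le hσ.width_lt
    (by simp [Nat.carryAt, Nat.mod_one]) (fun j _ => add_step σ.reg x y j) (Or.inr ⟨rfl, ?_⟩)
    (ensures_skip ?_ h))
  -- All old registers have bit `0` on the new square, and the bit of the sum there is the carry. So
  -- the new column is the indicator of `x`, as `add` writes it.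
  · rw [hc, if_pos rfl, bits_update, Nat.testBit_add_carryAt, hc,
      Nat.testBit_lt_two_pow (hr x), Nat.testBit_lt_two_pow (hr y)]
    congr 1
    funext k
    by_cases hk : k = x
    · subst hk; simp
    · simp [hk, bits, Nat.testBit_lt_two_pow (hr k)]
  · exact ⟨hσ.pos_le, Nat.succ_pos _, hS⟩

/-- Subtract register `y` from register `x`. -/
def sub (x y : K) : Fragment X Y (TrackSymbol K) Unit :=
  (scan (fun c b => (if b x = b y then c else b y, Function.update b x ((b x ^^ b y) ^^ c)))
    (fun _ => none) false).bind fun _ => skip ()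

theorem ensures_sub {x y : K} {Q : Unit → Memory K Y → Prop} {σ : Memory K Y}
    (hσ : Fits w S σ) (hx : σ.reg y ≤ σ.reg x)
    (h : Q () { σ with reg := Function.update σ.reg x (σ.reg x - σ.reg y) }) :
    Ensures w S (sub x y) Q σ := by
  refine Ensures.bind (ensures_scan _
    (fun j => Nat.ltAt (σ.reg x) (σ.reg y) j) hσ.pos_le hσ.width_pos hσ.width_lt
    (by simp [Nat.ltAt, Nat.mod_one]) (fun j _ => ?_) (ensures_skip ?_ h))
  · rw [bits_update, Nat.testBit_sub_ltAt hx, Nat.ltAt_succ]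
    rfl
  · exact ⟨hσ.pos_le, hσ.width_pos, hσ.width_lt⟩

/-- Test whether the registers `x` and `y` are equal. -/
noncomputable def equal (x y : K) : Fragment X Y (TrackSymbol K) Bool :=
  test (Function.update some x (some y))

theorem ensures_equal {x y : K} {Q : Bool → Memory K Y → Prop} {σ : Memory K Y}
    (hσ : Fits w S σ) (hx : σ.reg x < 2 ^ σ.width) (hy : σ.reg y < 2 ^ σ.width)
    (h : Q (decide (σ.reg x = σ.reg y)) σ) :
    Ensures w S (equal x y) Q σ := by
  refine ensures_test hσ (fun k hk => ?_) (fun k k' hk hkk => ?_) ?_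
  · by_cases h : k = x
    · exact h ▸ hx
    · simp [h] at hk
  · by_cases h : k = x
    · subst h
      simp only [Function.update_self, Option.some.injEq] at hk
      exact hk ▸ hy
    · simp only [Function.update_of_ne h, Option.some.injEq] at hk
      exact absurd hk.symm hkk
  · convert h using 2
    refine ⟨fun h => by simpa [selected] using congrFun h x, fun h => funext fun k => ?_⟩
    by_cases hk : k = x
    · subst hk; simpa [selected] using h
    · simp [selected, hk]

/-- Assign to register `x` the value of register `y`, or zero. -/
def assign (x : K) (y : Option K) : Fragment X Y (TrackSymbol K) Unit :=
  select (Function.update some x y)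

theorem ensures_assign {x : K} {y : Option K} {Q : Unit → Memory K Y → Prop} {σ : Memory K Y}
    (hσ : Fits w S σ) (h : Q () { σ with reg := Function.update σ.reg x (y.elim 0 σ.reg) }) :
    Ensures w S (assign x y) Q σ := by
  refine ensures_select hσ ?_
  convert h using 2
  funext k
  by_cases hk : k = x
  · subst hk; simp [selected]
  · simp [selected, hk]

end Fragment

/-! ### A representation detecting the center of the torus knot group -/

/-- A number divisible by all small numbers is large or zero. -/
theorem Int.eq_zero_of_forall_dvd {d : ℤ} {k : ℕ} (hk : 4 ≤ k)
    (h : ∀ q : ℕ, 2 ≤ q → q ≤ 2 * k → (q : ℤ) ∣ d) (hd : |d| < 2 ^ k) : d = 0 := by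
  have hdvd : k.centralBinom ∣ d.natAbs := by
    rw [Nat.dvd_iff_prime_pow_dvd_dvd]
    intro p i hp hi
    rcases i with _ | i
    · simp
    have hi' := (hp.pow_dvd_iff_le_factorization (Nat.centralBinom_ne_zero k)).1 hi
    -- A prime power dividing the binomial coefficient of `2 * k` over `k` is at most `2 * k`, hence
    -- among the `q` of the hypothesis.
    have hle : p ^ (i + 1) ≤ 2 * k :=
      (Nat.pow_le_pow_right hp.pos hi').trans (Nat.pow_factorization_choose_le (by omega))
    have h2 : 2 ≤ p ^ (i + 1) := hp.two_le.trans (Nat.le_self_pow (by omega) p)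
    exact Int.natCast_dvd.1 (h _ h2 hle)
  by_contra hd0
  have h1 := Nat.le_of_dvd (Int.natAbs_pos.2 hd0) hdvd
  have h2 := Nat.four_pow_lt_mul_centralBinom k hk
  have h3 : d.natAbs < 2 ^ k := by zify; exact_mod_cast hd
  have h4 : 4 ^ k = 2 ^ k * 2 ^ k := by
    rw [← mul_pow]; norm_num
  have h5 : k * k.centralBinom ≤ 2 ^ k * k.centralBinom :=
    Nat.mul_le_mul_right _ (Nat.lt_two_pow_self).le
  -- From `4 ^ k < k * centralBinom k` and `k < 2 ^ k`, cancelling one factor `2 ^ k`.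
  have h6 : 2 ^ k < k.centralBinom := by
    rw [h4] at h2
    exact Nat.lt_of_mul_lt_mul_left (h2.trans_le h5)
  omega

namespace TorusKnot

/-- The two generators are indexed by `Bool`, and `N t` is the exponent of the generator `t` in the
relation. -/
abbrev Index (N : Bool → ℕ) : Type := Σ t : Bool, ZMod (N t)

variable {N : Bool → ℕ}

/-- The action of the `e`-th power of the generator `t`. -/
def twist (t : Bool) (e : ℤ) (v : Index N → ℤ) : Index N → ℤ := fun i =>
  if i.1 = t then v ⟨i.1, i.2 - e⟩ +
    3 * v ⟨!i.1, 0⟩ * ((if i.2 = e then 1 else 0) - (if i.2 = 0 then 1 else 0))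
  else v i

/-- On the coordinates of type `t` this is the cyclic shift by `e`, conjugated by the shear that
adds three times the coordinate `⟨!t, 0⟩` to the coordinate `⟨t, 0⟩`. The coordinates of the other
type stay fixed. -/
theorem twist_self (t : Bool) (e : ℤ) (v : Index N → ℤ) (x : ZMod (N t)) :
    twist t e v ⟨t, x⟩ = v ⟨t, x - e⟩ +
      3 * v ⟨!t, 0⟩ * ((if x = e then 1 else 0) - (if x = 0 then 1 else 0)) := by
  simp [twist]

@[simp] theorem twist_not (t : Bool) (e : ℤ) (v : Index N → ℤ) (x : ZMod (N !t)) :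
    twist t e v ⟨!t, x⟩ = v ⟨!t, x⟩ := by
  simp [twist]

theorem index_cases (t : Bool) (i : Index N) :
    (∃ x : ZMod (N t), i = ⟨t, x⟩) ∨ ∃ x : ZMod (N !t), i = ⟨!t, x⟩ := by
  obtain ⟨u, x⟩ := i
  cases t <;> cases u <;> first | exact Or.inl ⟨x, rfl⟩ | exact Or.inr ⟨x, rfl⟩

/-- The indicator terms telescope: the one at `e` occurs with both signs and cancels. -/
theorem twist_twist (t : Bool) (e e' : ℤ) (v : Index N → ℤ) :
    twist t e (twist t e' v) = twist t (e + e') v := by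
  funext i
  rcases index_cases t i with ⟨x, rfl⟩ | ⟨x, rfl⟩
  · have h1 : x - (e : ZMod (N t)) = e' ↔ x = ((e + e' : ℤ) : ZMod (N t)) := by
      rw [sub_eq_iff_eq_add, Int.cast_add, add_comm]
    have h2 : x - (e : ZMod (N t)) = 0 ↔ x = e := sub_eq_zero
    have h3 : x - (e : ZMod (N t)) - e' = x - ((e + e' : ℤ) : ZMod (N t)) := by
      push_cast; ring
    rw [twist_self, twist_self, twist_not, twist_self]
    simp only [h1, h2, h3]
    ring
  · simp

@[simp] theorem twist_zero (t : Bool) (v : Index N → ℤ) : twist t 0 v = v := by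
  funext i
  rcases index_cases t i with ⟨x, rfl⟩ | ⟨x, rfl⟩
  · simp [twist_self]
  · simp

theorem twist_natCast_self (t : Bool) (v : Index N → ℤ) : twist t (N t) v = v := by
  funext i
  rcases index_cases t i with ⟨x, rfl⟩ | ⟨x, rfl⟩
  · simp [twist_self]
  · simp

/-- The generator `t` as a permutation. -/
def genPerm (N : Bool → ℕ) (t : Bool) : Equiv.Perm (Index N → ℤ) where
  toFun := twist t 1
  invFun := twist t (-1)
  left_inv v := by simp [twist_twist]
  right_inv v := by simp [twist_twist]

theorem genPerm_pow_apply (t : Bool) (e : ℕ) (v : Index N → ℤ) :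
    (genPerm N t ^ e) v = twist t e v := by
  induction e with
  | zero => simp
  | succ e ih =>
    rw [pow_succ', Equiv.Perm.mul_apply, ih]
    exact (twist_twist t 1 e v).trans (by rw [add_comm]; push_cast; rfl)

theorem genPerm_pow_self (t : Bool) : genPerm N t ^ N t = 1 := by
  ext1 v
  rw [genPerm_pow_apply, twist_natCast_self]
  rfl

/-- Only growth by a constant factor per letter matters; `7` is not optimal. -/
theorem abs_twist_one_le (t : Bool) {v : Index N → ℤ} {M : ℤ} (h : ∀ i, |v i| ≤ M) (i : Index N) :
    |twist t 1 v i| ≤ 7 * M := by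
  have hM : 0 ≤ M := (abs_nonneg _).trans (h i)
  rcases index_cases t i with ⟨x, rfl⟩ | ⟨x, rfl⟩
  · rw [twist_self]
    have h1 := abs_le.1 (h ⟨t, x - (1 : ℤ)⟩)
    have h2 := abs_le.1 (h ⟨!t, 0⟩)
    rw [abs_le]
    split_ifs <;> constructor <;> linarith
  · rw [twist_not]
    linarith [h ⟨!t, x⟩]

/-- The vector with the entry `1` at the index `0` of each type. -/
def baseVector (N : Bool → ℕ) : Index N → ℤ := fun i => if i.2 = 0 then 1 else 0

/-! ### Ping-pong for the free product of two cyclic groups. -/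

/-- The entry at `⟨t, 0⟩` is large. -/
structure Dominant (t : Bool) (v : Index N → ℤ) : Prop where
  other : ∀ x, |v ⟨!t, x⟩| ≤ |v ⟨t, 0⟩|
  same : ∀ x, |v ⟨t, x⟩| ≤ 2 * |v ⟨t, 0⟩|
  ne : v ⟨t, 0⟩ ≠ 0

theorem dominant_baseVector (t : Bool) : Dominant t (baseVector N) where
  other x := by simp only [baseVector]; split_ifs <;> simp
  same x := by simp only [baseVector]; split_ifs <;> simp
  ne := by simp [baseVector]

/-- Let `M` be the absolute value of the entry at `⟨!t, 0⟩`. As `e` is nonzero modulo `N t`, the new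
entry at `⟨t, 0⟩` is an old entry of size at most `M` minus three times that entry, so it has size
at least `2 * M`. The entries of type `!t` have size at most `2 * M`, and the new ones of type `t`
at most `4 * M`. This is what the factor `3` is chosen for. -/
theorem Dominant.twist {t : Bool} {v : Index N → ℤ} (h : Dominant (!t) v) {e : ℕ} (he : 0 < e)
    (heN : e < N t) : Dominant t (twist t e v) ∧
      2 * |v ⟨!t, 0⟩| ≤ |TorusKnot.twist t e v ⟨t, 0⟩| := by
  have he0 : ((e : ℤ) : ZMod (N t)) ≠ 0 := by
    rw [Int.cast_natCast, Ne, ZMod.natCast_eq_zero_iff]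
    exact fun hd => absurd (Nat.le_of_dvd he hd) (by omega)
  have hother : ∀ x : ZMod (N t), |v ⟨t, x⟩| ≤ |v ⟨!t, 0⟩| := by
    have := h.other
    rwa [Bool.not_not] at this
  have hpos : 0 < |v ⟨!t, 0⟩| := abs_pos.2 h.ne
  have h0 : TorusKnot.twist t e v ⟨t, 0⟩ = v ⟨t, 0 - (e : ℤ)⟩ - 3 * v ⟨!t, 0⟩ := by
    rw [twist_self, if_neg he0.symm, if_pos rfl]; ring
  have habs : |3 * v ⟨!t, 0⟩| = 3 * |v ⟨!t, 0⟩| := by rw [abs_mul]; norm_num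
  have h1 : 2 * |v ⟨!t, 0⟩| ≤ |TorusKnot.twist t e v ⟨t, 0⟩| := by
    rw [h0]
    have := abs_sub_abs_le_abs_sub (3 * v ⟨!t, 0⟩) (v ⟨t, 0 - (e : ℤ)⟩)
    rw [abs_sub_comm] at this
    linarith [hother (0 - (e : ℤ))]
  refine ⟨⟨fun x => ?_, fun x => ?_, fun hz => ?_⟩, h1⟩
  · rw [twist_not]
    exact (h.same x).trans h1
  · by_cases hx : x = 0
    · subst hx; linarith [abs_nonneg (TorusKnot.twist t e v ⟨t, 0⟩)]
    · have hle : |TorusKnot.twist t e v ⟨t, x⟩| ≤ |v ⟨t, x - (e : ℤ)⟩| + 3 * |v ⟨!t, 0⟩| := by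
        rw [twist_self, if_neg hx]
        split_ifs
        · rw [← habs]; simpa using abs_add_le (v ⟨t, x - (e : ℤ)⟩) (3 * v ⟨!t, 0⟩)
        · simp
      linarith [hother (x - (e : ℤ))]
  · rw [hz, abs_zero] at h1
    linarith

/-- Exponents of a reduced product of powers of the two generators in turn, starting with the
generator `t`. -/
def Reduced (N : Bool → ℕ) : Bool → List ℕ → Prop
  | _, [] => True
  | t, e :: es => 0 < e ∧ e < N t ∧ Reduced N (!t) es

/-- The image of the base vector under a product of powers of the two generators in turn. -/
def orbitPoint (N : Bool → ℕ) : Bool → List ℕ → Index N → ℤ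
  | _, [] => baseVector N
  | t, e :: es => twist t e (orbitPoint N (!t) es)

theorem Reduced.dominant_cons {t : Bool} {es : List ℕ} {e : ℕ} (he : 0 < e) (heN : e < N t)
    (h : Dominant (!t) (orbitPoint N (!t) es)) : Dominant t (orbitPoint N t (e :: es)) :=
  (h.twist he heN).1

theorem Reduced.dominant {t : Bool} {es : List ℕ} (h : Reduced N t es) :
    Dominant t (orbitPoint N t es) := by
  induction es generalizing t with
  | nil => exact dominant_baseVector t
  | cons e es ih => exact Reduced.dominant_cons h.1 h.2.1 (ih h.2.2)

/-- The twist keeps the entry at `⟨!t, 0⟩` and makes the one at `⟨t, 0⟩` at least twice as large,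
whereas dominance of `!t` in `v'` makes the latter at most as large. -/
theorem twist_ne_of_dominant {t : Bool} {v v' : Index N → ℤ} (h : Dominant (!t) v)
    (h' : Dominant (!t) v') {e : ℕ} (he : 0 < e) (heN : e < N t) : twist t e v ≠ v' := by
  rintro rfl
  have h1 := (h.twist he heN).2
  have h2 := h'.other
  rw [Bool.not_not] at h2
  have h3 := h2 0
  rw [twist_not] at h3
  linarith [abs_pos.2 h.ne]

/-- Undoing the smaller power leaves a twist by `e' - e`, which `twist_ne_of_dominant` excludes
unless the difference is `0`. -/
theorem twist_injective {t : Bool} {v v' : Index N → ℤ} (h : Dominant (!t) v)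
    (h' : Dominant (!t) v') {e e' : ℕ} (he : e < N t) (he' : e' < N t)
    (heq : twist t e v = twist t e' v') : e = e' ∧ v = v' := by
  wlog hle : e ≤ e' generalizing e e' v v'
  · have := this h' h he' he heq.symm (by omega)
    exact ⟨this.1.symm, this.2.symm⟩
  have h1 : v = twist t ((e' - e : ℕ) : ℤ) v' := by
    have h2 := congrArg (twist t (-e)) heq
    rw [twist_twist, twist_twist, neg_add_cancel, twist_zero] at h2
    rw [h2]
    congr 1
    omega
  rcases hle.eq_or_lt with rfl | hlt
  · refine ⟨rfl, ?_⟩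
    simpa using h1
  · exact absurd h1.symm (twist_ne_of_dominant h' h (by omega) (by omega))

/-- This is the uniqueness of normal forms in the free product: the exponents are recovered from the
orbit point one by one, beginning with the first. -/
theorem Reduced.orbitPoint_injective {t : Bool} {es es' : List ℕ} (h : Reduced N t es)
    (h' : Reduced N t es') (heq : orbitPoint N t es = orbitPoint N t es') : es = es' := by
  induction es generalizing t es' with
  | nil =>
    rcases es' with _ | ⟨e', es'⟩
    · rfl
    · exact absurd heq.symm (twist_ne_of_dominant h'.2.2.dominant (dominant_baseVector _) h'.1 h'.2.1)
  | cons e es ih =>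
    rcases es' with _ | ⟨e', es'⟩
    · exact absurd heq (twist_ne_of_dominant h.2.2.dominant (dominant_baseVector _) h.1 h.2.1)
    · obtain ⟨rfl, h2⟩ := twist_injective h.2.2.dominant h'.2.2.dominant h.2.1 h'.2.1 heq
      rw [ih h.2.2 h'.2.2 h2]

/-! ### Groups with the central relation, their representation and their exponent map. -/

/-- The letters in which the algorithm works: the generators, the inverse of the central element,
and a letter for the identity. -/
inductive Letter : Type
  | gen (t : Bool)
  | zinv
  | one

instance : Finite Letter :=
  Finite.of_surjective (fun o : Option (Option Bool) => match o with
    | none => Letter.one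
    | some none => Letter.zinv
    | some (some t) => Letter.gen t) fun l => match l with
    | Letter.one => ⟨none, rfl⟩
    | Letter.zinv => ⟨some none, rfl⟩
    | Letter.gen t => ⟨some (some t), rfl⟩

/-- A group with two generators `g t` such that the elements `g t ^ N t` coincide, with a
representation `ρ` on vectors and an exponent map `τ`. -/
structure Setting (N : Bool → ℕ) (G : Type) [Group G] where
  g : Bool → G
  ρ : G →* Equiv.Perm (Index N → ℤ)
  τ : G →* Multiplicative ℤ
  pos : ∀ t, 0 < N t
  pow_eq : g true ^ N true = g false ^ N false
  ρ_g : ∀ t, ρ (g t) = genPerm N t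
  τ_g : ∀ t, τ (g t) = Multiplicative.ofAdd (N (!t) : ℤ)
  closure_eq : Subgroup.closure (Set.range g) = ⊤

namespace Setting

variable {G : Type} [Group G] (𝒮 : Setting N G)

/-- The central element. -/
def z : G := 𝒮.g false ^ N false

/-- The value of a letter. -/
def letter : Letter → G
  | Letter.gen t => 𝒮.g t
  | Letter.zinv => 𝒮.z⁻¹
  | Letter.one => 1

/-- A product of powers of the two generators in turn. -/
def syllables : Bool → List ℕ → G
  | _, [] => 1
  | t, e :: es => 𝒮.g t ^ e * syllables (!t) es

theorem g_pow (t : Bool) : 𝒮.g t ^ N t = 𝒮.z := by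
  cases t
  · rfl
  · exact 𝒮.pow_eq

theorem ρ_z : 𝒮.ρ 𝒮.z = 1 := by
  rw [z, map_pow, ρ_g, genPerm_pow_self]

theorem ρ_syllables (t : Bool) (es : List ℕ) :
    𝒮.ρ (𝒮.syllables t es) (baseVector N) = orbitPoint N t es := by
  induction es generalizing t with
  | nil => simp [syllables, orbitPoint]
  | cons e es ih =>
    rw [syllables, map_mul, Equiv.Perm.mul_apply, ih, map_pow, ρ_g, genPerm_pow_apply]
    rfl

theorem commute_z_g (t : Bool) : Commute 𝒮.z (𝒮.g t) := by
  rw [← 𝒮.g_pow t]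
  exact (Commute.refl _).pow_left _

theorem commute_z (x : G) : Commute 𝒮.z x := by
  have : x ∈ Subgroup.closure (Set.range 𝒮.g) := by rw [closure_eq]; trivial
  induction this using Subgroup.closure_induction with
  | mem x hx => obtain ⟨t, rfl⟩ := hx; exact 𝒮.commute_z_g t
  | one => exact Commute.one_right _
  | mul x y _ _ hx hy => exact hx.mul_right hy
  | inv x _ hx => exact hx.inv_right

/-- Every element is the value of a word. -/
theorem exists_word (x : G) : ∃ l : List Letter, (l.map 𝒮.letter).prod = x := by
  have h : Submonoid.closure (Set.range 𝒮.letter) = ⊤ := by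
    rw [eq_top_iff]
    have hg : ∀ t, 𝒮.g t ∈ Submonoid.closure (Set.range 𝒮.letter) := fun t =>
      Submonoid.subset_closure ⟨Letter.gen t, rfl⟩
    rintro x -
    have : x ∈ Subgroup.closure (Set.range 𝒮.g) := by rw [closure_eq]; trivial
    refine Subgroup.closure_induction_right (p := fun x _ => x ∈ _) (one_mem _) ?_ ?_ this
    · rintro x _ y ⟨t, rfl⟩ hx
      exact mul_mem hx (hg t)
    · rintro x _ y ⟨t, rfl⟩ hx
      -- Letters for the inverse generators are dispensable: such an inverse is a positive power
      -- times the inverse of the central element.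
      have h1 : (𝒮.g t)⁻¹ = 𝒮.g t ^ (N t - 1) * 𝒮.z⁻¹ := by
        rw [← 𝒮.g_pow t, eq_mul_inv_iff_mul_eq, inv_mul_eq_iff_eq_mul, ← pow_succ',
          Nat.sub_add_cancel (𝒮.pos t)]
      rw [h1]
      exact mul_mem hx (mul_mem (pow_mem (hg t) _) (Submonoid.subset_closure ⟨Letter.zinv, rfl⟩))
  have hx : x ∈ Submonoid.closure (Set.range 𝒮.letter) := by rw [h]; trivial
  induction hx using Submonoid.closure_induction with
  | mem x hx => obtain ⟨l, rfl⟩ := hx; exact ⟨[l], by simp⟩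
  | one => exact ⟨[], rfl⟩
  | mul x y _ _ hx hy =>
    obtain ⟨l, rfl⟩ := hx
    obtain ⟨l', rfl⟩ := hy
    exact ⟨l ++ l', by simp⟩

/-- Only the first exponent changes. If it reaches `N t`, the power equals `z`, which is moved to
the right end. -/
theorem exists_reduced_g_mul (t u : Bool) {es : List ℕ} (h : Reduced N u es) :
    ∃ t' es' , ∃ k : ℤ, Reduced N t' es' ∧
      𝒮.g t * 𝒮.syllables u es = 𝒮.syllables t' es' * 𝒮.z ^ k := by
  have key : ∀ e es, e < N t → Reduced N (!t) es → ∃ t' es' , ∃ k : ℤ, Reduced N t' es' ∧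
      𝒮.g t * (𝒮.g t ^ e * 𝒮.syllables (!t) es) = 𝒮.syllables t' es' * 𝒮.z ^ k := by
    intro e es he hes
    rcases (Nat.succ_le_of_lt he).eq_or_lt with h1 | h1
    · refine ⟨!t, es, 1, hes, ?_⟩
      rw [← mul_assoc, ← pow_succ', show e + 1 = N t from h1, g_pow, zpow_one]
      exact 𝒮.commute_z _
    · refine ⟨t, (e + 1) :: es, 0, ⟨Nat.succ_pos e, h1, hes⟩, ?_⟩
      rw [← mul_assoc, ← pow_succ', zpow_zero, mul_one]
      rfl
  by_cases htu : u = t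
  · subst htu
    rcases es with _ | ⟨e, es⟩
    · simpa [syllables] using key 0 [] (𝒮.pos u) trivial
    · exact key e es h.2.1 h.2.2
  · obtain rfl : u = !t := by cases t <;> cases u <;> simp_all
    -- A product beginning with the other generator is read as one with the exponent `0` in front.
    simpa using key 0 es (𝒮.pos t) h

theorem exists_reduced (x : G) :
    ∃ t es, ∃ k : ℤ, Reduced N t es ∧ x = 𝒮.syllables t es * 𝒮.z ^ k := by
  obtain ⟨l, rfl⟩ := 𝒮.exists_word x
  induction l with
  | nil => exact ⟨true, [], 0, trivial, by simp [syllables]⟩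
  | cons a l ih =>
    obtain ⟨t, es, k, h, heq⟩ := ih
    rw [List.map_cons, List.prod_cons, heq, ← mul_assoc]
    cases a with
    | gen u =>
      obtain ⟨t', es', k', h', heq'⟩ := 𝒮.exists_reduced_g_mul u t h
      refine ⟨t', es', k' + k, h', ?_⟩
      rw [zpow_add, ← mul_assoc, ← heq']
      rfl
    | zinv =>
      refine ⟨t, es, -1 + k, h, ?_⟩
      rw [zpow_add, ← mul_assoc, zpow_neg_one]
      congr 1
      exact (𝒮.commute_z _).inv_left
    | one => exact ⟨t, es, k, h, by simp [letter]⟩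

/-- The stabilizer of the base vector consists of the powers of the central element. -/
theorem eq_zpow_of_ρ_baseVector {x : G} (hx : 𝒮.ρ x (baseVector N) = baseVector N) :
    ∃ k : ℤ, x = 𝒮.z ^ k := by
  obtain ⟨t, es, k, h, rfl⟩ := 𝒮.exists_reduced x
  rw [map_mul, map_zpow, ρ_z, one_zpow, mul_one, ρ_syllables] at hx
  obtain rfl := h.orbitPoint_injective (es' := []) trivial hx
  exact ⟨k, by simp [syllables]⟩

/-- Owing to this the machine need only follow a single vector instead of a matrix. -/
theorem ρ_eq_one_iff {x : G} : 𝒮.ρ x = 1 ↔ 𝒮.ρ x (baseVector N) = baseVector N := by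
  refine ⟨fun h => by rw [h]; rfl, fun h => ?_⟩
  obtain ⟨k, rfl⟩ := 𝒮.eq_zpow_of_ρ_baseVector h
  rw [map_zpow, ρ_z, one_zpow]

theorem τ_z : 𝒮.τ 𝒮.z = Multiplicative.ofAdd (N false * N true : ℤ) := by
  rw [z, map_pow, τ_g, ← ofAdd_nsmul]
  simp

/-- The representation separates the exponents of the generators; then `τ`, which does not kill `z`,
determines the exponent of `z`. The first exponent may be `0`, so that all normal forms can begin
with the same generator. -/
theorem eq_of_syllables_eq {e e' : ℕ} {es es' : List ℕ} {k k' : ℤ} (he : e < N false)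
    (he' : e' < N false) (hes : Reduced N true es) (hes' : Reduced N true es')
    (heq : 𝒮.syllables false (e :: es) * 𝒮.z ^ k = 𝒮.syllables false (e' :: es') * 𝒮.z ^ k') :
    e = e' ∧ es = es' ∧ k = k' := by
  have h1 := congrArg (fun x => 𝒮.ρ x (baseVector N)) heq
  simp only [map_mul, map_zpow, ρ_z, one_zpow, mul_one, ρ_syllables] at h1
  obtain ⟨rfl, h2⟩ := twist_injective (t := false) hes.dominant hes'.dominant he he' h1
  obtain rfl := hes.orbitPoint_injective hes' h2
  refine ⟨rfl, rfl, ?_⟩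
  have h3 := congrArg 𝒮.τ (mul_left_cancel heq)
  rw [map_zpow, map_zpow, τ_z, ← ofAdd_zsmul, ← ofAdd_zsmul] at h3
  have h4 : k * (N false * N true : ℤ) = k' * (N false * N true : ℤ) := by
    simpa using congrArg Multiplicative.toAdd h3
  refine mul_right_cancel₀ ?_ h4
  have := 𝒮.pos false
  have := 𝒮.pos true
  positivity

theorem abs_ρ_baseVector_le (l : List Letter) (i : Index N) :
    |𝒮.ρ (l.map 𝒮.letter).prod (baseVector N) i| ≤ 7 ^ l.length := by
  induction l generalizing i with
  | nil => 
    rw [List.map_nil, List.prod_nil, map_one, Equiv.Perm.one_apply, baseVector]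
    split_ifs <;> simp
  | cons a l ih =>
    rw [List.map_cons, List.prod_cons, map_mul, Equiv.Perm.mul_apply, List.length_cons, pow_succ']
    have h7 : (7 : ℤ) ^ l.length ≤ 7 * 7 ^ l.length := by
      have : (0 : ℤ) < 7 ^ l.length := by positivity
      linarith
    cases a with
    | gen t =>
      rw [letter, ρ_g]
      exact abs_twist_one_le t ih i
    | zinv =>
      rw [letter, map_inv, ρ_z, inv_one]
      exact (ih i).trans h7
    | one =>
      rw [letter, map_one]
      exact (ih i).trans h7

end Setting

end TorusKnot

open TorusKnot in
/-- The torus knot group as an instance of the general setting. -/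
noncomputable def TorusKnotGroup.setting (m n : ℕ) (hm : 0 < m) (hn : 0 < n) :
    Setting (fun t => if t then n else m) (TorusKnotGroup m n) :=
  have h {H : Type} [Group H] {f : Fin 2 → H} (hf : f 0 ^ m = f 1 ^ n) :
      ∀ r ∈ ({FreeGroup.of 0 ^ m * (FreeGroup.of 1 ^ n)⁻¹} : Set (FreeGroup (Fin 2))),
        FreeGroup.lift f r = 1 := by
    rintro r rfl
    simp [hf]
  { g := fun t => PresentedGroup.of (if t then 1 else 0)
    ρ := PresentedGroup.toGroup (f := ![genPerm _ false, genPerm _ true]) (h (by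
      -- Both sides of the defining relation act trivially.
      have h1 := genPerm_pow_self (N := fun t => if t then n else m) false
      have h2 := genPerm_pow_self (N := fun t => if t then n else m) true
      exact h1.trans h2.symm))
    τ := PresentedGroup.toGroup
      (f := ![Multiplicative.ofAdd (n : ℤ), Multiplicative.ofAdd (m : ℤ)]) (h (by
        change Multiplicative.ofAdd (n : ℤ) ^ m = Multiplicative.ofAdd (m : ℤ) ^ n
        rw [← ofAdd_nsmul, ← ofAdd_nsmul, nsmul_eq_mul, nsmul_eq_mul, mul_comm]))
    pos := by intro t; cases t <;> simpa
    pow_eq := by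
      have := PresentedGroup.one_of_mem (rels :=
        ({FreeGroup.of 0 ^ m * (FreeGroup.of 1 ^ n)⁻¹} : Set (FreeGroup (Fin 2)))) rfl
      rw [map_mul, map_inv, map_pow, map_pow, mul_inv_eq_one] at this
      exact this.symm
    ρ_g := by
      intro t
      cases t <;> simp
    τ_g := by
      intro t
      cases t <;> simp
    closure_eq := by
      rw [eq_top_iff, ← PresentedGroup.closure_range_of]
      refine Subgroup.closure_mono ?_
      rintro _ ⟨i, rfl⟩
      fin_cases i
      · exact ⟨false, rfl⟩
      · exact ⟨true, rfl⟩ }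

/-! ### The program -/

/-- The registers apart from those that hold a vector. -/
inductive RegisterName : Type
  | one | len | lim | up | down | cur | probe | modu | idx
  deriving DecidableEq

instance : Finite RegisterName :=
  Finite.of_surjective
    ![RegisterName.one, .len, .lim, .up, .down, .cur, .probe, .modu, .idx] fun x => by
    cases x
    exacts [⟨0, rfl⟩, ⟨1, rfl⟩, ⟨2, rfl⟩, ⟨3, rfl⟩, ⟨4, rfl⟩, ⟨5, rfl⟩, ⟨6, rfl⟩, ⟨7, rfl⟩, ⟨8, rfl⟩]

namespace Fragment

open Memory RegisterName

variable {X Y V E : Type} {w : List X} {S : ℕ} {σ : Memory (RegisterName ⊕ V) Y}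

theorem Fits.setReg {K : Type} {σ : Memory K Y} (h : Fits w S σ) (r : K → ℕ) :
    Fits w S { σ with reg := r } :=
  ⟨h.pos_le, h.width_pos, h.width_lt⟩

theorem Fits.setPos {K : Type} {σ : Memory K Y} (h : Fits w S σ) {p : ℕ} (hp : p ≤ w.length + 1) :
    Fits w S { σ with pos := p } :=
  ⟨hp, h.width_pos, h.width_lt⟩

/-- Move the input head to the left end. -/
def rewind {K : Type} : Fragment X Y (TrackSymbol K) Unit :=
  iter (P := Unit) (fun _ => act fun
    | InputSymbol.leftEnd => (Sum.inr (), HeadMove.stay, [])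
    | _ => (Sum.inl (), HeadMove.left, [])) ()

theorem inputAt_succ_ne (w : List X) (p : ℕ) :
    Transducer.inputAt w (p + 1) ≠ InputSymbol.leftEnd := by
  simp only [Transducer.inputAt]
  split <;> simp

theorem inputAt_succ {w : List X} {p : ℕ} (hp : p < w.length) :
    Transducer.inputAt w (p + 1) = InputSymbol.letter w[p] := by
  simp [Transducer.inputAt, hp]

theorem inputAt_length_succ (w : List X) :
    Transducer.inputAt w (w.length + 1) = InputSymbol.rightEnd := by
  simp [Transducer.inputAt]

theorem ensures_rewind {K : Type} {Q : Unit → Memory K Y → Prop} {σ : Memory K Y}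
    (hσ : Fits w S σ) (h : Q () { σ with pos := 0 }) : Ensures w S rewind Q σ := by
  obtain ⟨W, p, r, o⟩ := σ
  have hS := hσ.width_pos.trans hσ.width_lt
  induction p with
  | zero =>
    refine Ensures.iter (ensures_act hS ?_)
    simpa [Transducer.inputAt, HeadMove.apply] using h
  | succ p ih =>
    refine Ensures.iter (ensures_act hS ?_)
    have hp := hσ.pos_le
    have hp' : p ≤ w.length + 1 := by simp at hp; omega
    have := ih ⟨hp', hσ.width_pos, hσ.width_lt⟩ h
    dsimp only
    split
    · rename_i h1; exact absurd h1 (inputAt_succ_ne w p)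
    · simpa [HeadMove.apply, hp', rewind] using this

/-- Increase register `x` by `c`. -/
def increase [DecidableEq V] (x : RegisterName) : ℕ →
    Fragment X Y (TrackSymbol (RegisterName ⊕ V)) Unit
  | 0 => skip ()
  | c + 1 => (add (Sum.inl x) (Sum.inl one)).bind fun _ => increase x c

theorem ensures_increase [DecidableEq V] {Q : Unit → Memory (RegisterName ⊕ V) Y → Prop}
    {x : RegisterName} (hx : x ≠ one) {c : ℕ}
    (hσ : Fits w S σ) (h1 : σ.reg (Sum.inl one) = 1) (hc : σ.reg (Sum.inl x) + c < 2 ^ σ.width)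
    (h : Q () { σ with
      reg := Function.update σ.reg (Sum.inl x) (σ.reg (Sum.inl x) + c) }) :
    Ensures w S (increase x c) Q σ := by
  induction c generalizing σ with
  | zero =>
    refine ensures_skip hσ ?_
    simpa using h
  | succ c ih =>
    refine Ensures.bind (ensures_add hσ (by omega) (ih (hσ.setReg _) ?_ ?_ ?_))
    · simpa [hx.symm] using h1
    · simp [h1]; omega
    · simpa [h1, add_assoc, add_comm 1 c] using h

/-- Move the input head to the square whose number is in register `x`, and copy this number to the
register `idx`. -/
noncomputable def goto [DecidableEq V] (x : RegisterName) :
    Fragment X Y (TrackSymbol (RegisterName ⊕ V)) Unit :=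
  rewind.bind fun _ => (assign (Sum.inl idx) none).bind fun _ =>
    iter (P := Unit) (fun _ => (equal (Sum.inl idx) (Sum.inl x)).bind fun b =>
      if b then skip (Sum.inr ()) else
        (act fun _ => ((), HeadMove.right, [])).bind fun _ =>
          (increase idx 1).bind fun _ => skip (Sum.inl ())) ()

/-- A machine cannot read off the position of its input head; `idx` counts along with the head from
the left end. -/
theorem ensures_goto [DecidableEq V] {Q : Unit → Memory (RegisterName ⊕ V) Y → Prop}
    {x : RegisterName} (hx : x ≠ idx) (hσ : Fits w S σ) (h1 : σ.reg (Sum.inl one) = 1)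
    (hle : σ.reg (Sum.inl x) ≤ w.length) (hlt : σ.reg (Sum.inl x) < 2 ^ σ.width)
    (h : Q () { σ with
      pos := σ.reg (Sum.inl x)
      reg := Function.update σ.reg (Sum.inl idx) (σ.reg (Sum.inl x)) }) :
    Ensures w S (goto x) Q σ := by
  refine Ensures.bind (ensures_rewind hσ (Ensures.bind (ensures_assign
    (hσ.setPos (Nat.zero_le _)) ?_)))
  have key : ∀ d p, p + d = σ.reg (Sum.inl x) →
      Ensures w S (iter (P := Unit) (fun _ => (equal (Sum.inl idx) (Sum.inl x)).bind fun b =>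
        if b then skip (Sum.inr ()) else
          (act fun _ => ((), HeadMove.right, [])).bind fun _ =>
            (increase idx 1).bind fun _ => skip (Sum.inl ())) ()) Q
        { σ with pos := p, reg := Function.update σ.reg (Sum.inl idx) p } := by
    intro d
    induction d with
    | zero =>
      intro p hp
      rw [Nat.add_zero] at hp
      have hfit : Fits w S { σ with pos := p, reg := Function.update σ.reg (Sum.inl idx) p } :=
        (hσ.setPos (p := p) (by omega)).setReg _
      refine Ensures.iter (Ensures.bind (ensures_equal hfit ?_ ?_ ?_))
      · simp; omega
      · simpa [hx] using hlt
      · simp only [Function.update_self, ne_eq, Sum.inl.injEq, hx, not_false_eq_true,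
          Function.update_of_ne]
        rw [if_pos (by simpa using hp)]
        refine ensures_skip hfit ?_
        simpa [hp] using h
    | succ d ih =>
      intro p hp
      have hfit : Fits w S { σ with pos := p, reg := Function.update σ.reg (Sum.inl idx) p } :=
        (hσ.setPos (p := p) (by omega)).setReg _
      have hfit' : Fits w S { σ with pos := p + 1, reg := Function.update σ.reg (Sum.inl idx) p } :=
        (hσ.setPos (p := p + 1) (by omega)).setReg _
      refine Ensures.iter (Ensures.bind (ensures_equal hfit ?_ ?_ ?_))
      · simp; omega
      · simpa [hx] using hlt
      · simp only [Function.update_self, ne_eq, Sum.inl.injEq, hx, not_false_eq_true,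
          Function.update_of_ne]
        rw [if_neg (by simp; omega)]
        refine Ensures.bind (ensures_act (hσ.width_pos.trans hσ.width_lt) ?_)
        simp only [HeadMove.apply, List.append_nil]
        rw [min_eq_left (by omega)]
        refine Ensures.bind (ensures_increase (by simp) hfit' (by simpa using h1)
          (by simp; omega) (ensures_skip (hfit'.setReg _) ?_))
        simpa using ih (p + 1) (by omega)
  simpa using key _ 0 (zero_add _)

end Fragment

/-! ### Arithmetic modulo `q` and the action of the generators on residues. -/

namespace Fragment

open Memory RegisterName TorusKnot

variable {X Y V E : Type} {w : List X} {S : ℕ} {σ : Memory (RegisterName ⊕ V) Y}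

section Modular

/-- The registers hold the entries of `v` modulo `q`. -/
def Holds (q : ℕ) (v : V → ℤ) (r : RegisterName ⊕ V → ℕ) : Prop :=
  ∀ i, (r (Sum.inr i) : ℤ) = v i % q

theorem Holds.lt {q : ℕ} {v : V → ℤ} {r : RegisterName ⊕ V → ℕ} (h : Holds q v r) (hq : 0 < q)
    (i : V) : r (Sum.inr i) < q := by
  have := Int.emod_lt_of_pos (v i) (Int.natCast_pos.2 hq)
  rw [← h i] at this
  exact_mod_cast this

variable [DecidableEq V]

/-- Reduce register `x` once by the modulus. -/
def reduceOnce (x : V) : Fragment X Y (TrackSymbol (RegisterName ⊕ V)) Unit :=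
  (less (Sum.inr x) (Sum.inl modu)).bind fun b =>
    if b then skip () else sub (Sum.inr x) (Sum.inl modu)

/-- Add register `y` to register `x` modulo the modulus. -/
def modAdd (x y : V) : Fragment X Y (TrackSymbol (RegisterName ⊕ V)) Unit :=
  (add (Sum.inr x) (Sum.inr y)).bind fun _ => reduceOnce x

/-- Subtract register `y` from register `x` modulo the modulus. -/
def modSub (x y : V) : Fragment X Y (TrackSymbol (RegisterName ⊕ V)) Unit :=
  (add (Sum.inr x) (Sum.inl modu)).bind fun _ =>
    (sub (Sum.inr x) (Sum.inr y)).bind fun _ => reduceOnce x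

variable {Q : Unit → Memory (RegisterName ⊕ V) Y → Prop}

theorem ensures_reduceOnce {x : V} {q : ℕ} (hσ : Fits w S σ) (hq : σ.reg (Sum.inl modu) = q)
    (hqW : 2 * q ≤ 2 ^ σ.width) (hx : σ.reg (Sum.inr x) < 2 * q)
    (h : Q () { σ with
      reg := Function.update σ.reg (Sum.inr x) (σ.reg (Sum.inr x) % q) }) :
    Ensures w S (reduceOnce x) Q σ := by
  refine Ensures.bind (ensures_less hσ (by omega) (by omega) ?_)
  rw [hq]
  by_cases hlt : σ.reg (Sum.inr x) < q
  · rw [if_pos (by simpa using hlt)]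
    refine ensures_skip hσ ?_
    rwa [Nat.mod_eq_of_lt hlt, Function.update_eq_self] at h
  · rw [if_neg (by simpa using hlt)]
    refine ensures_sub hσ (by omega) ?_
    rwa [Nat.mod_eq_sub_mod (by omega), Nat.mod_eq_of_lt (by omega), ← hq] at h

theorem ensures_modAdd {x y : V} {v : V → ℤ} {q : ℕ} (hσ : Fits w S σ)
    (hq : σ.reg (Sum.inl modu) = q) (hqW : 2 * q ≤ 2 ^ σ.width) (hq0 : 0 < q)
    (hv : Holds q v σ.reg)
    (h : ∀ r, (∀ a, r (Sum.inl a) = σ.reg (Sum.inl a)) →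
      Holds q (Function.update v x (v x + v y)) r → Q () { σ with reg := r }) :
    Ensures w S (modAdd x y) Q σ := by
  have hx := hv.lt hq0 x
  have hy := hv.lt hq0 y
  refine Ensures.bind (ensures_add hσ (by omega) (ensures_reduceOnce (hσ.setReg _)
    (by simpa using hq) hqW (by simp; omega) ?_))
  refine h _ (fun a => by simp) fun i => ?_
  by_cases hi : i = x
  · subst hi
    simp only [Function.update_self]
    push_cast
    rw [hv, hv, ← Int.add_emod]
  · simpa [hi] using hv i

/-- Adding the modulus first keeps the natural number subtraction exact. The result is below `2 *
q`, so one reduction suffices; the intermediate sum fits because `2 * q ≤ 2 ^ σ.width`. -/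
theorem ensures_modSub {x y : V} {v : V → ℤ} {q : ℕ} (hxy : y ≠ x) (hσ : Fits w S σ)
    (hq : σ.reg (Sum.inl modu) = q) (hqW : 2 * q ≤ 2 ^ σ.width) (hq0 : 0 < q)
    (hv : Holds q v σ.reg)
    (h : ∀ r, (∀ a, r (Sum.inl a) = σ.reg (Sum.inl a)) →
      Holds q (Function.update v x (v x - v y)) r → Q () { σ with reg := r }) :
    Ensures w S (modSub x y) Q σ := by
  have hx := hv.lt hq0 x
  have hy := hv.lt hq0 y
  refine Ensures.bind (ensures_add hσ (by omega) (Ensures.bind (ensures_sub (hσ.setReg _)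
    (by simp [hxy]; omega) (ensures_reduceOnce ((hσ.setReg _).setReg _) (by simpa using hq) hqW
    (by simp [hxy]; omega) ?_))))
  refine h _ (fun a => by simp) fun i => ?_
  by_cases hi : i = x
  · subst hi
    simp only [Function.update_self, ne_eq, Sum.inr.injEq, hxy, not_false_eq_true,
      Function.update_of_ne, hq]
    rw [Nat.add_sub_assoc hy.le]
    push_cast [hy.le]
    rw [hv, hv, Int.add_emod, Int.emod_emod, ← Int.add_emod, ← add_sub_assoc, add_sub_right_comm,
      Int.add_emod_right]
    simp
  · simpa [hi] using hv i

end Modular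

variable {N : Bool → ℕ} {τ : Memory (RegisterName ⊕ Index N) Y}
  {Q : Unit → Memory (RegisterName ⊕ Index N) Y → Prop}

/-- The permutation of registers used for the generator `t`. -/
def shift (N : Bool → ℕ) (t : Bool) : RegisterName ⊕ Index N → Option (RegisterName ⊕ Index N)
  | Sum.inl a => some (Sum.inl a)
  | Sum.inr i => some (Sum.inr ⟨i.1, i.2 - if i.1 = t then 1 else 0⟩)

/-- Apply the generator `t` to the vector in the registers. -/
def applyGen (t : Bool) : Fragment X Y (TrackSymbol (RegisterName ⊕ Index N)) Unit :=
  (modAdd ⟨t, 0⟩ ⟨!t, 0⟩).bind fun _ => (modAdd ⟨t, 0⟩ ⟨!t, 0⟩).bind fun _ =>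
  (modAdd ⟨t, 0⟩ ⟨!t, 0⟩).bind fun _ => (select (shift N t)).bind fun _ =>
  (modSub ⟨t, 0⟩ ⟨!t, 0⟩).bind fun _ => (modSub ⟨t, 0⟩ ⟨!t, 0⟩).bind fun _ =>
  modSub ⟨t, 0⟩ ⟨!t, 0⟩

theorem not_index_ne (t : Bool) : (⟨!t, 0⟩ : Index N) ≠ ⟨t, 0⟩ := by
  intro h
  have := congrArg Sigma.fst h
  cases t <;> simp at this

/-- The left side has the form that three successive uses of `ensures_modAdd` produce. -/
theorem update_add_three {V : Type} [DecidableEq V] (v : V → ℤ) {x y : V} (hxy : y ≠ x) :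
    Function.update (Function.update (Function.update v x (v x + v y)) x
      (Function.update v x (v x + v y) x + Function.update v x (v x + v y) y)) x
      (Function.update (Function.update v x (v x + v y)) x
      (Function.update v x (v x + v y) x + Function.update v x (v x + v y) y) x +
      Function.update (Function.update v x (v x + v y)) x
      (Function.update v x (v x + v y) x + Function.update v x (v x + v y) y) y) =
    Function.update v x (v x + 3 * v y) := by
  simp only [Function.update_self, Function.update_idem, ne_eq, hxy, not_false_eq_true,
    Function.update_of_ne]
  congr 1
  ring

theorem update_sub_three {V : Type} [DecidableEq V] (v : V → ℤ) {x y : V} (hxy : y ≠ x) :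
    Function.update (Function.update (Function.update v x (v x - v y)) x
      (Function.update v x (v x - v y) x - Function.update v x (v x - v y) y)) x
      (Function.update (Function.update v x (v x - v y)) x
      (Function.update v x (v x - v y) x - Function.update v x (v x - v y) y) x -
      Function.update (Function.update v x (v x - v y)) x
      (Function.update v x (v x - v y) x - Function.update v x (v x - v y) y) y) =
    Function.update v x (v x - 3 * v y) := by
  simp only [Function.update_self, Function.update_idem, ne_eq, hxy, not_false_eq_true,
    Function.update_of_ne]
  congr 1
  ring

/-- The conjugation behind `twist`, step by step: shear, cyclic shift, inverse shear. It uses only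
additions, subtractions and a permutation of registers, as does `applyGen`. -/
theorem twist_one_eq (t : Bool) (v : Index N → ℤ) {v₁ v₂ v₃ : Index N → ℤ}
    (h1 : v₁ = Function.update v ⟨t, 0⟩ (v ⟨t, 0⟩ + 3 * v ⟨!t, 0⟩))
    (h2 : v₂ = fun i => v₁ ⟨i.1, i.2 - if i.1 = t then 1 else 0⟩)
    (h3 : v₃ = Function.update v₂ ⟨t, 0⟩ (v₂ ⟨t, 0⟩ - 3 * v₂ ⟨!t, 0⟩)) :
    v₃ = twist t 1 v := by
  have hne := not_index_ne (N := N) t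
  have hv1 : ∀ x, v₁ ⟨t, x⟩ = v ⟨t, x⟩ + if x = 0 then 3 * v ⟨!t, 0⟩ else 0 := by
    intro x
    rw [h1]
    by_cases hx : x = 0
    · subst hx; simp
    · rw [Function.update_of_ne (by simpa using hx), if_neg hx, add_zero]
  have hv1' : ∀ x, v₁ ⟨!t, x⟩ = v ⟨!t, x⟩ := by
    intro x
    rw [h1, Function.update_of_ne]
    intro h
    have := congrArg Sigma.fst h
    cases t <;> simp at this
  have hv2 : ∀ x, v₂ ⟨t, x⟩ = v ⟨t, x - 1⟩ + if x = 1 then 3 * v ⟨!t, 0⟩ else 0 := by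
    intro x
    rw [h2]
    simp only [if_true, hv1, sub_eq_zero]
  have hv2' : ∀ x, v₂ ⟨!t, x⟩ = v ⟨!t, x⟩ := by
    intro x
    rw [h2]
    simp [hv1']
  funext i
  rcases index_cases t i with ⟨x, rfl⟩ | ⟨x, rfl⟩
  · rw [twist_self, h3, hv2', Int.cast_one]
    by_cases hx : x = 0
    · subst hx
      rw [Function.update_self, hv2, if_pos (rfl : (0 : ZMod (N t)) = 0)]
      split_ifs <;> ring
    · rw [Function.update_of_ne (by simpa using hx), hv2, if_neg hx]
      split_ifs <;> ring
  · rw [twist_not, h3, Function.update_of_ne, hv2']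
    intro h
    have := congrArg Sigma.fst h
    cases t <;> simp at this

theorem ensures_applyGen {t : Bool} {v : Index N → ℤ} {q : ℕ} (hσ : Fits w S τ)
    (hq : τ.reg (Sum.inl modu) = q) (hqW : 2 * q ≤ 2 ^ τ.width) (hq0 : 0 < q)
    (hv : Holds q v τ.reg)
    (h : ∀ r, (∀ a, r (Sum.inl a) = τ.reg (Sum.inl a)) →
      Holds q (genPerm N t v) r → Q () { τ with reg := r }) :
    Ensures w S (applyGen t) Q τ := by
  refine Ensures.bind (ensures_modAdd hσ hq hqW hq0 hv fun r₁ hr₁ hv₁ => ?_)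
  refine Ensures.bind (ensures_modAdd (hσ.setReg _) ((hr₁ _).trans hq) hqW hq0 hv₁
    fun r₂ hr₂ hv₂ => ?_)
  have hr₂' := fun a => (hr₂ a).trans (hr₁ a)
  refine Ensures.bind (ensures_modAdd (hσ.setReg _) ((hr₂' _).trans hq) hqW hq0 hv₂
    fun r₃ hr₃ hv₃ => ?_)
  have hr₃' := fun a => (hr₃ a).trans (hr₂' a)
  rw [update_add_three _ (not_index_ne t)] at hv₃
  refine Ensures.bind (ensures_select (hσ.setReg _) ?_)
  have hr₄ : ∀ a, selected (shift N t) r₃ (Sum.inl a) = τ.reg (Sum.inl a) := hr₃'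
  have hv₄ : Holds q _ (selected (shift N t) r₃) := fun i => hv₃ _
  refine Ensures.bind (ensures_modSub (not_index_ne t) (hσ.setReg _) ((hr₄ _).trans hq) hqW hq0 hv₄
    fun r₅ hr₅ hv₅ => ?_)
  have hr₅' := fun a => (hr₅ a).trans (hr₄ a)
  refine Ensures.bind (ensures_modSub (not_index_ne t) (hσ.setReg _) ((hr₅' _).trans hq) hqW hq0 hv₅
    fun r₆ hr₆ hv₆ => ?_)
  have hr₆' := fun a => (hr₆ a).trans (hr₅' a)
  refine ensures_modSub (not_index_ne t) (hσ.setReg _) ((hr₆' _).trans hq) hqW hq0 hv₆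
    fun r₇ hr₇ hv₇ => ?_
  rw [update_sub_three _ (not_index_ne t)] at hv₇
  refine h r₇ (fun a => (hr₇ a).trans (hr₆' a)) ?_
  rwa [twist_one_eq t v rfl rfl rfl] at hv₇

/-- Apply a power of the generator `t` to the vector in the registers. -/
def applyPower (t : Bool) : ℕ → Fragment X Y (TrackSymbol (RegisterName ⊕ Index N)) Unit
  | 0 => skip ()
  | f + 1 => (applyGen t).bind fun _ => applyPower t f

theorem ensures_applyPower {t : Bool} {f : ℕ} {v : Index N → ℤ} {q : ℕ} (hσ : Fits w S τ)
    (hq : τ.reg (Sum.inl modu) = q) (hqW : 2 * q ≤ 2 ^ τ.width) (hq0 : 0 < q)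
    (hv : Holds q v τ.reg)
    (h : ∀ r, (∀ a, r (Sum.inl a) = τ.reg (Sum.inl a)) →
      Holds q ((genPerm N t ^ f) v) r → Q () { τ with reg := r }) :
    Ensures w S (applyPower t f) Q τ := by
  induction f generalizing τ v with
  | zero => exact ensures_skip hσ (h τ.reg (fun _ => rfl) hv)
  | succ f ih =>
    refine Ensures.bind (ensures_applyGen hσ hq hqW hq0 hv fun r hr hv' => ?_)
    refine ih (hσ.setReg _) ((hr _).trans hq) hqW hv' fun r' hr' hv'' => ?_
    refine h r' (fun a => (hr' a).trans (hr a)) ?_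
    rwa [pow_succ]

variable {G : Type} [Group G] (𝒮 : Setting N G)

/-- Apply a letter to the vector in the registers. -/
def applyLetter : Letter → Fragment X Y (TrackSymbol (RegisterName ⊕ Index N)) Unit
  | Letter.gen t => applyGen t
  | _ => skip ()

theorem ensures_applyLetter {a : Letter} {v : Index N → ℤ} {q : ℕ} (hσ : Fits w S τ)
    (hq : τ.reg (Sum.inl modu) = q) (hqW : 2 * q ≤ 2 ^ τ.width) (hq0 : 0 < q)
    (hv : Holds q v τ.reg)
    (h : ∀ r, (∀ a, r (Sum.inl a) = τ.reg (Sum.inl a)) →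
      Holds q (𝒮.ρ (𝒮.letter a) v) r → Q () { τ with reg := r }) :
    Ensures w S (applyLetter a) Q τ := by
  cases a with
  | gen t =>
    refine ensures_applyGen hσ hq hqW hq0 hv ?_
    rwa [Setting.letter, 𝒮.ρ_g] at h
  | zinv =>
    refine ensures_skip hσ (h τ.reg (fun _ => rfl) ?_)
    rwa [Setting.letter, map_inv, 𝒮.ρ_z, inv_one]
  | one =>
    refine ensures_skip hσ (h τ.reg (fun _ => rfl) ?_)
    rwa [Setting.letter, map_one]

end Fragment

/-! ### Prefixes of the input, and how many moduli decide centrality. -/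

namespace TorusKnot.Setting

variable {N : Bool → ℕ} {G : Type} [Group G] (𝒮 : Setting N G) (w : List Letter)

/-- The value of the prefix of length `i`. -/
def pre (i : ℕ) : G := ((w.take i).map 𝒮.letter).prod

@[simp] theorem pre_zero : 𝒮.pre w 0 = 1 := by simp [pre]

theorem pre_length : 𝒮.pre w w.length = (w.map 𝒮.letter).prod := by simp [pre]

theorem pre_succ {i : ℕ} (hi : i < w.length) :
    𝒮.pre w (i + 1) = 𝒮.pre w i * 𝒮.letter w[i] := by
  rw [pre, pre, List.take_add_one, List.getElem?_eq_getElem hi, List.map_append, List.prod_append]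
  simp

theorem exists_word_between {i j : ℕ} (hij : i ≤ j) :
    ∃ l : List Letter, l.length ≤ j - i ∧ (l.map 𝒮.letter).prod = (𝒮.pre w i)⁻¹ * 𝒮.pre w j := by
  refine ⟨(w.drop i).take (j - i), by simp, ?_⟩
  rw [eq_inv_mul_iff_mul_eq, pre, pre, ← List.prod_append, ← List.map_append, ← List.take_add,
    Nat.add_sub_cancel' hij]

theorem abs_ρ_pow_mul_le {i j : ℕ} (hij : i ≤ j) (t : Bool) (f : ℕ) (k : Index N) :
    |𝒮.ρ (𝒮.g t ^ f * ((𝒮.pre w i)⁻¹ * 𝒮.pre w j)) (baseVector N) k| ≤ 7 ^ (f + (j - i)) := by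
  obtain ⟨l, hl, h⟩ := 𝒮.exists_word_between w hij
  have h1 : ((List.replicate f (Letter.gen t) ++ l).map 𝒮.letter).prod =
      𝒮.g t ^ f * ((𝒮.pre w i)⁻¹ * 𝒮.pre w j) := by
    simp [h, letter]
  rw [← h1]
  refine (𝒮.abs_ρ_baseVector_le _ k).trans ?_
  refine pow_le_pow_right₀ (by norm_num) ?_
  simpa using hl

/-- `Int.eq_zero_of_forall_dvd` is applied to each coordinate with `k = κ * (w.length + 1)`. A
coordinate is at most `7 ^ (N t + w.length)` in size, so the difference from the base vector is
below `2 ^ (3 * (N t + w.length) + 4)`, and `κ` is large enough for this exponent to be at most `k`.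
-/
theorem ρ_eq_one_of_dvd {i j f κ M : ℕ} {t : Bool} (hij : i ≤ j) (hf : f ≤ N t)
    (hj : j ≤ w.length) (hκ : 4 + 3 * N t ≤ κ) (hM : 2 * (κ * (w.length + 1)) < M)
    (h : ∀ q : ℕ, 2 ≤ q → q < M → ∀ k, (q : ℤ) ∣
      𝒮.ρ (𝒮.g t ^ f * ((𝒮.pre w i)⁻¹ * 𝒮.pre w j)) (baseVector N) k - baseVector N k) :
    𝒮.ρ (𝒮.g t ^ f * ((𝒮.pre w i)⁻¹ * 𝒮.pre w j)) = 1 := by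
  rw [ρ_eq_one_iff]
  funext k
  have hκl : 3 * (N t + w.length) + 4 ≤ κ * (w.length + 1) := by nlinarith
  refine sub_eq_zero.1 (Int.eq_zero_of_forall_dvd (k := κ * (w.length + 1)) (by omega)
    (fun q hq hq' => h q hq (by omega) k) ?_)
  have h1 := 𝒮.abs_ρ_pow_mul_le w hij t f k
  have h2 : |baseVector N k| ≤ 1 := by
    rw [baseVector]; split_ifs <;> simp
  have h3 := abs_sub (𝒮.ρ (𝒮.g t ^ f * ((𝒮.pre w i)⁻¹ * 𝒮.pre w j)) (baseVector N) k)
    (baseVector N k)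
  have h4 : (7 : ℤ) ^ (f + (j - i)) ≤ 8 ^ (N t + w.length) :=
    (pow_le_pow_left₀ (by norm_num) (by norm_num) _).trans
      (pow_le_pow_right₀ (by norm_num) (by omega))
  have h5 : (1 : ℤ) ≤ 8 ^ (N t + w.length) := one_le_pow₀ (by norm_num)
  have h6 : (8 : ℤ) ^ (N t + w.length) * 2 ^ 4 ≤ 2 ^ (κ * (w.length + 1)) := by
    rw [show (8 : ℤ) = 2 ^ 3 by norm_num, ← pow_mul, ← pow_add]
    exact pow_le_pow_right₀ (by norm_num) hκl
  linarith

end TorusKnot.Setting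

/-! ### Evaluating a factor of the input modulo one number. -/

namespace Fragment

open Memory RegisterName TorusKnot

variable {Y : Type} {w : List Letter} {S : ℕ} {N : Bool → ℕ}
  {σ : Memory (RegisterName ⊕ Index N) Y} {G : Type} [Group G] (𝒮 : Setting N G)

/-- Read back the letters from the input head down to the one after the square whose number is in
register `cur`, and apply them to the vector. -/
noncomputable def readBack (N : Bool → ℕ) (Y : Type) :
    Fragment Letter Y (TrackSymbol (RegisterName ⊕ Index N)) Unit :=
  iter (P := Unit) (fun _ => (equal (Sum.inl idx) (Sum.inl cur)).bind fun b =>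
    if b then skip (Sum.inr ()) else
      (act fun
        | InputSymbol.letter a => (a, HeadMove.left, [])
        | _ => (Letter.one, HeadMove.left, [])).bind fun a =>
      (applyLetter a).bind fun _ => (sub (Sum.inl idx) (Sum.inl one)).bind fun _ =>
      skip (Sum.inl ())) ()

/-- The group acts from the left, so the last letter acts first and the input is read from right to
left. Square `p` carries the last letter of the prefix of length `p`; thus the head on square `p`
stands for that prefix. -/
theorem ensures_readBack {Q : Unit → Memory (RegisterName ⊕ Index N) Y → Prop} {q i j p : ℕ}
    (hσ : Fits w S σ) (hq : σ.reg (Sum.inl modu) = q) (hqW : 2 * q ≤ 2 ^ σ.width) (hq0 : 0 < q)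
    (h1 : σ.reg (Sum.inl one) = 1) (hidx : σ.reg (Sum.inl idx) = p) (hpos : σ.pos = p)
    (hcur : σ.reg (Sum.inl cur) = i) (hip : i ≤ p) (hp : p ≤ w.length) (hpW : p < 2 ^ σ.width)
    (hv : Holds q (𝒮.ρ ((𝒮.pre w p)⁻¹ * 𝒮.pre w j) (baseVector N)) σ.reg)
    (h : ∀ r p', p' ≤ w.length + 1 → (∀ a, a ≠ idx → r (Sum.inl a) = σ.reg (Sum.inl a)) →
      Holds q (𝒮.ρ ((𝒮.pre w i)⁻¹ * 𝒮.pre w j) (baseVector N)) r →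
      Q () { σ with pos := p', reg := r }) :
    Ensures w S (readBack N Y) Q σ := by
  obtain ⟨d, rfl⟩ := Nat.exists_eq_add_of_le hip
  induction d generalizing σ with
  | zero =>
    refine Ensures.iter (Ensures.bind (ensures_equal hσ (by omega) (by omega) ?_))
    rw [if_pos (by simp; omega)]
    exact ensures_skip hσ (h _ _ hσ.pos_le (fun _ _ => rfl) hv)
  | succ d ih =>
    refine Ensures.iter (Ensures.bind (ensures_equal hσ (by omega) (by omega) ?_))
    rw [if_neg (by simp; omega)]
    refine Ensures.bind (ensures_act (hσ.width_pos.trans hσ.width_lt) ?_)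
    have hlt : i + d < w.length := by omega
    rw [hpos, show i + (d + 1) = i + d + 1 from rfl, inputAt_succ hlt]
    simp only [HeadMove.apply, List.append_nil]
    rw [min_eq_left (by omega), Nat.add_sub_cancel]
    have hσ' : Fits w S { σ with pos := i + d } := hσ.setPos (by omega)
    refine Ensures.bind (ensures_applyLetter 𝒮 hσ' hq hqW hq0 hv fun r hr hv' => ?_)
    have hr' : r (Sum.inl idx) = i + (d + 1) := (hr idx).trans hidx
    have hr1 : r (Sum.inl one) = 1 := (hr one).trans h1
    have hstep : Fits w S { σ with pos := i + d, reg := r } := hσ'.setReg r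
    refine Ensures.bind (ensures_sub hstep (by simp only [hr', hr1]; omega) (ensures_skip (hstep.setReg _) ?_))
    refine ih (hstep.setReg _) ?_ hqW ?_ ?_ ?_ ?_ rfl (by omega) (by omega)
      (lt_of_le_of_lt (by omega) hpW) ?_
    · simpa using (hr modu).trans hq
    · simpa using hr1
    · simpa using (hr cur).trans hcur
    rotate_left
    · simp only [Function.update_self, hr', hr1]
      rfl
    · intro k
      have h2 := hv' k
      -- Going back over one letter multiplies the factor by this letter on the left.
      rw [← Equiv.Perm.mul_apply, ← map_mul, show i + (d + 1) = i + d + 1 from rfl,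
        𝒮.pre_succ w hlt, mul_inv_rev, ← mul_assoc, mul_inv_cancel_left] at h2
      simpa using h2
    · intro r' p' hp' hr'' hv''
      refine h r' p' hp' (fun a ha => (hr'' a ha).trans ?_) hv''
      simpa [ha] using hr a

/-- Put the base vector into the registers. -/
def baseSelect (N : Bool → ℕ) : RegisterName ⊕ Index N → Option (RegisterName ⊕ Index N)
  | Sum.inl a => some (Sum.inl a)
  | Sum.inr i => if i.2 = 0 then some (Sum.inl one) else none

@[simp] theorem selected_baseSelect_inl (r : RegisterName ⊕ Index N → ℕ) (a : RegisterName) :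
    selected (baseSelect N) r (Sum.inl a) = r (Sum.inl a) := rfl

theorem selected_baseSelect_inr {r : RegisterName ⊕ Index N → ℕ} (h1 : r (Sum.inl one) = 1)
    (i : Index N) : (selected (baseSelect N) r (Sum.inr i) : ℤ) = baseVector N i := by
  simp only [selected, baseSelect, baseVector]
  split_ifs <;> simp [h1]

theorem holds_baseVector {q : ℕ} {r : RegisterName ⊕ Index N → ℕ} (h1 : r (Sum.inl one) = 1)
    (hq : 2 ≤ q) : Holds q (baseVector N) (selected (baseSelect N) r) := by
  intro i
  rw [selected_baseSelect_inr h1, Int.emod_eq_of_lt] <;> rw [baseVector] <;> split_ifs <;>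
    (try norm_num) <;> omega

/-- Test, modulo the number in register `modu`, whether the base vector is fixed by the element
represented by `f` letters `t`, followed by the letters from the position in register `cur` to the
one in register `probe`. -/
noncomputable def checkMod (t : Bool) (f : ℕ) :
    Fragment Letter Y (TrackSymbol (RegisterName ⊕ Index N)) Bool :=
  (select (baseSelect N)).bind fun _ => (goto probe).bind fun _ => (readBack N Y).bind fun _ =>
    (applyPower t f).bind fun _ => test (baseSelect N)

theorem ensures_checkMod {Q : Bool → Memory (RegisterName ⊕ Index N) Y → Prop} {q i j f : ℕ}
    {t : Bool}
    (hσ : Fits w S σ) (hq : σ.reg (Sum.inl modu) = q) (hqW : 2 * q ≤ 2 ^ σ.width) (hq0 : 2 ≤ q)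
    (h1 : σ.reg (Sum.inl one) = 1) (hj : σ.reg (Sum.inl probe) = j)
    (hcur : σ.reg (Sum.inl cur) = i) (hij : i ≤ j) (hjw : j ≤ w.length) (hjW : j < 2 ^ σ.width)
    (h : ∀ b r p, p ≤ w.length + 1 → (∀ a, a ≠ idx → r (Sum.inl a) = σ.reg (Sum.inl a)) →
      (b = true ↔ ∀ k, (q : ℤ) ∣ 𝒮.ρ (𝒮.g t ^ f * ((𝒮.pre w i)⁻¹ * 𝒮.pre w j)) (baseVector N) k -
        baseVector N k) →
      Q b { σ with pos := p, reg := r }) :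
    Ensures w S (checkMod t f) Q σ := by
  classical
  refine Ensures.bind (ensures_select hσ ?_)
  refine Ensures.bind (ensures_goto (by simp) (hσ.setReg _) h1 ?_ ?_ ?_)
  · exact hj.trans_le hjw
  · exact hj.trans_lt hjW
  have hj' : selected (baseSelect N) σ.reg (Sum.inl probe) = j := hj
  simp only [hj']
  have hf1 : Fits w S { σ with
      pos := j
      reg := Function.update (selected (baseSelect N) σ.reg) (Sum.inl idx) j } :=
    (hσ.setPos (p := j) (by omega)).setReg _
  refine Ensures.bind (ensures_readBack 𝒮 (q := q) (i := i) (j := j) (p := j) hf1 ?_ hqW (by omega)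
    ?_ ?_ rfl ?_ hij hjw hjW ?_ fun r p hp hr hv => ?_)
  · simpa using hq
  · simpa using h1
  · simp
  · simpa using hcur
  -- At the start `p = j`: the factor is trivial, and the vector is the base vector.
  · intro k
    rw [inv_mul_cancel, map_one]
    simpa using holds_baseVector h1 hq0 k
  have hr' : ∀ a, a ≠ idx → r (Sum.inl a) = σ.reg (Sum.inl a) := by
    intro a ha
    rw [hr a ha]
    simp only [ne_eq, Sum.inl.injEq, ha, not_false_eq_true, Function.update_of_ne]
    rfl
  have hf2 : Fits w S { σ with pos := p, reg := r } := (hσ.setPos hp).setReg r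
  refine Ensures.bind (ensures_applyPower hf2 ((hr' _ (by simp)).trans hq) hqW (by omega) hv
    fun r₂ hr₂ hv₂ => ?_)
  have hr₂' : ∀ a, a ≠ idx → r₂ (Sum.inl a) = σ.reg (Sum.inl a) :=
    fun a ha => (hr₂ a).trans (hr' a ha)
  have hone : r₂ (Sum.inl one) = 1 := (hr₂' _ (by simp)).trans h1
  refine ensures_test (hf2.setReg r₂) ?_ ?_ ?_
  · rintro (a | k) hk
    · exact absurd rfl hk
    · refine lt_of_lt_of_le (hv₂.lt (by omega) k) ?_
      simp; omega
  · rintro (a | k) k' hk hne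
    · simp only [baseSelect, Option.some.injEq] at hk
      exact absurd hk.symm hne
    · simp only [baseSelect] at hk
      split_ifs at hk
      simp only [Option.some.injEq] at hk
      subst hk
      simp only [hone]
      omega
  · refine h _ r₂ p hp hr₂' ?_
    rw [decide_eq_true_iff]
    -- Since `2 ≤ q`, the entries `0` and `1` of the base vector are their own residues, so equality
    -- of registers is a congruence modulo `q`.
    have hmod : ∀ k, r₂ (Sum.inr k) = selected (baseSelect N) r₂ (Sum.inr k) ↔ (q : ℤ) ∣
        𝒮.ρ (𝒮.g t ^ f * ((𝒮.pre w i)⁻¹ * 𝒮.pre w j)) (baseVector N) k - baseVector N k := by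
      intro k
      rw [map_mul, Equiv.Perm.mul_apply, map_pow, 𝒮.ρ_g, ← Int.modEq_iff_dvd,
        Int.ModEq, eq_comm, ← hv₂ k, ← holds_baseVector hone hq0 k]
      norm_cast
    refine ⟨fun heq k => (hmod k).1 (congrFun heq _), fun hall => funext ?_⟩
    rintro (a | k)
    · rfl
    · exact (hmod k).2 (hall k)

end Fragment

/-! ### The test for centrality and the search for the end of a syllable. -/

namespace Fragment

open Memory RegisterName TorusKnot

variable {Y : Type} {w : List Letter} {S : ℕ} {N : Bool → ℕ}
  {σ : Memory (RegisterName ⊕ Index N) Y} {G : Type} [Group G] (𝒮 : Setting N G)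

/-- The facts about the registers that remain true in the main part of the program. -/
structure Ready (κ : ℕ) (w : List Letter) (S : ℕ) (σ : Memory (RegisterName ⊕ Index N) Y) : Prop
    extends Fits w S σ where
  one_eq : σ.reg (Sum.inl one) = 1
  len_eq : σ.reg (Sum.inl len) = w.length
  lt_lim : 2 * (κ * (w.length + 1)) < σ.reg (Sum.inl lim)
  lim_le : 2 * σ.reg (Sum.inl lim) ≤ 2 ^ σ.width
  le_κ : ∀ t, 4 + 3 * N t ≤ κ

namespace Ready

variable {κ : ℕ}

theorem congr (h : Ready κ w S σ) {p : ℕ} (hp : p ≤ w.length + 1)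
    {r : RegisterName ⊕ Index N → ℕ} {o : List Y} (h1 : r (Sum.inl one) = σ.reg (Sum.inl one))
    (h2 : r (Sum.inl len) = σ.reg (Sum.inl len)) (h3 : r (Sum.inl lim) = σ.reg (Sum.inl lim)) :
    Ready κ w S { σ with pos := p, reg := r, out := o } where
  toFits := ⟨hp, h.width_pos, h.width_lt⟩
  one_eq := h1.trans h.one_eq
  len_eq := h2.trans h.len_eq
  lt_lim := h.lt_lim.trans_eq h3.symm
  lim_le := by simpa [h3] using h.lim_le
  le_κ := h.le_κ

theorem length_lt (h : Ready κ w S σ) : w.length < 2 ^ σ.width := by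
  have h1 := h.lt_lim
  have h2 := h.lim_le
  have h3 := h.le_κ true
  nlinarith

end Ready

/-- Test whether the element represented by `f` letters `t`, followed by the letters from the
position in register `cur` to the one in register `probe`, is central. -/
noncomputable def check (t : Bool) (f : ℕ) :
    Fragment Letter Y (TrackSymbol (RegisterName ⊕ Index N)) Bool :=
  (assign (Sum.inl modu) (some (Sum.inl one))).bind fun _ => (increase modu 1).bind fun _ =>
    iter (P := Unit) (fun _ => (equal (Sum.inl modu) (Sum.inl lim)).bind fun b =>
      if b then skip (Sum.inr true) else (checkMod t f).bind fun b =>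
        if b then (increase modu 1).bind fun _ => skip (Sum.inl ()) else skip (Sum.inr false)) ()

/-- A failure for one modulus refutes triviality of the action. If all moduli below `lim` succeed,
`Setting.ρ_eq_one_of_dvd` applies. -/
theorem ensures_check {Q : Bool → Memory (RegisterName ⊕ Index N) Y → Prop} {κ i j f : ℕ}
    {t : Bool} (hσ : Ready κ w S σ) (hj : σ.reg (Sum.inl probe) = j)
    (hcur : σ.reg (Sum.inl cur) = i) (hij : i ≤ j) (hjw : j ≤ w.length) (hf : f ≤ N t)
    (h : ∀ b r p, p ≤ w.length + 1 →
      (∀ a, a ≠ idx → a ≠ modu → r (Sum.inl a) = σ.reg (Sum.inl a)) →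
      (b = true ↔ 𝒮.ρ (𝒮.g t ^ f * ((𝒮.pre w i)⁻¹ * 𝒮.pre w j)) = 1) →
      Q b { σ with pos := p, reg := r }) :
    Ensures w S (check t f) Q σ := by
  have hκ := hσ.le_κ t
  have hlim := hσ.lt_lim
  have hlim' := hσ.lim_le
  have hlen := hσ.length_lt
  have h8 : 8 ≤ 2 * (κ * (w.length + 1)) := by nlinarith
  have key : ∀ d q, q + d = σ.reg (Sum.inl lim) → 2 ≤ q →
      (∀ q' : ℕ, 2 ≤ q' → q' < q → ∀ k, (q' : ℤ) ∣
        𝒮.ρ (𝒮.g t ^ f * ((𝒮.pre w i)⁻¹ * 𝒮.pre w j)) (baseVector N) k - baseVector N k) →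
      ∀ r p, p ≤ w.length + 1 →
      (∀ a, a ≠ idx → a ≠ modu → r (Sum.inl a) = σ.reg (Sum.inl a)) → r (Sum.inl modu) = q →
      Ensures w S (iter (P := Unit) (fun _ => (equal (Sum.inl modu) (Sum.inl lim)).bind fun b =>
        if b then skip (Sum.inr true) else (checkMod t f).bind fun b =>
          if b then (increase modu 1).bind fun _ => skip (Sum.inl ())
          else skip (Sum.inr false)) ()) Q { σ with pos := p, reg := r } := by
    intro d
    induction d with
    | zero =>
      intro q hq hq2 hdvd r p hp hr hmodu
      have hfit : Fits w S { σ with pos := p, reg := r } := (hσ.setPos hp).setReg r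
      have hrlim := hr lim (by simp) (by simp)
      refine Ensures.iter (Ensures.bind (ensures_equal hfit ?_ ?_ ?_))
      · simp only [hmodu]; omega
      · simp only [hrlim]; omega
      simp only [hmodu, hrlim]
      rw [if_pos (by simpa using hq)]
      refine ensures_skip hfit (h true r p hp hr ?_)
      simp only [true_iff]
      refine 𝒮.ρ_eq_one_of_dvd w hij hf hjw hκ hlim ?_
      rwa [← hq, Nat.add_zero]
    | succ d ih =>
      intro q hq hq2 hdvd r p hp hr hmodu
      have hfit : Fits w S { σ with pos := p, reg := r } := (hσ.setPos hp).setReg r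
      have hrlim := hr lim (by simp) (by simp)
      refine Ensures.iter (Ensures.bind (ensures_equal hfit ?_ ?_ ?_))
      · simp only [hmodu]; omega
      · simp only [hrlim]; omega
      simp only [hmodu, hrlim]
      rw [if_neg (by simp; omega)]
      refine Ensures.bind (ensures_checkMod 𝒮 (i := i) (j := j) (q := q) hfit hmodu
        (by simp only; omega) hq2 ((hr _ (by simp) (by simp)).trans hσ.one_eq)
        ((hr _ (by simp) (by simp)).trans hj) ((hr _ (by simp) (by simp)).trans hcur) hij hjw
        (by simp only; omega) fun b r' p' hp' hr' hb => ?_)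
      have hfit' : Fits w S { σ with pos := p', reg := r' } := (hσ.setPos hp').setReg r'
      have hr'' : ∀ a, a ≠ idx → a ≠ modu → r' (Sum.inl a) = σ.reg (Sum.inl a) :=
        fun a h1 h2 => (hr' a h1).trans (hr a h1 h2)
      have hmodu' : r' (Sum.inl modu) = q := (hr' _ (by simp)).trans hmodu
      cases b with
      | false =>
        refine ensures_skip hfit' (h false r' p' hp' hr'' ?_)
        simp only [Bool.false_eq_true, false_iff]
        intro h1
        refine absurd (hb.2 fun k => ?_) (by simp)
        rw [h1]
        simp
      | true =>
        refine Ensures.bind (ensures_increase (by simp) hfit'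
          ((hr'' _ (by simp) (by simp)).trans hσ.one_eq) (by simp only [hmodu']; omega)
          (ensures_skip (hfit'.setReg _) ?_))
        refine ih (q + 1) (by omega) (by omega) ?_ _ p' hp' ?_ ?_
        · intro q' hq' hlt
          rcases Nat.lt_succ_iff_lt_or_eq.1 hlt with hlt | rfl
          · exact hdvd q' hq' hlt
          · exact hb.1 rfl
        · intro a h1 h2
          simpa [h2] using hr'' a h1 h2
        · simp [hmodu']
  refine Ensures.bind (ensures_assign hσ.toFits (Ensures.bind (ensures_increase (by simp)
    (hσ.setReg _) ?_ ?_ ?_)))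
  · simpa using hσ.one_eq
  · simp only [Function.update_self, Option.elim, hσ.one_eq]; omega
  · refine key (σ.reg (Sum.inl lim) - 2) 2 (by omega) le_rfl (fun q' _ _ => by omega) _ _
      hσ.pos_le (fun a h1 h2 => ?_) ?_
    · simp [h2]
    · simp [hσ.one_eq]

/-- Search for an exponent `f` in a list for which `check t f` succeeds. -/
noncomputable def findExponent (t : Bool) : List (Fin (N t)) →
    Fragment Letter Y (TrackSymbol (RegisterName ⊕ Index N)) (Option (Fin (N t)))
  | [] => skip none
  | f :: fs => (check t f).bind fun b => if b then skip (some f) else findExponent t fs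

theorem ensures_findExponent {κ i j : ℕ} {t : Bool}
    {Q : Option (Fin (N t)) → Memory (RegisterName ⊕ Index N) Y → Prop} {fs : List (Fin (N t))}
    (hσ : Ready κ w S σ) (hj : σ.reg (Sum.inl probe) = j)
    (hcur : σ.reg (Sum.inl cur) = i) (hij : i ≤ j) (hjw : j ≤ w.length)
    (h : ∀ (o : Option (Fin (N t))) r p, p ≤ w.length + 1 →
      (∀ a, a ≠ idx → a ≠ modu → r (Sum.inl a) = σ.reg (Sum.inl a)) →
      (∀ f ∈ o, 𝒮.ρ (𝒮.g t ^ (f : ℕ) * ((𝒮.pre w i)⁻¹ * 𝒮.pre w j)) = 1) →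
      (o = none → ∀ f ∈ fs, 𝒮.ρ (𝒮.g t ^ (f : ℕ) * ((𝒮.pre w i)⁻¹ * 𝒮.pre w j)) ≠ 1) →
      Q o { σ with pos := p, reg := r }) :
    Ensures w S (findExponent t fs) Q σ := by
  induction fs generalizing σ with
  | nil => exact ensures_skip hσ.toFits (h none _ _ hσ.pos_le (fun _ _ _ => rfl) (by simp) (by simp))
  | cons f fs ih =>
    refine Ensures.bind (ensures_check 𝒮 hσ hj hcur hij hjw f.2.le fun b r p hp hr hb => ?_)
    have hσ' : Ready κ w S { σ with pos := p, reg := r } := hσ.congr hp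
      (hr _ (by simp) (by simp)) (hr _ (by simp) (by simp)) (hr _ (by simp) (by simp))
    cases b with
    | true =>
      refine ensures_skip hσ'.toFits (h (some f) r p hp hr ?_ (by simp))
      simpa using hb
    | false =>
      refine ih hσ' ((hr _ (by simp) (by simp)).trans hj) ((hr _ (by simp) (by simp)).trans hcur)
        fun o r' p' hp' hr' h1 h2 => ?_
      refine h o r' p' hp' (fun a ha ha' => (hr' a ha ha').trans (hr a ha ha')) h1 fun ho f' hf' => ?_
      rcases List.mem_cons.1 hf' with rfl | hf'
      · exact fun h3 => absurd (hb.2 h3) (by simp)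
      · exact h2 ho f' hf'

/-- Search backwards for the last position such that, for some `f`, the word of the preceding test
is central. -/
noncomputable def findLast (t : Bool) :
    Fragment Letter Y (TrackSymbol (RegisterName ⊕ Index N)) (Fin (N t)) :=
  (assign (Sum.inl probe) (some (Sum.inl len))).bind fun _ =>
    iter (P := Unit) (fun _ => (findExponent t (List.finRange (N t))).bind fun
      | some f => skip (Sum.inr f)
      | none => (sub (Sum.inl probe) (Sum.inl one)).bind fun _ => skip (Sum.inl ())) ()

theorem ensures_findLast {κ i : ℕ} {t : Bool}
    {Q : Fin (N t) → Memory (RegisterName ⊕ Index N) Y → Prop}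
    (hσ : Ready κ w S σ) (hcur : σ.reg (Sum.inl cur) = i) (hi : i ≤ w.length)
    (h : ∀ (f : Fin (N t)) j r p, p ≤ w.length + 1 → i ≤ j → j ≤ w.length →
      (∀ a, a ≠ idx → a ≠ modu → a ≠ probe → r (Sum.inl a) = σ.reg (Sum.inl a)) →
      r (Sum.inl probe) = j →
      𝒮.ρ (𝒮.g t ^ (f : ℕ) * ((𝒮.pre w i)⁻¹ * 𝒮.pre w j)) = 1 →
      (∀ j', j < j' → j' ≤ w.length → ∀ f : Fin (N t),
        𝒮.ρ (𝒮.g t ^ (f : ℕ) * ((𝒮.pre w i)⁻¹ * 𝒮.pre w j')) ≠ 1) →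
      Q f { σ with pos := p, reg := r }) :
    Ensures w S (findLast t) Q σ := by
  have key : ∀ d j, i + d = j → j ≤ w.length →
      (∀ j', j < j' → j' ≤ w.length → ∀ f : Fin (N t),
        𝒮.ρ (𝒮.g t ^ (f : ℕ) * ((𝒮.pre w i)⁻¹ * 𝒮.pre w j')) ≠ 1) →
      ∀ r p, p ≤ w.length + 1 →
      (∀ a, a ≠ idx → a ≠ modu → a ≠ probe → r (Sum.inl a) = σ.reg (Sum.inl a)) →
      r (Sum.inl probe) = j →
      Ensures w S (iter (P := Unit) (fun _ => (findExponent t (List.finRange (N t))).bind fun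
        | some f => skip (Sum.inr f)
        | none => (sub (Sum.inl probe) (Sum.inl one)).bind fun _ => skip (Sum.inl ())) ()) Q
        { σ with pos := p, reg := r } := by
    intro d
    induction d with
    | zero =>
      intro j hj hjw hmax r p hp hr hprobe
      have hσ' : Ready κ w S { σ with pos := p, reg := r } := hσ.congr hp
        (hr _ (by simp) (by simp) (by simp)) (hr _ (by simp) (by simp) (by simp))
        (hr _ (by simp) (by simp) (by simp))
      refine Ensures.iter (Ensures.bind (ensures_findExponent 𝒮 hσ' hprobe
        ((hr _ (by simp) (by simp) (by simp)).trans hcur) (by omega) hjw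
        fun o r' p' hp' hr' ho ho' => ?_))
      have hσ'' : Fits w S { σ with pos := p', reg := r' } := (hσ.setPos hp').setReg r'
      rcases o with _ | f
      -- When the search has come back to `cur` the factor is trivial, and the exponent `0`
      -- succeeds; hence the loop ends.
      · refine absurd ?_ (ho' rfl ⟨0, 𝒮.pos t⟩ (List.mem_finRange _))
        obtain rfl : i = j := hj
        simp
      · exact ensures_skip hσ'' (h f j r' p' hp' (by omega) hjw
          (fun a h1 h2 h3 => (hr' a h1 h2).trans (hr a h1 h2 h3))
          ((hr' _ (by simp) (by simp)).trans hprobe) (ho f rfl) hmax)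
    | succ d ih =>
      intro j hj hjw hmax r p hp hr hprobe
      have hσ' : Ready κ w S { σ with pos := p, reg := r } := hσ.congr hp
        (hr _ (by simp) (by simp) (by simp)) (hr _ (by simp) (by simp) (by simp))
        (hr _ (by simp) (by simp) (by simp))
      refine Ensures.iter (Ensures.bind (ensures_findExponent 𝒮 hσ' hprobe
        ((hr _ (by simp) (by simp) (by simp)).trans hcur) (by omega) hjw
        fun o r' p' hp' hr' ho ho' => ?_))
      have hσ'' : Fits w S { σ with pos := p', reg := r' } := (hσ.setPos hp').setReg r'
      have hprobe' : r' (Sum.inl probe) = j := (hr' _ (by simp) (by simp)).trans hprobe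
      have hone : r' (Sum.inl one) = 1 := ((hr' _ (by simp) (by simp)).trans
        (hr _ (by simp) (by simp) (by simp))).trans hσ.one_eq
      rcases o with _ | f
      · refine Ensures.bind (ensures_sub hσ'' (by simp only [hprobe', hone]; omega)
          (ensures_skip (hσ''.setReg _) ?_))
        refine ih (j - 1) (by omega) (by omega) (fun j' hj' hjw' f => ?_) _ p' hp'
          (fun a h1 h2 h3 => ?_) ?_
        · rcases (Nat.le_of_pred_lt hj').eq_or_lt with rfl | hlt
          · exact ho' rfl f (List.mem_finRange _)
          · exact hmax j' hlt hjw' f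
        · simpa [h3] using (hr' a h1 h2).trans (hr a h1 h2 h3)
        · simp [hprobe', hone]
      · exact ensures_skip hσ'' (h f j r' p' hp' (by omega) hjw
          (fun a h1 h2 h3 => (hr' a h1 h2).trans (hr a h1 h2 h3)) hprobe' (ho f rfl) hmax)
  refine Ensures.bind (ensures_assign hσ.toFits ?_)
  refine key (w.length - i) w.length (by omega) le_rfl (fun j' h1 h2 => by omega) _ _ hσ.pos_le
    (fun a _ _ h3 => ?_) ?_
  · simp [h3]
  · simp [hσ.len_eq]

end Fragment

/-! ### Positions that differ by a power of one generator modulo the center. -/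

namespace TorusKnot.Setting

variable {N : Bool → ℕ} {G : Type} [Group G] (𝒮 : Setting N G) (w : List Letter)

/-- The test finds the exponent `f` that cancels `x`; the exponent of `x` itself is `-f` modulo `N
t`. The outer remainder matters only for `f = 0`. -/
theorem ρ_eq_pow {t : Bool} {x : G} {f : ℕ} (hf : f < N t) (h : 𝒮.ρ (𝒮.g t ^ f * x) = 1) :
    𝒮.ρ x = genPerm N t ^ ((N t - f) % N t) := by
  rw [map_mul, map_pow, 𝒮.ρ_g] at h
  have h1 : 𝒮.ρ x = (genPerm N t ^ f)⁻¹ := eq_inv_of_mul_eq_one_right h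
  have h2 : genPerm N t ^ ((N t - f) % N t) = genPerm N t ^ (N t - f) := by
    conv_rhs => rw [← Nat.mod_add_div (N t - f) (N t), pow_add, pow_mul, genPerm_pow_self, one_pow,
      mul_one]
  rw [h1, h2, inv_eq_iff_mul_eq_one, ← pow_add, Nat.add_sub_cancel' hf.le, genPerm_pow_self]

theorem exists_fin_of_mem_zpowers {t : Bool} {x : G}
    (h : 𝒮.ρ x ∈ Subgroup.zpowers (genPerm N t)) :
    ∃ f : Fin (N t), 𝒮.ρ (𝒮.g t ^ (f : ℕ) * x) = 1 := by
  obtain ⟨k, hk⟩ := h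
  have hpos : (0 : ℤ) < N t := Int.natCast_pos.2 (𝒮.pos t)
  have h1 := Int.emod_nonneg (-k) hpos.ne'
  have h2 := Int.emod_lt_of_pos (-k) hpos
  refine ⟨⟨((-k) % N t).toNat, by omega⟩, ?_⟩
  have hpow : genPerm N t ^ (N t : ℤ) = 1 := by rw [zpow_natCast, genPerm_pow_self]
  have hk' : genPerm N t ^ k = 𝒮.ρ x := hk
  rw [map_mul, map_pow, 𝒮.ρ_g, ← hk', ← zpow_natCast, Int.toNat_of_nonneg h1, Int.emod_def,
    zpow_sub, zpow_mul, hpow, one_zpow, inv_one, mul_one, zpow_neg, inv_mul_cancel]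

/-- The positions `i` and `j` of a word are related by a power of the generator `t`. -/
def Related (t : Bool) (i j : ℕ) : Prop :=
  𝒮.ρ ((𝒮.pre w i)⁻¹ * 𝒮.pre w j) ∈ Subgroup.zpowers (genPerm N t)

variable {w}

theorem Related.of_left {𝒮 : Setting N G} {t : Bool} {i j k : ℕ} (h : 𝒮.Related w t i j)
    (h' : 𝒮.Related w t j k) : 𝒮.Related w t i k := by
  have := mul_mem h h'
  rwa [← map_mul, mul_assoc, mul_inv_cancel_left] at this

/-- Every letter is a power of a single generator modulo the center. This ensures progress in the
main loop. -/
theorem related_succ {i : ℕ} (hi : i < w.length) (t : Bool) :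
    𝒮.Related w t i (i + 1) ∨ 𝒮.Related w (!t) i (i + 1) := by
  simp only [Related, 𝒮.pre_succ w hi, inv_mul_cancel_left]
  cases w[i] with
  | gen u =>
    rw [letter, 𝒮.ρ_g]
    cases t <;> cases u <;> simp [Subgroup.mem_zpowers]
  | zinv => rw [letter, map_inv, 𝒮.ρ_z, inv_one]; exact Or.inl (one_mem _)
  | one => rw [letter, map_one]; exact Or.inl (one_mem _)

theorem related_of_ρ_eq {t u : Bool} {i j : ℕ} {e : ℕ}
    (h : 𝒮.ρ ((𝒮.pre w i)⁻¹ * 𝒮.pre w j) = genPerm N t ^ e) (he : e = 0 ∨ u = t) :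
    𝒮.Related w u i j := by
  rw [Related, h]
  rcases he with rfl | rfl
  · rw [pow_zero]; exact one_mem _
  · exact pow_mem (Subgroup.mem_zpowers _) _

end TorusKnot.Setting

/-! ### Printing the alternating product of powers. -/

namespace Fragment

open Memory RegisterName TorusKnot

variable {Y : Type} {w : List Letter} {S : ℕ} {N : Bool → ℕ}
  {σ : Memory (RegisterName ⊕ Index N) Y} {G : Type} [Group G] (𝒮 : Setting N G)
  (word : Bool → List Y)

/-- Print the next power of the generator `t` in the normal form, and go to the position where this
power is completed. -/
noncomputable def mainBody (t : Bool) :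
    Fragment Letter Y (TrackSymbol (RegisterName ⊕ Index N)) (Bool ⊕ Unit) :=
  (findLast t).bind fun f =>
    (act fun _ => ((), HeadMove.stay, (List.replicate ((N t - f) % N t) (word t)).flatten)).bind
    fun _ => (increase down (N (!t) * ((N t - f) % N t))).bind fun _ =>
    (assign (Sum.inl cur) (some (Sum.inl probe))).bind fun _ =>
    (equal (Sum.inl cur) (Sum.inl len)).bind fun b =>
    if b then skip (Sum.inr ()) else skip (Sum.inl !t)

theorem mul_not_le {e : ℕ} {t : Bool} (he : e < N t) : N (!t) * e ≤ N false * N true := by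
  cases t
  · rw [mul_comm (N false)]; exact Nat.mul_le_mul_left _ he.le
  · exact Nat.mul_le_mul_left _ he.le

theorem ensures_mainBody {κ i : ℕ} {t : Bool}
    {Q : Bool ⊕ Unit → Memory (RegisterName ⊕ Index N) Y → Prop}
    (hσ : Ready κ w S σ) (hcur : σ.reg (Sum.inl cur) = i) (hi : i ≤ w.length)
    (hdown : σ.reg (Sum.inl down) + N false * N true < 2 ^ σ.width)
    (h : ∀ e j r p, p ≤ w.length + 1 → i ≤ j → j ≤ w.length → e < N t →
      𝒮.ρ ((𝒮.pre w i)⁻¹ * 𝒮.pre w j) = genPerm N t ^ e →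
      (∀ j', j < j' → j' ≤ w.length → ¬ 𝒮.Related w t i j') →
      (∀ a, a ≠ idx → a ≠ modu → a ≠ probe → a ≠ cur → a ≠ down →
        r (Sum.inl a) = σ.reg (Sum.inl a)) →
      r (Sum.inl cur) = j → r (Sum.inl down) = σ.reg (Sum.inl down) + N (!t) * e →
      Q (if j = w.length then Sum.inr () else Sum.inl !t)
        { σ with pos := p, reg := r, out := σ.out ++ (List.replicate e (word t)).flatten }) :
    Ensures w S (mainBody word t) Q σ := by
  refine Ensures.bind (ensures_findLast 𝒮 hσ hcur hi fun f j r p hp hij hj hr hprobe hf hmax => ?_)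
  refine Ensures.bind (ensures_act (hσ.width_pos.trans hσ.width_lt) ?_)
  simp only [HeadMove.apply]
  rw [min_eq_left hp]
  obtain ⟨e, he⟩ : ∃ e, e = (N t - f) % N t := ⟨_, rfl⟩
  have heN : e < N t := he ▸ Nat.mod_lt _ (𝒮.pos t)
  have hmul := mul_not_le heN
  have hρ := 𝒮.ρ_eq_pow f.2 hf
  rw [← he] at hρ ⊢
  have hfit : ∀ r, Fits w S (⟨σ.width, p, r, σ.out ++ (List.replicate e (word t)).flatten⟩ :
      Memory (RegisterName ⊕ Index N) Y) := fun r => ⟨hp, hσ.width_pos, hσ.width_lt⟩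
  have hrdown := hr down (by simp) (by simp) (by simp)
  refine Ensures.bind (ensures_increase (by simp) (hfit r)
    ((hr one (by simp) (by simp) (by simp)).trans hσ.one_eq) (by simp only [hrdown]; omega) ?_)
  refine Ensures.bind (ensures_assign (hfit _) ?_)
  have hlen : r (Sum.inl len) = w.length := (hr len (by simp) (by simp) (by simp)).trans hσ.len_eq
  have hlt := hσ.length_lt
  refine Ensures.bind (ensures_equal (hfit _) ?_ ?_ ?_)
  · simp [hprobe]; omega
  · simp [hlen]; omega
  have hQ := h e j (Function.update (Function.update r (Sum.inl down)
    (r (Sum.inl down) + N (!t) * e)) (Sum.inl cur) j) p hp hij hj heN hρ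
    (fun j' h1 h2 h3 => (𝒮.exists_fin_of_mem_zpowers h3).elim fun f' hf' => hmax j' h1 h2 f' hf')
    (fun a h1 h2 h3 h4 h5 => by simpa [h4, h5] using hr a h1 h2 h3) (by simp) (by simp [hrdown])
  simp only [Option.elim, ne_eq, Sum.inl.injEq, reduceCtorEq, not_false_eq_true,
    Function.update_of_ne, Function.update_self, hprobe, hlen]
  by_cases hjl : j = w.length
  · rw [if_pos hjl] at hQ
    rw [if_pos (by simpa using hjl)]
    exact ensures_skip (hfit _) hQ
  · rw [if_neg hjl] at hQ
    rw [if_neg (by simpa using hjl)]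
    exact ensures_skip (hfit _) hQ

/-- The word for a product of powers of the two generators in turn. -/
def syllableWord : Bool → List ℕ → List Y
  | _, [] => []
  | t, e :: es => (List.replicate e (word t)).flatten ++ syllableWord (!t) es

/-- The image under `τ` of a product of powers of the two generators in turn. -/
def weight (N : Bool → ℕ) : Bool → List ℕ → ℕ
  | _, [] => 0
  | t, e :: es => N (!t) * e + weight N (!t) es

/-- Print powers of the generators in turn, starting with the generator `t`. -/
noncomputable def mainLoop (t : Bool) :
    Fragment Letter Y (TrackSymbol (RegisterName ⊕ Index N)) Unit :=
  iter (mainBody word) t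

/-- By `hmax`, which the maximal choice in the preceding round provides, no later position is
related to `i` by the other generator. So each round advances and prints a nonzero exponent. A
syllable adds at most `N false * N true` to `down` and uses up at least one letter, which bounds the
total. -/
theorem ensures_mainLoop_reduced {κ i : ℕ} {t : Bool}
    {Q : Unit → Memory (RegisterName ⊕ Index N) Y → Prop}
    (hσ : Ready κ w S σ) (hcur : σ.reg (Sum.inl cur) = i) (hi : i < w.length)
    (hdown : σ.reg (Sum.inl down) + N false * N true * (w.length - i) < 2 ^ σ.width)
    (hmax : ∀ j, i < j → j ≤ w.length → ¬ 𝒮.Related w (!t) i j)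
    (h : ∀ es r p, p ≤ w.length + 1 → Reduced N t es →
      𝒮.ρ (𝒮.syllables t es) = 𝒮.ρ ((𝒮.pre w i)⁻¹ * 𝒮.pre w w.length) →
      (∀ a, a ≠ idx → a ≠ modu → a ≠ probe → a ≠ cur → a ≠ down →
        r (Sum.inl a) = σ.reg (Sum.inl a)) →
      r (Sum.inl down) = σ.reg (Sum.inl down) + weight N t es →
      weight N t es ≤ N false * N true * (w.length - i) →
      Q () { σ with pos := p, reg := r, out := σ.out ++ syllableWord word t es }) :
    Ensures w S (mainLoop word t) Q σ := by
  obtain ⟨d, hd⟩ : ∃ d, d = w.length - i := ⟨_, rfl⟩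
  induction d using Nat.strong_induction_on generalizing i t σ with
  | _ d ih =>
  have hle1 : N false * N true * 1 ≤ N false * N true * (w.length - i) :=
    Nat.mul_le_mul_left _ (by omega)
  refine Ensures.iter (ensures_mainBody 𝒮 word hσ hcur hi.le (by omega)
    fun e j r p hp hij hj he hρ hmax' hr hrcur hrdown => ?_)
  have hmul := mul_not_le he
  -- Position `i + 1` is related to `i` by `t` or by `!t`; the former contradicts maximality if `j =
  -- i`, the latter contradicts `hmax`.
  have hji : i < j := by
    refine lt_of_le_of_ne hij ?_
    rintro rfl
    rcases 𝒮.related_succ hi t with h1 | h1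
    · exact hmax' _ (Nat.lt_succ_self _) hi h1
    · exact hmax _ (Nat.lt_succ_self _) hi h1
  -- With `e = 0` the position `j` would be related to `i` by either generator, against `hmax`.
  have he0 : 0 < e := by
    rw [Nat.pos_iff_ne_zero]
    exact fun he0 => hmax j hji hj (𝒮.related_of_ρ_eq hρ (Or.inl he0))
  have hstep : N false * N true * (w.length - j) + N false * N true ≤
      N false * N true * (w.length - i) := by
    rw [← Nat.mul_succ]
    exact Nat.mul_le_mul_left _ (by omega)
  by_cases hjl : j = w.length
  · rw [if_pos hjl]
    have := h [e] r p hp ⟨he0, he, trivial⟩ ?_ hr (by simpa [weight] using hrdown)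
      (by simp only [weight]; omega)
    · simpa [syllableWord] using this
    · subst hjl
      rw [hρ, Setting.syllables, Setting.syllables, mul_one, map_pow, 𝒮.ρ_g]
  · rw [if_neg hjl]
    refine ih (w.length - j) (by omega) (t := !t) (i := j) (hσ.congr hp
      (hr _ (by simp) (by simp) (by simp) (by simp) (by simp))
      (hr _ (by simp) (by simp) (by simp) (by simp) (by simp))
      (hr _ (by simp) (by simp) (by simp) (by simp) (by simp))) hrcur (by omega)
      (by simp only [hrdown]; omega) ?_ ?_ rfl
    · intro j' h1 h2 h3
      rw [Bool.not_not] at h3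
      -- A position related to `j` by `t` would also be related to `i` by `t`, against the
      -- maximality of `j`.
      exact hmax' j' h1 h2 ((𝒮.related_of_ρ_eq hρ (Or.inr rfl)).of_left h3)
    · intro es r' p' hp' hes hρ' hr' hdown' hw'
      have := h (e :: es) r' p' hp' ⟨he0, he, hes⟩ ?_
        (fun a h1 h2 h3 h4 h5 => (hr' a h1 h2 h3 h4 h5).trans (hr a h1 h2 h3 h4 h5))
        (by simp only [hdown', hrdown, weight, add_assoc]) (by simp only [weight]; omega)
      · simpa [syllableWord] using this
      · rw [Setting.syllables, map_mul, hρ', map_pow, 𝒮.ρ_g, ← hρ, ← map_mul, mul_assoc,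
          mul_inv_cancel_left]

/-- The first round is separate, as no maximality precedes it: its exponent may be `0` and the
position may stay. -/
theorem ensures_mainLoop {κ : ℕ}
    {Q : Unit → Memory (RegisterName ⊕ Index N) Y → Prop}
    (hσ : Ready κ w S σ) (hcur : σ.reg (Sum.inl cur) = 0)
    (hdown : σ.reg (Sum.inl down) + N false * N true * (w.length + 1) < 2 ^ σ.width)
    (h : ∀ e es r p, p ≤ w.length + 1 → e < N false → Reduced N true es →
      𝒮.ρ (𝒮.syllables false (e :: es)) = 𝒮.ρ (𝒮.pre w w.length) →
      (∀ a, a ≠ idx → a ≠ modu → a ≠ probe → a ≠ cur → a ≠ down →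
        r (Sum.inl a) = σ.reg (Sum.inl a)) →
      r (Sum.inl down) = σ.reg (Sum.inl down) + weight N false (e :: es) →
      r (Sum.inl down) < 2 ^ σ.width →
      Q () { σ with pos := p, reg := r, out := σ.out ++ syllableWord word false (e :: es) }) :
    Ensures w S (mainLoop word false) Q σ := by
  rw [Nat.mul_succ] at hdown
  refine Ensures.iter (ensures_mainBody 𝒮 word hσ hcur (Nat.zero_le _) (by omega)
    fun e j r p hp _ hj he hρ hmax' hr hrcur hrdown => ?_)
  have hmul := mul_not_le he
  rw [Bool.not_false] at hmul hrdown
  have hρ' := hρ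
  rw [𝒮.pre_zero, inv_one, one_mul] at hρ'
  by_cases hjl : j = w.length
  · rw [if_pos hjl]
    have := h e [] r p hp he trivial ?_ hr (by simpa [weight] using hrdown)
      (by omega)
    · simpa [syllableWord] using this
    · subst hjl
      rw [hρ', Setting.syllables, Setting.syllables, mul_one, map_pow, 𝒮.ρ_g]
  · rw [if_neg hjl]
    have hle : N false * N true * (w.length - j) ≤ N false * N true * w.length :=
      Nat.mul_le_mul_left _ (by omega)
    refine ensures_mainLoop_reduced 𝒮 word (hσ.congr hp
      (hr _ (by simp) (by simp) (by simp) (by simp) (by simp))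
      (hr _ (by simp) (by simp) (by simp) (by simp) (by simp))
      (hr _ (by simp) (by simp) (by simp) (by simp) (by simp))) hrcur (by omega)
      (by simp only [hrdown]; omega) ?_ ?_
    · intro j' h1 h2 h3
      exact hmax' j' h1 h2 ((𝒮.related_of_ρ_eq hρ (Or.inr rfl)).of_left h3)
    · intro es r' p' hp' hes hρes hr' hdown' hw'
      simp only [hrdown] at hdown'
      have := h e es r' p' hp' he hes ?_
        (fun a h1 h2 h3 h4 h5 => (hr' a h1 h2 h3 h4 h5).trans (hr a h1 h2 h3 h4 h5))
        (by simp only [hdown', weight, Bool.not_false, add_assoc]) (by omega)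
      · simpa [syllableWord] using this
      · rw [Setting.syllables, map_mul, hρes, map_pow, 𝒮.ρ_g, ← hρ', ← map_mul,
          mul_inv_cancel_left]

end Fragment

namespace Fragment

open Memory RegisterName TorusKnot

variable {Y : Type} {w : List Letter} {S : ℕ} {N : Bool → ℕ}
  {σ : Memory (RegisterName ⊕ Index N) Y} {G : Type} [Group G] (𝒮 : Setting N G)
  (word : Bool → List Y)

/-! ### Preparation -/

/-- The registers at the beginning, where only `one` and `idx` are different from zero. -/
def startReg (N : Bool → ℕ) (v : ℕ) : RegisterName ⊕ Index N → ℕ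
  | Sum.inl one => 1
  | Sum.inl idx => v
  | _ => 0

theorem update_startReg (v v' : ℕ) :
    Function.update (startReg N v) (Sum.inl idx) v' = startReg N v' := by
  funext k
  rcases k with a | k
  · cases a <;> simp [startReg]
  · simp [startReg]

/-- The number `W` of squares in use is the length of `v`. -/
structure Tight (W v : ℕ) : Prop where
  pos : 0 < W
  lt : v < 2 ^ W
  le : W = 1 ∨ 2 ^ (W - 1) ≤ v

/-- A number without superfluous squares uses at most `Nat.log 2 V + 1` of them, and the head needs
one more. -/
theorem Tight.lt_of_log {W v V : ℕ} (h : Tight W v) (hv : v ≤ V) (hS : Nat.log 2 V + 3 ≤ S) :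
    W + 1 < S := by
  rcases h.le with h1 | h1
  · omega
  · have := Nat.le_log_of_pow_le (b := 2) (by norm_num) (h1.trans hv)
    omega

theorem ensures_increase_grow {Q : Unit → Memory (RegisterName ⊕ Index N) Y → Prop} {W p v V c : ℕ}
    {o : List Y} (hp : p ≤ w.length + 1) (hW : Tight W v) (hV : v + c ≤ V)
    (hS : Nat.log 2 V + 3 ≤ S) (h : ∀ W', Tight W' (v + c) → Q () ⟨W', p, startReg N (v + c), o⟩) :
    Ensures w S (increase idx c) Q ⟨W, p, startReg N v, o⟩ := by
  induction c generalizing W v with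
  | zero =>
    exact ensures_skip ⟨hp, hW.pos, (Nat.lt_succ_self _).trans (hW.lt_of_log hV hS)⟩ (h W hW)
  | succ c ih =>
    have hS' := hW.lt_of_log (V := V) (by omega) hS
    have hfit : Fits w S (⟨W, p, startReg N v, o⟩ : Memory (RegisterName ⊕ Index N) Y) :=
      ⟨hp, hW.pos, (Nat.lt_succ_self _).trans hS'⟩
    have h2 : 2 ≤ 2 ^ W := Nat.le_self_pow hW.pos.ne' 2
    have hvc : v + (c + 1) = v + 1 + c := by omega
    rw [hvc] at h hV
    rcases (Nat.succ_le_of_lt hW.lt).lt_or_eq with hlt | heq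
    · refine Ensures.bind (ensures_add hfit hlt ?_)
      refine cast (congrArg (fun r => Ensures w S _ Q ⟨W, p, r, o⟩)
        (update_startReg v (v + 1)).symm) ?_
      refine ih ⟨hW.pos, hlt, hW.le.imp_right fun h => h.trans (Nat.le_succ v)⟩ hV h
    -- Here `v + 1 = 2 ^ W`, the only case in which an increment needs a new square.
    · refine Ensures.bind (ensures_add_grow hfit ?_ hS' heq.ge ?_)
      · rintro (a | k)
        · cases a <;> simp only [startReg] <;> first | exact hW.lt | omega
        · simp only [startReg]; omega
      refine cast (congrArg (fun r => Ensures w S _ Q ⟨W + 1, p, r, o⟩)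
        (update_startReg v (v + 1)).symm) ?_
      refine ih ⟨Nat.succ_pos W, ?_, Or.inr ?_⟩ hV h
      · have : v + 1 = 2 ^ W := heq
        rw [pow_succ]; omega
      · exact heq.ge

/-- Use so many squares that the numbers up to `c * (n + 1)` can be stored, where `n` is the length
of the input. -/
def allocate (N : Bool → ℕ) (Y : Type) (c : ℕ) :
    Fragment Letter Y (TrackSymbol (RegisterName ⊕ Index N)) Unit :=
  (mark fun k => decide (k = Sum.inl one)).bind fun _ => (increase idx c).bind fun _ =>
    iter (P := Unit) (fun _ =>
      (act fun
        | InputSymbol.letter _ => (true, HeadMove.right, [])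
        | _ => (false, HeadMove.stay, [])).bind fun b =>
      if b then (increase idx c).bind fun _ => skip (Sum.inl ()) else skip (Sum.inr ())) ()

/-- A counter increased by `c` once at the beginning and once for each input letter lays out the
required width; later operations never change the width. -/
theorem ensures_allocate {Q : Unit → Memory (RegisterName ⊕ Index N) Y → Prop} {c : ℕ}
    (hS : Nat.log 2 (c * (w.length + 1)) + 3 ≤ S)
    (h : ∀ W, 0 < W → W < S → c * (w.length + 1) < 2 ^ W →
      Q () ⟨W, w.length + 1, startReg N (c * (w.length + 1)), []⟩) :
    Ensures w S (allocate N Y c) Q ⟨0, 1, fun _ => 0, []⟩ := by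
  have hS0 : 0 < S := by omega
  refine Ensures.bind (ensures_mark hS0 rfl (by simp) ?_)
  have h0 : (fun k : RegisterName ⊕ Index N => (decide (k = Sum.inl one)).toNat) =
      startReg N 0 := by
    funext k
    rcases k with a | k
    · cases a <;> simp [startReg]
    · simp [startReg]
  refine Ensures.bind ?_
  simp only [h0]
  refine ensures_increase_grow (V := c * (w.length + 1)) (by simp) ⟨one_pos, by simp, Or.inl rfl⟩
    (by rw [Nat.zero_add]; exact Nat.le_mul_of_pos_right c (Nat.succ_pos _)) hS fun W hW => ?_
  have key : ∀ d p, p + d = w.length → ∀ W, Tight W (c * (p + 1)) →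
      Ensures w S (iter (P := Unit) (fun _ =>
        (act fun
          | InputSymbol.letter _ => (true, HeadMove.right, [])
          | _ => (false, HeadMove.stay, [])).bind fun b =>
        if b then (increase idx c).bind fun _ => skip (Sum.inl ()) else skip (Sum.inr ())) ()) Q
        (⟨W, p + 1, startReg N (c * (p + 1)), []⟩ : Memory (RegisterName ⊕ Index N) Y) := by
    intro d
    induction d with
    | zero =>
      intro p hp W hW
      obtain rfl : p = w.length := hp
      refine Ensures.iter (Ensures.bind (ensures_act hS0 ?_))
      simp only [inputAt_length_succ, HeadMove.apply, List.append_nil, min_self]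
      have hWS := hW.lt_of_log le_rfl hS
      exact ensures_skip ⟨le_rfl, hW.pos, by simp only; omega⟩ (h W hW.pos (by omega) hW.lt)
    | succ d ih =>
      intro p hp W hW
      refine Ensures.iter (Ensures.bind (ensures_act hS0 ?_))
      have hpw : p < w.length := by omega
      simp only [inputAt_succ hpw, HeadMove.apply, List.append_nil]
      rw [min_eq_left (by omega)]
      have hle : c * (p + 1) + c ≤ c * (w.length + 1) := by
        rw [← Nat.mul_succ]; exact Nat.mul_le_mul_left _ (by omega)
      refine Ensures.bind (ensures_increase_grow (by omega) hW hle hS fun W' hW' => ?_)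
      have hWS := hW'.lt_of_log hle hS
      exact ensures_skip ⟨by simp only; omega, hW'.pos, by simp only; omega⟩
        (ih (p + 1) (by omega) W' hW')
  rw [Nat.zero_add] at hW ⊢
  simpa using key w.length 0 (Nat.zero_add _) W (by simpa using hW)

/-- Account for the image under `τ` of a letter. -/
def account (N : Bool → ℕ) (Y : Type) :
    Letter → Fragment Letter Y (TrackSymbol (RegisterName ⊕ Index N)) Unit
  | Letter.gen t => increase up (N !t)
  | Letter.zinv => increase down (N false * N true)
  | Letter.one => skip ()

/-- Compute the length of the input, a bound for the moduli, and the image under `τ`. -/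
def count (N : Bool → ℕ) (Y : Type) (c : ℕ) :
    Fragment Letter Y (TrackSymbol (RegisterName ⊕ Index N)) Unit :=
  rewind.bind fun _ => (act fun _ => ((), HeadMove.right, [])).bind fun _ =>
    (increase lim c).bind fun _ => iter (P := Unit) (fun _ =>
      (act fun
        | InputSymbol.letter a => (some a, HeadMove.right, [])
        | _ => (none, HeadMove.stay, [])).bind fun
      | some a => (increase len 1).bind fun _ => (increase lim c).bind fun _ =>
          (account N Y a).bind fun _ => skip (Sum.inl ())
      | none => skip (Sum.inr ())) ()

theorem le_relator (h : ∀ t, 0 < N t) (t : Bool) : N t ≤ N false * N true := by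
  cases t
  · exact Nat.le_mul_of_pos_right _ (h true)
  · exact Nat.le_mul_of_pos_left _ (h false)

/-- Registers hold natural numbers, so the integer value of `τ` is kept as the difference of `up`
and `down`. -/
theorem ensures_account {Q : Unit → Memory (RegisterName ⊕ Index N) Y → Prop} {a : Letter} {x : G}
    {B : ℕ}
    (hσ : Fits w S σ) (h1 : σ.reg (Sum.inl one) = 1)
    (hup : σ.reg (Sum.inl up) ≤ B) (hdown : σ.reg (Sum.inl down) ≤ B)
    (hB : B + N false * N true < 2 ^ σ.width)
    (hτ : (𝒮.τ x).toAdd = σ.reg (Sum.inl up) - σ.reg (Sum.inl down))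
    (h : ∀ r, (∀ b, b ≠ up → b ≠ down → r (Sum.inl b) = σ.reg (Sum.inl b)) →
      r (Sum.inl up) ≤ B + N false * N true → r (Sum.inl down) ≤ B + N false * N true →
      (𝒮.τ (x * 𝒮.letter a)).toAdd = r (Sum.inl up) - r (Sum.inl down) →
      Q () { σ with reg := r }) :
    Ensures w S (account N Y a) Q σ := by
  cases a with
  | gen t =>
    have hN := le_relator 𝒮.pos (!t)
    refine ensures_increase (by simp) hσ h1 (by omega) (h _ (fun b hb _ => ?_) ?_ ?_ ?_)
    · simp [hb]
    · simp; omega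
    · simp; omega
    · simp only [Setting.letter, map_mul, 𝒮.τ_g, toAdd_mul, hτ, toAdd_ofAdd]
      simp; ring
  | zinv =>
    refine ensures_increase (by simp) hσ h1 (by omega) (h _ (fun b _ hb => ?_) ?_ ?_ ?_)
    · simp [hb]
    · simp; omega
    · simp; omega
    · simp only [Setting.letter, map_mul, map_inv, 𝒮.τ_z, toAdd_mul, toAdd_inv, hτ, toAdd_ofAdd]
      simp; ring
  | one =>
    refine ensures_skip hσ (h _ (fun _ _ _ => rfl) (by omega) (by omega) ?_)
    rw [Setting.letter, mul_one, hτ]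

theorem ensures_count {Q : Unit → Memory (RegisterName ⊕ Index N) Y → Prop} {c W v : ℕ}
    (hW0 : 0 < W) (hWS : W < S) (hc : c * (w.length + 1) < 2 ^ W)
    (hD : (N false * N true + 1) * (w.length + 1) < 2 ^ W)
    (h : ∀ r, r (Sum.inl one) = 1 → r (Sum.inl cur) = 0 → r (Sum.inl len) = w.length →
      r (Sum.inl lim) = c * (w.length + 1) → r (Sum.inl up) ≤ N false * N true * w.length →
      r (Sum.inl down) ≤ N false * N true * w.length →
      (𝒮.τ (𝒮.pre w w.length)).toAdd = r (Sum.inl up) - r (Sum.inl down) →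
      Q () ⟨W, w.length + 1, r, []⟩) :
    Ensures w S (count N Y c) Q ⟨W, w.length + 1, startReg N v, []⟩ := by
  have hfit : ∀ p r, p ≤ w.length + 1 →
      Fits w S (⟨W, p, r, []⟩ : Memory (RegisterName ⊕ Index N) Y) := fun p r hp => ⟨hp, hW0, hWS⟩
  have key : ∀ d p, p + d = w.length → ∀ r : RegisterName ⊕ Index N → ℕ,
      r (Sum.inl one) = 1 → r (Sum.inl cur) = 0 → r (Sum.inl len) = p →
      r (Sum.inl lim) = c * (p + 1) → r (Sum.inl up) ≤ N false * N true * p →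
      r (Sum.inl down) ≤ N false * N true * p →
      (𝒮.τ (𝒮.pre w p)).toAdd = r (Sum.inl up) - r (Sum.inl down) →
      Ensures w S (iter (P := Unit) (fun _ =>
        (act fun
          | InputSymbol.letter a => (some a, HeadMove.right, [])
          | _ => (none, HeadMove.stay, [])).bind fun
        | some a => (increase len 1).bind fun _ => (increase lim c).bind fun _ =>
            (account N Y a).bind fun _ => skip (Sum.inl ())
        | none => skip (Sum.inr ())) ()) Q
        (⟨W, p + 1, r, []⟩ : Memory (RegisterName ⊕ Index N) Y) := by
    intro d
    induction d with
    | zero =>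
      intro p hp r h1 h2 h3 h4 h5 h6 h7
      obtain rfl : p = w.length := hp
      refine Ensures.iter (Ensures.bind (ensures_act (hW0.trans hWS) ?_))
      simp only [inputAt_length_succ, HeadMove.apply, List.append_nil, min_self]
      exact ensures_skip (hfit _ _ le_rfl) (h r h1 h2 h3 h4 h5 h6 h7)
    | succ d ih =>
      intro p hp r h1 h2 h3 h4 h5 h6 h7
      refine Ensures.iter (Ensures.bind (ensures_act (hW0.trans hWS) ?_))
      have hpw : p < w.length := by omega
      simp only [inputAt_succ hpw, HeadMove.apply, List.append_nil]
      rw [min_eq_left (by omega)]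
      have hle : c * (p + 1) + c ≤ c * (w.length + 1) := by
        rw [← Nat.mul_succ]; exact Nat.mul_le_mul_left _ (by omega)
      have hle' : N false * N true * p + N false * N true ≤ N false * N true * w.length := by
        rw [← Nat.mul_succ]; exact Nat.mul_le_mul_left _ (by omega)
      have hD' : (N false * N true + 1) * (w.length + 1) =
          N false * N true * w.length + N false * N true + w.length + 1 := by ring
      refine Ensures.bind (ensures_increase (by simp) (hfit (p + 1 + 1) _ (by omega)) h1
        (by simp only [h3]; omega) ?_)
      refine Ensures.bind (ensures_increase (by simp) (hfit (p + 1 + 1) _ (by omega)) (by simpa using h1)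
        (by simp [h4]; omega) ?_)
      refine Ensures.bind (ensures_account 𝒮 (x := 𝒮.pre w p) (B := N false * N true * p)
        (hfit (p + 1 + 1) _ (by omega)) (by simpa using h1)
        (by simpa using h5) (by simpa using h6) (by simp only; omega) (by simpa using h7)
        fun r' hr' hup hdown hτ => ?_)
      refine ensures_skip (hfit (p + 1 + 1) _ (by omega)) (ih (p + 1) (by omega) r' ?_ ?_ ?_ ?_ hup hdown ?_)
      · rw [hr' _ (by simp) (by simp)]; simpa using h1
      · rw [hr' _ (by simp) (by simp)]; simpa using h2
      · rw [hr' _ (by simp) (by simp)]; simpa using h3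
      · rw [hr' _ (by simp) (by simp)]; simp [h4]; ring
      · rwa [𝒮.pre_succ w hpw]
  refine Ensures.bind (ensures_rewind (hfit _ _ le_rfl)
    (Ensures.bind (ensures_act (hW0.trans hWS) ?_)))
  simp only [HeadMove.apply, List.append_nil, Nat.zero_add]
  rw [min_eq_left (by omega)]
  have hcw : c ≤ c * (w.length + 1) := Nat.le_mul_of_pos_right c (Nat.succ_pos _)
  refine Ensures.bind (ensures_increase (by simp) (hfit 1 _ (by omega)) rfl
    (by simp only [startReg]; omega) ?_)
  refine key w.length 0 (Nat.zero_add _) _ ?_ ?_ ?_ ?_ ?_ ?_ ?_ <;> simp [startReg]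

/-! ### The central part of the normal form -/

/-- Print a word so often that register `idx`, increased by `D` each time, reaches register `x`. -/
noncomputable def pump (x : RegisterName) (D : ℕ) (u : List Y) :
    Fragment Letter Y (TrackSymbol (RegisterName ⊕ Index N)) Unit :=
  iter (P := Unit) (fun _ => (equal (Sum.inl idx) (Sum.inl x)).bind fun b =>
    if b then skip (Sum.inr ()) else
      (act fun _ => ((), HeadMove.stay, u)).bind fun _ =>
      (increase idx D).bind fun _ => skip (Sum.inl ())) ()

theorem ensures_pump {Q : Unit → Memory (RegisterName ⊕ Index N) Y → Prop} {x : RegisterName}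
    {D k : ℕ} {u : List Y} (hx : x ≠ idx) (hD : 0 < D) (hσ : Fits w S σ)
    (h1 : σ.reg (Sum.inl one) = 1)
    (hk : σ.reg (Sum.inl idx) + D * k = σ.reg (Sum.inl x))
    (hlt : σ.reg (Sum.inl x) < 2 ^ σ.width)
    (h : ∀ r, Q () { σ with reg := r, out := σ.out ++ (List.replicate k u).flatten }) :
    Ensures w S (pump x D u) Q σ := by
  induction k generalizing σ with
  | zero =>
    refine Ensures.iter (Ensures.bind (ensures_equal hσ (by omega) hlt ?_))
    rw [if_pos (by simpa using hk)]
    exact ensures_skip hσ (by simpa using h σ.reg)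
  | succ k ih =>
    rw [Nat.mul_succ] at hk
    refine Ensures.iter (Ensures.bind (ensures_equal hσ (by omega) hlt ?_))
    rw [if_neg (by simp; omega)]
    refine Ensures.bind (ensures_act (hσ.width_pos.trans hσ.width_lt) ?_)
    simp only [HeadMove.apply]
    rw [min_eq_left hσ.pos_le]
    have hfit : ∀ r, Fits w S (⟨σ.width, σ.pos, r, σ.out ++ u⟩ :
      Memory (RegisterName ⊕ Index N) Y) := fun r => ⟨hσ.pos_le, hσ.width_pos, hσ.width_lt⟩
    refine Ensures.bind (ensures_increase (by simp) (hfit _) h1 (by simp only; omega)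
      (ensures_skip (hfit _) (ih (hfit _) (by simpa using h1) ?_ ?_ fun r => ?_)))
    · simp [hx]; omega
    · simpa [hx] using hlt
    · simpa [List.replicate_succ] using h r

/-- The word for a power of the central element. -/
def centralWord (u u' : List Y) (k : ℤ) : List Y :=
  if 0 ≤ k then (List.replicate k.toNat u).flatten else (List.replicate (-k).toNat u').flatten

/-- Print the power of the central element determined by the registers `up` and `down`. -/
noncomputable def finish (D : ℕ) (u u' : List Y) :
    Fragment Letter Y (TrackSymbol (RegisterName ⊕ Index N)) Unit :=
  (assign (Sum.inl idx) none).bind fun _ =>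
    (iter (P := Unit) (fun _ => (equal (Sum.inl idx) (Sum.inl up)).bind fun b =>
      if b then skip (Sum.inr false) else (equal (Sum.inl idx) (Sum.inl down)).bind fun b =>
      if b then skip (Sum.inr true) else
      (increase idx 1).bind fun _ => skip (Sum.inl ())) ()).bind fun b =>
    if b then pump up D u else pump down D u'

/-- The counter `idx` climbs to the smaller of `up` and `down`. The remaining distance to the larger
one is `|k| * D`, which steps of length `D` cover without any division. -/
theorem ensures_finish {Q : Unit → Memory (RegisterName ⊕ Index N) Y → Prop}
    {D : ℕ} {k : ℤ} {u u' : List Y} (hD : 0 < D) (hσ : Fits w S σ)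
    (h1 : σ.reg (Sum.inl one) = 1)
    (hk : (σ.reg (Sum.inl up) : ℤ) = σ.reg (Sum.inl down) + k * D)
    (hup : σ.reg (Sum.inl up) < 2 ^ σ.width) (hdown : σ.reg (Sum.inl down) < 2 ^ σ.width)
    (h : ∀ r, Q () { σ with reg := r, out := σ.out ++ centralWord u u' k }) :
    Ensures w S (finish D u u') Q σ := by
  have hD' : (0 : ℤ) < D := Int.natCast_pos.2 hD
  refine Ensures.bind (ensures_assign hσ (Ensures.bind ?_))
  have key : ∀ d p, p + d = min (σ.reg (Sum.inl up)) (σ.reg (Sum.inl down)) →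
      Ensures w S (iter (P := Unit) (fun _ => (equal (Sum.inl idx) (Sum.inl up)).bind fun b =>
        if b then skip (Sum.inr false) else (equal (Sum.inl idx) (Sum.inl down)).bind fun b =>
        if b then skip (Sum.inr true) else
        (increase idx 1).bind fun _ => skip (Sum.inl ())) ())
        (fun b => Ensures w S (if b then pump up D u else pump down D u') Q)
        { σ with reg := Function.update σ.reg (Sum.inl idx) p } := by
    intro d
    induction d with
    | zero =>
      intro p hp
      refine Ensures.iter (Ensures.bind (ensures_equal (hσ.setReg _) ?_ ?_ ?_))
      · simp; omega
      · simpa using hup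
      simp only [Function.update_self, ne_eq, Sum.inl.injEq, reduceCtorEq, not_false_eq_true,
        Function.update_of_ne]
      by_cases hpu : p = σ.reg (Sum.inl up)
      · rw [if_pos (by simpa using hpu)]
        refine ensures_skip (hσ.setReg _) ?_
        simp only [Sum.elim_inr, Bool.false_eq_true, if_false]
        have hk0 : k ≤ 0 := by
          by_contra hk0
          have : 0 < k * D := mul_pos (by omega) hD'
          omega
        have hkD : k * D = -(D * ((-k).toNat : ℤ)) := by
          rw [Int.toNat_of_nonneg (by omega)]; ring
        refine ensures_pump (k := (-k).toNat) (by simp) hD (hσ.setReg _) (by simpa using h1) ?_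
          (by simpa using hdown) fun r => ?_
        · simp only [Function.update_self, ne_eq, Sum.inl.injEq, reduceCtorEq, not_false_eq_true,
            Function.update_of_ne]
          zify
          rw [hpu, hk, hkD]
          ring
        · have := h r
          rw [centralWord] at this
          -- If `up` and `down` agree, the exponent is `0` and either branch prints nothing.
          rcases hk0.lt_or_eq with hk0 | rfl
          · rwa [if_neg (by omega)] at this
          · simpa using this
      · rw [if_neg (by simpa using hpu)]
        have hpd : p = σ.reg (Sum.inl down) := by omega
        refine Ensures.bind (ensures_equal (hσ.setReg _) ?_ ?_ ?_)
        · simp; omega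
        · simpa using hdown
        simp only [Function.update_self, ne_eq, Sum.inl.injEq, reduceCtorEq, not_false_eq_true,
          Function.update_of_ne]
        rw [if_pos (by simpa using hpd)]
        refine ensures_skip (hσ.setReg _) ?_
        simp only [Sum.elim_inr, if_true]
        have hk0 : 0 ≤ k := by
          by_contra hk0
          have : k * D < 0 := mul_neg_of_neg_of_pos (by omega) hD'
          omega
        refine ensures_pump (k := k.toNat) (by simp) hD (hσ.setReg _) (by simpa using h1) ?_
          (by simpa using hup) fun r => ?_
        · simp only [Function.update_self, ne_eq, Sum.inl.injEq, reduceCtorEq, not_false_eq_true,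
            Function.update_of_ne]
          zify
          rw [hpd, hk, Int.toNat_of_nonneg hk0]
          ring
        · have := h r
          rwa [centralWord, if_pos hk0] at this
    | succ d ih =>
      intro p hp
      refine Ensures.iter (Ensures.bind (ensures_equal (hσ.setReg _) ?_ ?_ ?_))
      · simp; omega
      · simpa using hup
      simp only [Function.update_self, ne_eq, Sum.inl.injEq, reduceCtorEq, not_false_eq_true,
        Function.update_of_ne]
      rw [if_neg (by simp; omega)]
      refine Ensures.bind (ensures_equal (hσ.setReg _) ?_ ?_ ?_)
      · simp; omega
      · simpa using hdown
      simp only [Function.update_self, ne_eq, Sum.inl.injEq, reduceCtorEq, not_false_eq_true,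
        Function.update_of_ne]
      rw [if_neg (by simp; omega)]
      refine Ensures.bind (ensures_increase (by simp) (hσ.setReg _) (by simpa using h1)
        (by simp; omega) (ensures_skip ((hσ.setReg _).setReg _) ?_))
      simpa using ih (p + 1) (by omega)
  exact key _ 0 (Nat.zero_add _)

end Fragment

/-! ### The whole program and its space bound. -/

namespace Fragment

open Memory RegisterName TorusKnot

theorem Ensures.outputs {X Y K : Type} [Finite K] {w : List X} {S : ℕ}
    {F : Fragment X Y (TrackSymbol K) Unit} {Q : Unit → Memory K Y → Prop}
    (h : Ensures w S F Q ⟨0, 1, fun _ => 0, []⟩) (hS : 0 < S) :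
    ∃ σ, Q () σ ∧ (F.toTransducer none).Outputs w σ.out ∧
      (F.toTransducer none).UsesSpaceAtMost w S := by
  obtain ⟨⟨⟩, σ, hrun, hQ⟩ := h
  have hinit : (F.toTransducer none).initial = F.config none (some F.start)
      (⟨0, 1, fun _ => 0, []⟩ : Memory K Y).encode := by
    simp only [Transducer.initial, config, encode, Nat.not_lt_zero, if_false]
    rfl
  refine ⟨σ, hQ, ⟨_, ?_, step_config_none σ.encode, rfl⟩, fun C hC => ?_⟩
  · rw [hinit]; exact hrun.reaches
  · rw [hinit] at hC
    exact hrun.workPos_lt hS hC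

section

variable {Y : Type} {N : Bool → ℕ} {G : Type} [Group G] (𝒮 : Setting N G)
  (word : Bool → List Y) (u' : List Y)

/-- The word for the normal form given by exponents of the generators and of the central element. -/
def normalWord (N : Bool → ℕ) (e : ℕ) (es : List ℕ) (k : ℤ) : List Y :=
  syllableWord word false (e :: es) ++
    centralWord (List.replicate (N false) (word false)).flatten u' k

/-- The program that computes the normal form. -/
noncomputable def program (N : Bool → ℕ) :
    Fragment Letter Y (TrackSymbol (RegisterName ⊕ Index N)) Unit :=
  (allocate N Y (4 * (4 + 3 * (N false + N true)) + 2 + 2 * (N false * N true + 1))).bind fun _ =>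
  (count N Y (2 * (4 + 3 * (N false + N true)) + 1)).bind fun _ => (mainLoop word false).bind fun _ =>
  finish (N false * N true) (List.replicate (N false) (word false)).flatten u'

theorem toAdd_τ_syllables (t : Bool) (es : List ℕ) :
    (𝒮.τ (𝒮.syllables t es)).toAdd = weight N t es := by
  induction es generalizing t with
  | nil => simp [Setting.syllables, weight]
  | cons e es ih =>
    rw [Setting.syllables, map_mul, toAdd_mul, ih, map_pow, 𝒮.τ_g, weight]
    simp [mul_comm]

theorem ensures_program {w : List Letter} {S : ℕ}
    (hS : Nat.log 2 ((4 * (4 + 3 * (N false + N true)) + 2 + 2 * (N false * N true + 1)) *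
      (w.length + 1)) + 3 ≤ S) :
    Ensures w S (program word u' N) (fun _ σ => ∃ e es k, e < N false ∧ Reduced N true es ∧
      (w.map 𝒮.letter).prod = 𝒮.syllables false (e :: es) * 𝒮.z ^ k ∧
      σ.out = normalWord word u' N e es k) ⟨0, 1, fun _ => 0, []⟩ := by
  obtain ⟨κ, hκ⟩ : ∃ κ, κ = 4 + 3 * (N false + N true) := ⟨_, rfl⟩
  obtain ⟨D, hD⟩ : ∃ D, D = N false * N true := ⟨_, rfl⟩
  have hD0 : 0 < D := hD ▸ Nat.mul_pos (𝒮.pos false) (𝒮.pos true)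
  rw [← hκ, ← hD] at hS
  unfold program
  rw [← hκ, ← hD]
  refine Ensures.bind (ensures_allocate hS fun W hW0 hWS hW => ?_)
  -- The first summand is twice the register `lim`, as needed for arithmetic modulo numbers below
  -- `lim`. The second leaves room for `up` and for `down`, which receives contributions both from
  -- the input and from the printed syllables.
  have hW' : 2 * ((2 * κ + 1) * (w.length + 1)) + 2 * ((D + 1) * (w.length + 1)) < 2 ^ W := by
    refine lt_of_eq_of_lt ?_ hW
    ring
  refine Ensures.bind (ensures_count 𝒮 hW0 hWS (by omega) (by rw [← hD]; omega)
    fun r h1 hcur hlen hlim hup hdown hτ => ?_)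
  rw [← hD] at hup hdown
  have hready : Ready κ w S (⟨W, w.length + 1, r, []⟩ : Memory (RegisterName ⊕ Index N) Y) :=
    { pos_le := le_rfl
      width_pos := hW0
      width_lt := hWS
      one_eq := h1
      len_eq := hlen
      lt_lim := by simp only [hlim]; nlinarith
      lim_le := by simp only [hlim]; omega
      le_κ := fun t => by cases t <;> omega }
  have hDl : (D + 1) * (w.length + 1) = D * w.length + D + w.length + 1 := by ring
  refine Ensures.bind (ensures_mainLoop 𝒮 word hready hcur (by simp only [← hD, Nat.mul_succ]; omega)
    fun e es r' p hp he hes hρ hr hdown' hlt => ?_)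
  have hup' : r' (Sum.inl up) = r (Sum.inl up) :=
    hr up (by simp) (by simp) (by simp) (by simp) (by simp)
  -- Input and printed syllables act alike, so they differ by a power of `z`; comparing values of
  -- `τ` then identifies its exponent with the one that `finish` prints.
  obtain ⟨k, hk⟩ : ∃ k : ℤ, (𝒮.syllables false (e :: es))⁻¹ * 𝒮.pre w w.length = 𝒮.z ^ k := by
    refine 𝒮.eq_zpow_of_ρ_baseVector ?_
    rw [map_mul, map_inv, hρ, inv_mul_cancel]
    rfl
  have hk' : 𝒮.pre w w.length = 𝒮.syllables false (e :: es) * 𝒮.z ^ k := by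
    rw [← hk, mul_inv_cancel_left]
  refine ensures_finish (k := k) hD0 ⟨hp, hW0, hWS⟩ ?_ ?_ ?_ hlt fun r'' => ?_
  · exact (hr one (by simp) (by simp) (by simp) (by simp) (by simp)).trans h1
  · rw [hk', map_mul, toAdd_mul, toAdd_τ_syllables, map_zpow, 𝒮.τ_z] at hτ
    simp only [hup', hdown', hD]
    simp only [toAdd_zpow, toAdd_ofAdd, smul_eq_mul] at hτ
    push_cast
    linarith
  · simp only [hup']; omega
  · exact ⟨e, es, k, he, hes, by rw [← 𝒮.pre_length, hk'], by simp [normalWord]⟩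

theorem exists_transducer :
    ∃ (M : Transducer Letter Y) (c : ℕ), ∀ w : List Letter, ∃ e es k, e < N false ∧
      Reduced N true es ∧ (w.map 𝒮.letter).prod = 𝒮.syllables false (e :: es) * 𝒮.z ^ k ∧
      M.Outputs w (normalWord word u' N e es k) ∧
      M.UsesSpaceAtMost w (c * (Nat.log 2 w.length + 1)) := by
  have : ∀ t, NeZero (N t) := fun t => ⟨(𝒮.pos t).ne'⟩
  obtain ⟨c, hc⟩ : ∃ c, c = 4 * (4 + 3 * (N false + N true)) + 2 + 2 * (N false * N true + 1) :=
    ⟨_, rfl⟩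
  refine ⟨(program word u' N).toTransducer none, c + 4, fun w => ?_⟩
  have hlog : Nat.log 2 (c * (w.length + 1)) < c + (Nat.log 2 w.length + 1) := by
    refine Nat.log_lt_of_lt_pow (Nat.mul_pos (by omega) (Nat.succ_pos _)).ne' ?_
    rw [pow_add]
    exact Nat.mul_lt_mul_of_lt_of_le Nat.lt_two_pow_self
      (Nat.lt_pow_succ_log_self (by norm_num) _) (by positivity)
  have hS : Nat.log 2 (c * (w.length + 1)) + 3 ≤ (c + 4) * (Nat.log 2 w.length + 1) := by
    nlinarith [Nat.zero_le (c * Nat.log 2 w.length)]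
  obtain ⟨σ, ⟨e, es, k, he, hes, heq, hout⟩, hM, hspace⟩ :=
    (ensures_program 𝒮 word u' (S := (c + 4) * (Nat.log 2 w.length + 1))
      (by rw [← hc]; exact hS)).outputs (by positivity)
  exact ⟨e, es, k, he, hes, heq, hout ▸ hM, hspace⟩

end

end Fragment

/-! ### Substitution of words of equal length for the letters of the input -/

theorem List.getElem?_flatMap_ofFn {X A : Type*} {ℓ : ℕ} (s : X → Fin ℓ → A) (w : List X) (j : ℕ)
    (t : Fin ℓ) :
    (w.flatMap fun x => List.ofFn (s x))[ℓ * j + t]? = w[j]?.map fun x => s x t := by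
  induction w generalizing j with
  | nil => simp
  | cons x w ih =>
    rw [List.flatMap_cons]
    rcases j with _ | j
    · rw [List.getElem?_append_left (by simp)]
      simp
    · rw [List.getElem?_append_right (by rw [List.length_ofFn, Nat.mul_succ]; omega),
        List.length_ofFn, Nat.mul_succ, show ℓ * j + ℓ + t - ℓ = ℓ * j + t by omega, ih]
      simp

theorem List.length_flatMap_ofFn {X A : Type*} {ℓ : ℕ} (s : X → Fin ℓ → A) (w : List X) :
    (w.flatMap fun x => List.ofFn (s x)).length = ℓ * w.length := by
  induction w with
  | nil => simp
  | cons x w ih => rw [List.flatMap_cons, List.length_append, ih]; simp; ring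

namespace Transducer

variable {A X Y : Type} {ℓ : ℕ} (s : X → Fin ℓ → A)

/-- The word that results from substitution. -/
def substituted (w : List X) : List A := w.flatMap fun x => List.ofFn (s x)

/-- The letter number `t` of the word substituted for a symbol. -/
def substitutedSymbol (t : Fin ℓ) : InputSymbol X → InputSymbol A
  | InputSymbol.leftEnd => InputSymbol.leftEnd
  | InputSymbol.letter x => InputSymbol.letter (s x t)
  | InputSymbol.rightEnd => InputSymbol.rightEnd

/-- The square of the input tape that corresponds to the letter number `t` of the word substituted
for the letter on square `i`. -/
def substitutedPos (i : ℕ) (t : Fin ℓ) : ℕ :=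
  match i with
  | 0 => 0
  | j + 1 => ℓ * j + t + 1

/-- The state component and the movement of the input head that simulate a movement of the input
head on the word that results from substitution. -/
def substitutedMove [NeZero ℓ] (t : Fin ℓ) : InputSymbol X → HeadMove → Fin ℓ × HeadMove
  | _, HeadMove.stay => (t, HeadMove.stay)
  | InputSymbol.leftEnd, HeadMove.left => (t, HeadMove.stay)
  | InputSymbol.leftEnd, HeadMove.right => (0, HeadMove.right)
  | InputSymbol.rightEnd, HeadMove.left => (Fin.rev 0, HeadMove.left)
  | InputSymbol.rightEnd, HeadMove.right => (t, HeadMove.stay)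
  | InputSymbol.letter _, HeadMove.left =>
    if t.1 = 0 then (Fin.rev 0, HeadMove.left)
    else (⟨t.1 - 1, (Nat.sub_le _ _).trans_lt t.2⟩, HeadMove.stay)
  | InputSymbol.letter _, HeadMove.right =>
    if h : t.1 + 1 < ℓ then (⟨t.1 + 1, h⟩, HeadMove.stay) else (0, HeadMove.right)

/-- On the right marker only the offset `0` corresponds to the end of the substituted word; other
offsets would lie beyond the tape. -/
theorem inputAt_substituted (w : List X) {i : ℕ} {t : Fin ℓ} (hi : i ≤ w.length + 1)
    (ht : i = w.length + 1 → t.1 = 0) :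
    inputAt (substituted s w) (substitutedPos i t) = substitutedSymbol s t (inputAt w i) := by
  rcases i with _ | j
  · rfl
  · simp only [inputAt, substitutedPos, substituted, List.getElem?_flatMap_ofFn]
    cases w[j]? <;> rfl

theorem substitutedPos_move [NeZero ℓ] (w : List X) {i : ℕ} {t : Fin ℓ} (hi : i ≤ w.length + 1)
    (ht : i = w.length + 1 → t.1 = 0) (m : HeadMove) :
    substitutedPos (min ((substitutedMove t (inputAt w i) m).2.apply i) (w.length + 1))
        (substitutedMove t (inputAt w i) m).1 =
      min (m.apply (substitutedPos i t)) ((substituted s w).length + 1) ∧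
    (min ((substitutedMove t (inputAt w i) m).2.apply i) (w.length + 1) = w.length + 1 →
      (substitutedMove t (inputAt w i) m).1.1 = 0) := by
  have hℓ : 0 < ℓ := Nat.pos_of_neZero ℓ
  have hlen : (substituted s w).length = ℓ * w.length := List.length_flatMap_ofFn s w
  have hzero : (0 : Fin ℓ).1 = 0 := by simp
  have hrev : (Fin.rev (0 : Fin ℓ)).1 = ℓ - 1 := by simp
  rw [hlen]
  rcases i with _ | j
  · cases m <;> simp [substitutedMove, inputAt, substitutedPos, HeadMove.apply]
  have hjl : ℓ * j ≤ ℓ * w.length := Nat.mul_le_mul_left _ (by omega)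
  rcases (Nat.succ_le_succ_iff.1 hi).lt_or_eq with hj | rfl
  · have hx : inputAt w (j + 1) = InputSymbol.letter w[j] := by simp [inputAt, hj]
    have hjl' : ℓ * j + ℓ ≤ ℓ * w.length := by
      rw [← Nat.mul_succ]; exact Nat.mul_le_mul_left _ hj
    have htℓ := t.2
    rw [hx]
    cases m with
    | stay =>
      simp only [substitutedMove, HeadMove.apply]
      rw [min_eq_left (by omega)]
      simp only [substitutedPos]
      omega
    | left =>
      simp only [substitutedMove]
      split_ifs with h
      · simp only [HeadMove.apply]
        rw [min_eq_left (by omega)]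
        rcases j with _ | j
        · simp [substitutedPos, h]
        · simp only [Nat.add_sub_cancel, substitutedPos, hrev, h, Nat.mul_succ]
          rw [Nat.mul_succ] at hjl
          omega
      · simp only [HeadMove.apply]
        rw [min_eq_left (by omega)]
        simp only [substitutedPos]
        omega
    | right =>
      simp only [substitutedMove]
      split_ifs with h
      · simp only [HeadMove.apply]
        rw [min_eq_left (by omega)]
        simp only [substitutedPos]
        omega
      · simp only [HeadMove.apply]
        rw [min_eq_left (by omega)]
        simp only [substitutedPos, hzero, Nat.mul_succ, implies_true, and_true]
        omega
  · have hx : inputAt w (w.length + 1) = InputSymbol.rightEnd := by simp [inputAt]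
    have ht0 := ht rfl
    rw [hx]
    cases m with
    | stay => simp [substitutedMove, HeadMove.apply, substitutedPos, ht0]
    | right => simp [substitutedMove, HeadMove.apply, substitutedPos, ht0]
    | left =>
      simp only [substitutedMove, HeadMove.apply, Nat.add_sub_cancel]
      rw [min_eq_left (by omega)]
      rcases h : w.length with _ | n
      · simp [substitutedPos, ht0]
      · simp only [substitutedPos, hrev, ht0, Nat.mul_succ]
        omega

/-- The transducer that works on the input as `M` does on the word that results from
substitution. -/
def substitute [NeZero ℓ] (M : Transducer A Y) : Transducer X Y where
  State := M.State × Fin ℓ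
  Work := M.Work
  finite_state := by
    have := M.finite_state
    infer_instance
  finite_work := M.finite_work
  start := (M.start, 0)
  blank := M.blank
  transition q x b := (M.transition q.1 (substitutedSymbol s q.2 x) b).map fun a =>
    { nextState := (a.nextState, (substitutedMove q.2 x a.moveInput).1)
      writeWork := a.writeWork
      moveInput := (substitutedMove q.2 x a.moveInput).2
      moveWork := a.moveWork
      print := a.print }

variable [NeZero ℓ] {M : Transducer A Y} {w : List X}

/-- The configuration of `M` simulated by a configuration of `M.substitute s`. -/
def simulated (C : (M.substitute s).Config) : M.Config where
  state := C.state.1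
  inputPos := substitutedPos C.inputPos C.state.2
  workTape := C.workTape
  workPos := C.workPos
  output := C.output

/-- The input head is on the tape, and on its last square only in one way. -/
def Admissible (w : List X) (C : (M.substitute s).Config) : Prop :=
  C.inputPos ≤ w.length + 1 ∧ (C.inputPos = w.length + 1 → C.state.2.1 = 0)

variable {s}

/-- One step corresponds to exactly one step. Hence reachability, halting and the work head
positions carry over without further work space; the offset is kept in the finite control. -/
theorem step_simulated {C : (M.substitute s).Config} (hC : Admissible s w C) :
    M.step (substituted s w) (simulated s C) =
      ((M.substitute s).step w C).map (simulated s) := by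
  simp only [step, simulated, inputAt_substituted s w hC.1 hC.2, substitute]
  rcases M.transition C.state.1 (substitutedSymbol s C.state.2 (inputAt w C.inputPos))
    (C.workTape C.workPos) with _ | a
  · rfl
  · simp only [Option.map_some, ← (substitutedPos_move s w hC.1 hC.2 a.moveInput).1]
    rfl

theorem Admissible.step {C C' : (M.substitute s).Config} (hC : Admissible s w C)
    (h : (M.substitute s).step w C = some C') : Admissible s w C' := by
  obtain ⟨b, hb, rfl⟩ := Option.map_eq_some_iff.1 h
  obtain ⟨a, -, rfl⟩ := Option.map_eq_some_iff.1 hb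
  exact ⟨min_le_right _ _, (substitutedPos_move s w hC.1 hC.2 a.moveInput).2⟩

theorem admissible_initial : Admissible s w (M.substitute s).initial :=
  ⟨by simp [initial], fun _ => by simp [initial, substitute]⟩

theorem simulated_initial : simulated s (M.substitute s).initial = M.initial := by
  simp [simulated, initial, substitute, substitutedPos]

theorem exists_simulated {C : M.Config}
    (h : StateTransition.Reaches (M.step (substituted s w)) M.initial C) :
    ∃ C', StateTransition.Reaches ((M.substitute s).step w) (M.substitute s).initial C' ∧
      Admissible s w C' ∧ simulated s C' = C := by
  induction h with
  | refl => exact ⟨_, Relation.ReflTransGen.refl, admissible_initial, simulated_initial⟩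
  | tail _ h ih =>
    obtain ⟨C', hr, ha, rfl⟩ := ih
    rw [Option.mem_def, step_simulated ha, Option.map_eq_some_iff] at h
    obtain ⟨C'', h1, h2⟩ := h
    exact ⟨C'', hr.tail h1, ha.step h1, h2⟩

theorem reaches_simulated {C : (M.substitute s).Config}
    (h : StateTransition.Reaches ((M.substitute s).step w) (M.substitute s).initial C) :
    Admissible s w C ∧
      StateTransition.Reaches (M.step (substituted s w)) M.initial (simulated s C) := by
  induction h with
  | refl => exact ⟨admissible_initial, by rw [simulated_initial]; exact Relation.ReflTransGen.refl⟩
  | tail _ h ih =>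
    refine ⟨ih.1.step h, ih.2.tail ?_⟩
    rw [Option.mem_def, step_simulated ih.1, Option.mem_def.1 h]
    rfl

theorem Outputs.substitute {v : List Y} (h : M.Outputs (substituted s w) v) :
    (M.substitute s).Outputs w v := by
  obtain ⟨C, hC, hhalt, rfl⟩ := h
  obtain ⟨C', hr, ha, rfl⟩ := exists_simulated hC
  refine ⟨C', hr, ?_, rfl⟩
  rwa [step_simulated ha, Option.map_eq_none_iff] at hhalt

theorem UsesSpaceAtMost.substitute {S : ℕ} (h : M.UsesSpaceAtMost (substituted s w) S) :
    (M.substitute s).UsesSpaceAtMost w S :=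
  fun _ hC => h _ (reaches_simulated hC).2

end Transducer

/-! ### The theorem -/

section NormalForm

variable {G X : Type} [Group G]

@[simp] theorem wordValue_nil (φ : X → G) : wordValue φ [] = 1 := rfl

@[simp] theorem wordValue_append (φ : X → G) (w w' : List X) :
    wordValue φ (w ++ w') = wordValue φ w * wordValue φ w' := by
  simp [wordValue]

@[simp] theorem wordValue_flatten_replicate (φ : X → G) (w : List X) (k : ℕ) :
    wordValue φ (List.replicate k w).flatten = wordValue φ w ^ k := by
  induction k with
  | zero => simp
  | succ k ih => rw [List.replicate_succ, List.flatten_cons, wordValue_append, ih, pow_succ']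

theorem IsSymmetricGenerating.exists_wordValue {φ : X → G} (hφ : IsSymmetricGenerating φ) (x : G) :
    ∃ w, wordValue φ w = x := by
  have hx : x ∈ Subgroup.closure (Set.range φ) := by rw [hφ.2]; trivial
  induction hx using Subgroup.closure_induction_right with
  | one => exact ⟨[], rfl⟩
  | mul_right x _ y hy h =>
    obtain ⟨w, rfl⟩ := h
    obtain ⟨a, rfl⟩ := hy
    exact ⟨w ++ [a], by simp [wordValue]⟩
  | mul_inv_cancel x _ y hy h =>
    obtain ⟨w, rfl⟩ := h
    obtain ⟨a, rfl⟩ := hy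
    obtain ⟨b, hb⟩ := hφ.1 a
    exact ⟨w ++ [b], by simp [wordValue, hb]⟩

/-- A logspace normal form is given by a logspace computable function that preserves the values of
words and is constant on the words of equal value. -/
theorem hasLogspaceNormalForm_of_invariant [Finite X] {φ : X → G} (hφ : IsSymmetricGenerating φ)
    {f : List X → List X} (hf : LogspaceComputable f)
    (hval : ∀ w, wordValue φ (f w) = wordValue φ w)
    (hinv : ∀ w w', wordValue φ w = wordValue φ w' → f w = f w') : HasLogspaceNormalForm φ := by
  refine ⟨Set.range f, f, ⟨fun _ _ => trivial, ?_, fun x _ => ?_⟩, hf, fun w => ⟨⟨w, rfl⟩, hval w⟩⟩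
  · rintro _ ⟨w, rfl⟩ _ ⟨w', rfl⟩ h
    rw [hval, hval] at h
    exact hinv w w' h
  · obtain ⟨w, rfl⟩ := hφ.exists_wordValue x
    exact ⟨f w, ⟨w, rfl⟩, hval w⟩

open TorusKnot Fragment

variable {N : Bool → ℕ} (𝒮 : Setting N G)

theorem wordValue_syllableWord {φ : X → G} {word : Bool → List X}
    (hword : ∀ t, wordValue φ (word t) = 𝒮.g t) (t : Bool) (es : List ℕ) :
    wordValue φ (syllableWord word t es) = 𝒮.syllables t es := by
  induction es generalizing t with
  | nil => rfl
  | cons e es ih =>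
    rw [syllableWord, wordValue_append, wordValue_flatten_replicate, hword, ih]
    rfl

theorem wordValue_centralWord {φ : X → G} {u u' : List X} {z : G} (hu : wordValue φ u = z)
    (hu' : wordValue φ u' = z⁻¹) (k : ℤ) : wordValue φ (centralWord u u' k) = z ^ k := by
  rw [centralWord]
  split_ifs with hk
  · rw [wordValue_flatten_replicate, hu, ← zpow_natCast, Int.toNat_of_nonneg hk]
  · rw [wordValue_flatten_replicate, hu', ← zpow_natCast, Int.toNat_of_nonneg (by omega),
      inv_zpow', neg_neg]

/-- The letter `Letter.one` pads words to a common length without changing their value. -/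
theorem prod_ofFn_getD (l : List Letter) {ℓ : ℕ} (hl : l.length ≤ ℓ) :
    ((List.ofFn fun t : Fin ℓ => l.getD t Letter.one).map 𝒮.letter).prod =
      (l.map 𝒮.letter).prod := by
  induction l generalizing ℓ with
  | nil => simp [Setting.letter]
  | cons a l ih =>
    obtain ⟨ℓ, rfl⟩ : ∃ ℓ', ℓ = ℓ' + 1 := ⟨ℓ - 1, by simp at hl; omega⟩
    rw [List.ofFn_succ, List.map_cons, List.prod_cons, List.map_cons, List.prod_cons]
    congr 1
    exact ih (by simpa using hl)

-- Input letters are expanded into words over `Letter`, while the output uses fixed words over `X`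
-- for the generators and for the inverse of the central element. The output depends only on the
-- exponents, which `eq_of_syllables_eq` shows to be determined by the group element.
include 𝒮 in
theorem TorusKnot.Setting.hasLogspaceNormalForm [Finite X] {φ : X → G}
    (hφ : IsSymmetricGenerating φ) : HasLogspaceNormalForm φ := by
  choose word hword using fun t => hφ.exists_wordValue (𝒮.g t)
  obtain ⟨u', hu'⟩ := hφ.exists_wordValue 𝒮.z⁻¹
  obtain ⟨M, c, hM⟩ := exists_transducer 𝒮 word u'
  choose l hl using fun x => 𝒮.exists_word (φ x)
  obtain ⟨L, hL⟩ := Finite.exists_le fun x => (l x).length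
  -- The length is `L + 1` rather than `L`, so that the blocks are nonempty even for `L = 0`.
  obtain ⟨s, hs⟩ : ∃ s : X → Fin (L + 1) → Letter, s = fun x t => (l x).getD t.1 Letter.one :=
    ⟨_, rfl⟩
  have hval : ∀ w, ((Transducer.substituted s w).map 𝒮.letter).prod = wordValue φ w := by
    intro w
    induction w with
    | nil => rfl
    | cons x w ih =>
      rw [Transducer.substituted, List.flatMap_cons, List.map_append, List.prod_append,
        wordValue, List.map_cons, List.prod_cons, ← hl x, ← prod_ofFn_getD 𝒮 (l x)
        ((hL x).trans (Nat.le_succ L))]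
      subst hs
      exact congrArg _ ih
  choose e es k he hes heq hout hspace using fun w => hM (Transducer.substituted s w)
  have hnormal : ∀ e es k, wordValue φ (normalWord word u' N e es k) =
      𝒮.syllables false (e :: es) * 𝒮.z ^ k := by
    intro e es k
    rw [normalWord, wordValue_append, wordValue_syllableWord 𝒮 hword,
      wordValue_centralWord (z := 𝒮.z) (by rw [wordValue_flatten_replicate, hword]; rfl) hu']
  refine hasLogspaceNormalForm_of_invariant hφ
    (f := fun w => normalWord word u' N (e w) (es w) (k w))
    ⟨M.substitute s, c * (L + 3), fun w => ⟨(hout w).substitute, fun C hC => ?_⟩⟩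
    (fun w => by rw [hnormal, ← heq, hval]) fun w w' hww => ?_
  · refine ((hspace w).substitute C hC).trans_le ?_
    rw [mul_assoc]
    refine Nat.mul_le_mul_left _ ?_
    rw [Transducer.substituted, List.length_flatMap_ofFn]
    -- Expansion multiplies the length by a constant and so adds only a constant to the logarithm.
    have hlog : Nat.log 2 ((L + 1) * w.length) ≤ (L + 1) + (Nat.log 2 w.length + 1) := by
      rw [← Nat.log_pow (b := 2) (by norm_num) ((L + 1) + (Nat.log 2 w.length + 1)), pow_add]
      exact Nat.log_mono_right (Nat.mul_le_mul Nat.lt_two_pow_self.le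
        (Nat.lt_pow_succ_log_self (by norm_num) _).le)
    nlinarith [Nat.zero_le (L * Nat.log 2 w.length)]
  · have h := (heq w).symm.trans (((hval w).trans (hww.trans (hval w').symm)).trans (heq w'))
    obtain ⟨h1, h2, h3⟩ := 𝒮.eq_of_syllables_eq (he w) (he w') (hes w) (hes w') h
    rw [h1, h2, h3]

end NormalForm

theorem mainTheorem12 (m n : ℕ) (hm : 0 < m) (hn : 0 < n)
    (X : Type) [Finite X] (φ : X → TorusKnotGroup m n) (hφ : IsSymmetricGenerating φ) :
    HasLogspaceNormalForm φ :=
  (TorusKnotGroup.setting m n hm hn).hasLogspaceNormalForm hφ
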